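/- There are a deterministic algorithm and a polynomial $T$ with the following property. Let $G$ be any finite simple graph (not necessarily connected) that contains none of $P_9$, $C_3$, $C_5$ as an induced subgraph, where $P_9$ is the path on $9$ vertices and $C_k$ is the cycle of length $k$. Given $G$, with vertices numbered $0,\dots,n-1$, by $n$ and its adjacency matrix, the algorithm halts after at most $T(n)$ steps, decides correctly whether $G$ is $3$-colourable, that is, whether its vertices can be assigned colours from a set of three so that adjacent vertices receive distinct colours, and outputs such a $3$-colouring of $G$ if one exists. (Steps are counted on a random access machine over the natural numbers whose arithmetic operations are addition and truncated subtraction, at unit cost, so that polynomial time has the same meaning as for Turing machines.) -/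

import Mathlib

/-!
# A random access machine with a step count, and its graph inputs

The machine has registers and arrays of natural numbers; a program mentions only finitely many of
them. Its only arithmetic operations are addition and truncated subtraction (no multiplication),
each of unit cost, so that a running time polynomial in the size of the input means the same as on
a Turing machine.
-/

namespace RAM

/-- A memory state: registers, and arrays of unbounded length, all holding natural numbers. -/
structure State where
  reg : ℕ → ℕ
  arr : ℕ → ℕ → ℕ

/-- Write a register. -/
def State.setReg (s : State) (x v : ℕ) : State :=
  ⟨Function.update s.reg x v, s.arr⟩

/-- Write one cell of an array. -/
def State.setArr (s : State) (a i v : ℕ) : State :=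
  ⟨s.reg, Function.update s.arr a (Function.update (s.arr a) i v)⟩

/-- Expressions: literals, registers, array cells (at a computed index), sum and truncated
difference. -/
inductive Expr where
  | const (k : ℕ)
  | reg (x : ℕ)
  | read (a : ℕ) (i : Expr)
  | add (e f : Expr)
  | sub (e f : Expr)

/-- The value of an expression in a state. -/
def Expr.eval (s : State) : Expr → ℕ
  | .const k => k
  | .reg x => s.reg x
  | .read a i => s.arr a (i.eval s)
  | .add e f => e.eval s + f.eval s
  | .sub e f => e.eval s - f.eval s

/-- The number of elementary steps for evaluating an expression: one for each operation in it. -/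
def Expr.cost : Expr → ℕ
  | .const _ => 1
  | .reg _ => 1
  | .read _ i => i.cost + 1
  | .add e f => e.cost + f.cost + 1
  | .sub e f => e.cost + f.cost + 1

/-- Programs. The tests in `ite` and `loop` (a while loop) ask whether the expression is nonzero. -/
inductive Program where
  | skip
  | assign (x : ℕ) (e : Expr)
  | store (a : ℕ) (i e : Expr)
  | seq (p q : Program)
  | ite (e : Expr) (p q : Program)
  | loop (e : Expr) (p : Program)

/-- `Exec p s s' t`: the program `p`, started in the state `s`, halts in the state `s'` after
exactly `t` elementary steps. -/
inductive Exec : Program → State → State → ℕ → Prop where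
  | skip (s : State) : Exec .skip s s 1
  | assign (s : State) (x : ℕ) (e : Expr) :
      Exec (.assign x e) s (s.setReg x (e.eval s)) (e.cost + 1)
  | store (s : State) (a : ℕ) (i e : Expr) :
      Exec (.store a i e) s (s.setArr a (i.eval s) (e.eval s)) (i.cost + e.cost + 1)
  | seq {p q : Program} {s s' s'' : State} {t t' : ℕ} :
      Exec p s s' t → Exec q s' s'' t' → Exec (.seq p q) s s'' (t + t')
  | ite_true {e : Expr} {p q : Program} {s s' : State} {t : ℕ} :
      e.eval s ≠ 0 → Exec p s s' t → Exec (.ite e p q) s s' (e.cost + 1 + t)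
  | ite_false {e : Expr} {p q : Program} {s s' : State} {t : ℕ} :
      e.eval s = 0 → Exec q s s' t → Exec (.ite e p q) s s' (e.cost + 1 + t)
  | loop_true {e : Expr} {p : Program} {s s' s'' : State} {t t' : ℕ} :
      e.eval s ≠ 0 → Exec p s s' t → Exec (.loop e p) s' s'' t' →
        Exec (.loop e p) s s'' (e.cost + 1 + t + t')
  | loop_false {e : Expr} {p : Program} {s : State} :
      e.eval s = 0 → Exec (.loop e p) s s (e.cost + 1)

/-- The machine is deterministic: the final state and the number of steps are determined by the
program and the initial state. -/
theorem Exec.deterministic {p : Program} {s s₁ s₂ : State} {t₁ t₂ : ℕ}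
    (h₁ : Exec p s s₁ t₁) (h₂ : Exec p s s₂ t₂) : s₁ = s₂ ∧ t₁ = t₂ := by
  induction h₁ generalizing s₂ t₂ with
  | skip | assign | store => cases h₂; exact ⟨rfl, rfl⟩
  | seq _ _ ih ih' =>
    cases h₂ with
    | seq k k' =>
      obtain ⟨rfl, rfl⟩ := ih k
      obtain ⟨rfl, rfl⟩ := ih' k'
      exact ⟨rfl, rfl⟩
  | ite_true h _ ih =>
    cases h₂ with
    | ite_true _ k => obtain ⟨rfl, rfl⟩ := ih k; exact ⟨rfl, rfl⟩
    | ite_false h' _ => exact absurd h' h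
  | ite_false h _ ih =>
    cases h₂ with
    | ite_true h' _ => exact absurd h h'
    | ite_false _ k => obtain ⟨rfl, rfl⟩ := ih k; exact ⟨rfl, rfl⟩
  | loop_true h _ _ ih ih' =>
    cases h₂ with
    | loop_true _ k k' =>
      obtain ⟨rfl, rfl⟩ := ih k
      obtain ⟨rfl, rfl⟩ := ih' k'
      exact ⟨rfl, rfl⟩
    | loop_false h' => exact absurd h' h
  | loop_false h =>
    cases h₂ with
    | loop_true h' _ _ => exact absurd h h'
    | loop_false _ => exact ⟨rfl, rfl⟩

open Classical in
/-- The initial state for a graph `G` with vertices `0, …, n - 1`: register `0` holds `n`, array `0`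
holds the adjacency matrix of `G` row by row (cell `u * n + v` is `1` if `u` and `v` are adjacent
and `0` otherwise), and everything else is `0`. -/
noncomputable def graphInput {n : ℕ} (G : SimpleGraph (Fin n)) : State where
  reg x := if x = 0 then n else 0
  arr a i := if a = 0 ∧ ∃ u v : Fin n, G.Adj u v ∧ i = u.val * n + v.val then 1 else 0

end RAM

/-- `G` is `H`-free: it has no induced subgraph isomorphic to `H`. -/
def IsInducedFree {V W : Type*} (H : SimpleGraph W) (G : SimpleGraph V) : Prop :=
  ¬ H.IsIndContained G

/-!
The algorithm treats each connected component on its own. It guesses at most 93 vertices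
together with their colours, derives from the guess a list of at most two colours for every vertex
of the component, and then looks for a colouring from these lists. There are polynomially many
guesses, and list colouring with lists of size two is a matter of eliminating the vertices one at a
time.

That this finds a colouring whenever there is one is `ShortOdd.exists_respects`. A shortest odd
closed walk in a component has length at least seven and no chords, so it has length seven or nine,
since a longer one would contain an induced path on nine vertices. If there is none, the component
is bipartite and the lists `{0, 1}` do. If its length is nine, then every vertex has a neighbour on
it, and it is enough to guess the colours of its vertices.

The main case is a cycle `c` of length seven. A vertex that is not *far* from `c`, that is, has a
neighbour on it, has one such neighbour or shares its two neighbours with a vertex of the cycle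
(`ShortOdd.trichotomy`), and sees a colour on the cycle. For far vertices the excluded path yields
the following. Two far neighbours of a far vertex have the same neighbours among the vertices that
are not far (`ShortOdd.far_link`), and the two sides of an edge between far vertices fold onto an
edge of the cycle (`ShortOdd.exists_dominates_edge`). At most 84 further vertices are such that each
far vertex without far neighbours either is adjacent to one of them, or has a neighbourhood that
some vertex of the cycle dominates (`ShortOdd.exists_cover`). A far vertex whose neighbourhood is
dominated by `c p` may be recoloured with the colour of `c p`. Hence a colouring can be changed such
that the colour of a far vertex that sees no guessed vertex is among those that each of its
neighbours with a neighbour on the cycle sees there, and these are at most two colours because the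
neighbour has a colour itself. If no neighbour has a neighbour on the cycle, then colour `2` can be
avoided, so the program just removes this colour from lists of size three. These lists depend on the
guess alone, and it does not matter which of the guessed vertices form the cycle, or that they do.

The constraints for lists of size two are binary relations. Eliminating a vertex `v` adds to each
pair of other vertices the constraint that some colour of `v` is compatible with both. Afterwards
the vertices can be coloured greedily in the opposite order: if both colours of `v` were excluded by
one coloured vertex each, the two together would violate a constraint (`LoopProg.Elim.sol_of_fits`).

The program is written in a language whose only loops are bounded by linear functions of the number
of vertices, so that its polynomial running time is read off from its syntax
(`LoopProg.LProg.exec_compile`). -/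

/-! ### Graphs without short odd closed walks and long induced paths -/

namespace ShortOdd

variable {V : Type*} {G : SimpleGraph V}

/-- `IsIndPath G l`: consecutive members of `l` are adjacent in `G` and no other two members are. -/
def IsIndPath (G : SimpleGraph V) : List V → Prop
  | [] => True
  | [_] => True
  | a :: b :: l => G.Adj a b ∧ (∀ x ∈ l, ¬G.Adj a x) ∧ IsIndPath G (b :: l)

/-- The local form of being `(P₉, C₃, C₅)`-free: no closed walks of length three or five, and no
induced path on nine vertices. -/
structure NoShort (G : SimpleGraph V) : Prop where
  tri : ∀ {a b c}, G.Adj a b → G.Adj b c → G.Adj c a → False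
  pent : ∀ {a b c d e}, G.Adj a b → G.Adj b c → G.Adj c d → G.Adj d e → G.Adj e a → False
  path : ∀ l : List V, IsIndPath G l → l.length = 9 → False

/-- A closed walk of length seven. -/
def Cyc (G : SimpleGraph V) (c : ZMod 7 → V) : Prop := ∀ i, G.Adj (c i) (c (i + 1))

/-- No neighbour on the cycle (so in particular not on it). -/
def Far (G : SimpleGraph V) (c : ZMod 7 → V) (v : V) : Prop := ∀ i, ¬G.Adj v (c i)

/-- The only neighbour on the cycle is `c j`. -/
def IsA (G : SimpleGraph V) (c : ZMod 7 → V) (j : ZMod 7) (v : V) : Prop :=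
  ∀ i, G.Adj v (c i) ↔ i = j

/-- The neighbours on the cycle are those of `c j`; in particular `c j` itself qualifies. -/
def IsB (G : SimpleGraph V) (c : ZMod 7 → V) (j : ZMod 7) (v : V) : Prop :=
  ∀ i, G.Adj v (c i) ↔ i = j + 1 ∨ i = j - 1

theorem Cyc.rot {c : ZMod 7 → V} (hc : Cyc G c) (k : ZMod 7) : Cyc G (fun i => c (i + k)) := by
  intro i
  have := hc (i + k)
  rwa [add_right_comm] at this

theorem Cyc.refl {c : ZMod 7 → V} (hc : Cyc G c) : Cyc G (fun i => c (-i)) := by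
  intro i
  have := hc (-i - 1)
  rw [sub_add_cancel] at this
  simpa [neg_add, sub_eq_add_neg, add_comm] using this.symm

theorem Cyc.adj_zero (H : NoShort G) {c : ZMod 7 → V} (hc : Cyc G c) (d : ZMod 7) :
    G.Adj (c 0) (c d) ↔ d = 1 ∨ d = 6 := by
  have h0 : G.Adj (c 0) (c 1) := hc 0
  have h1 : G.Adj (c 1) (c 2) := hc 1
  have h2 : G.Adj (c 2) (c 3) := hc 2
  have h3 : G.Adj (c 3) (c 4) := hc 3
  have h4 : G.Adj (c 4) (c 5) := hc 4
  have h5 : G.Adj (c 5) (c 6) := hc 5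
  have h6 : G.Adj (c 6) (c 0) := hc 6
  constructor
  · intro h
    have : ∀ d : ZMod 7, d = 0 ∨ d = 1 ∨ d = 2 ∨ d = 3 ∨ d = 4 ∨ d = 5 ∨ d = 6 := by decide
    rcases this d with rfl | rfl | rfl | rfl | rfl | rfl | rfl
    · exact (G.irrefl h).elim
    · exact Or.inl rfl
    · exact (H.tri h0 h1 h.symm).elim
    · exact (H.pent h h3 h4 h5 h6).elim
    · exact (H.pent h0 h1 h2 h3 h.symm).elim
    · exact (H.tri h h5 h6).elim
    · exact Or.inr rfl
  · rintro (rfl | rfl)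
    · exact h0
    · exact h6.symm

theorem Cyc.adj_iff (H : NoShort G) {c : ZMod 7 → V} (hc : Cyc G c) (i j : ZMod 7) :
    G.Adj (c i) (c j) ↔ j = i + 1 ∨ j = i - 1 := by
  have := (hc.rot i).adj_zero H (j - i)
  simp only [zero_add, sub_add_cancel] at this
  rw [this]
  clear this
  revert i j; decide

theorem Cyc.isB (H : NoShort G) {c : ZMod 7 → V} (hc : Cyc G c) (j : ZMod 7) : IsB G c j (c j) :=
  fun i => hc.adj_iff H j i

theorem trichotomy (H : NoShort G) {c : ZMod 7 → V} (hc : Cyc G c) (v : V) :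
    Far G c v ∨ (∃ j, IsA G c j v) ∨ ∃ j, IsB G c j v := by
  -- two neighbours of `v` on the cycle coincide or are two steps apart
  have key : ∀ i k, G.Adj v (c i) → G.Adj v (c k) → k = i ∨ k = i + 2 ∨ k = i - 2 := by
    have main : ∀ i d, G.Adj v (c i) → G.Adj v (c (d + i)) → d ≠ 1 ∧ d ≠ 3 := by
      intro i d hi hd
      have := hc.rot i
      constructor
      · rintro rfl
        have h0 : G.Adj (c (0 + i)) (c (1 + i)) := this 0
        rw [zero_add] at h0
        exact H.tri hi h0 hd.symm
      · rintro rfl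
        have h0 : G.Adj (c (0 + i)) (c (1 + i)) := this 0
        have h1 : G.Adj (c (1 + i)) (c (2 + i)) := this 1
        have h2 : G.Adj (c (2 + i)) (c (3 + i)) := this 2
        rw [zero_add] at h0
        exact H.pent hi h0 h1 h2 hd.symm
    intro i k hi hk
    have h1 := main i (k - i) hi (by simpa using hk)
    have h2 := main k (i - k) hk (by simpa using hi)
    revert h1 h2
    clear * -
    revert i k; decide
  by_cases hf : Far G c v
  · exact Or.inl hf
  · right
    simp only [Far, not_forall, not_not] at hf
    obtain ⟨i, hi⟩ := hf
    by_cases h2 : G.Adj v (c (i + 2))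
    · right
      refine ⟨i + 1, fun k => ⟨fun hk => ?_, ?_⟩⟩
      · have h1 := key i k hi hk
        have h3 := key (i + 2) k h2 hk
        revert h1 h3
        clear * -
        revert i k; decide
      · rintro (rfl | rfl)
        · have : i + 1 + 1 = i + 2 := by ring
          rwa [this]
        · rwa [add_sub_cancel_right]
    · by_cases h3 : G.Adj v (c (i - 2))
      · right
        refine ⟨i - 1, fun k => ⟨fun hk => ?_, ?_⟩⟩
        · have h1 := key i k hi hk
          have h3 := key (i - 2) k h3 hk
          revert h1 h3
          clear * -
          revert i k; decide
        · rintro (rfl | rfl)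
          · rwa [sub_add_cancel]
          · have : i - 1 - 1 = i - 2 := by ring
            rwa [this]
      · left
        refine ⟨i, fun k => ⟨fun hk => ?_, ?_⟩⟩
        · rcases key i k hi hk with rfl | rfl | rfl
          · rfl
          · exact (h2 hk).elim
          · exact (h3 hk).elim
        · rintro rfl; exact hi

theorem IsA.not_far {c : ZMod 7 → V} {j : ZMod 7} {v : V} (h : IsA G c j v) : ¬Far G c v :=
  fun hf => hf j ((h j).2 rfl)

theorem IsB.not_far {c : ZMod 7 → V} {j : ZMod 7} {v : V} (h : IsB G c j v) : ¬Far G c v :=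
  fun hf => hf (j + 1) ((h _).2 (Or.inl rfl))

theorem Far.rot {c : ZMod 7 → V} {v : V} (h : Far G c v) (k : ZMod 7) :
    Far G (fun i => c (i + k)) v := fun i => h (i + k)

theorem Far.refl {c : ZMod 7 → V} {v : V} (h : Far G c v) : Far G (fun i => c (-i)) v :=
  fun i => h (-i)

theorem IsA.rot {c : ZMod 7 → V} {j : ZMod 7} {v : V} (h : IsA G c j v) (k : ZMod 7) :
    IsA G (fun i => c (i + k)) (j - k) v := fun i => by
  rw [h (i + k)]; exact eq_sub_iff_add_eq.symm

theorem IsB.rot {c : ZMod 7 → V} {j : ZMod 7} {v : V} (h : IsB G c j v) (k : ZMod 7) :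
    IsB G (fun i => c (i + k)) (j - k) v := fun i => by
  rw [h (i + k)]; clear h; revert i j k; decide

theorem IsA.refl {c : ZMod 7 → V} {j : ZMod 7} {v : V} (h : IsA G c j v) :
    IsA G (fun i => c (-i)) (-j) v := fun i => by
  rw [h (-i)]; clear h; revert i j; decide

theorem IsB.refl {c : ZMod 7 → V} {j : ZMod 7} {v : V} (h : IsB G c j v) :
    IsB G (fun i => c (-i)) (-j) v := fun i => by
  rw [h (-i)]; clear h; revert i j; decide

section Cycle

variable {c : ZMod 7 → V}

/-- A vertex with a neighbour of type `IsA` that is itself far from the cycle has no neighbours far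
from the cycle: going once around the cycle would give an induced path on nine vertices. -/
theorem isA_far_far (H : NoShort G) (hc : Cyc G c) {x s a : V} {j : ZMod 7}
    (hx : Far G c x) (hs : Far G c s) (ha : IsA G c j a) (hxs : G.Adj x s) (hsa : G.Adj s a) :
    False := by
  have main : ∀ {c : ZMod 7 → V}, Cyc G c → Far G c x → Far G c s → IsA G c 0 a → False := by
    intro c hc hx hs ha
    refine H.path [x, s, a, c 0, c 1, c 2, c 3, c 4, c 5] ?_ rfl
    have hxa : ¬G.Adj x a := fun h => H.tri hxs hsa h.symm
    simp [IsIndPath, hxs, hsa, hxa, hx _, hs _, ha _, hc.adj_iff H]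
    decide
  exact main (hc.rot j) (hx.rot j) (hs.rot j) (by simpa using ha.rot j)

/-- Along a path `x, y, z` far from the cycle, every neighbour of `z` that is not far from the cycle
is a neighbour of `x`. -/
theorem far_link (H : NoShort G) (hc : Cyc G c) {x y z d : V} (hx : Far G c x) (hy : Far G c y)
    (hz : Far G c z) (hxy : G.Adj x y) (hyz : G.Adj y z) (hzd : G.Adj z d) (hd : ¬Far G c d) :
    G.Adj x d := by
  rcases trichotomy H hc d with h | ⟨j, h⟩ | ⟨j, h⟩
  · exact (hd h).elim
  · exact (isA_far_far H hc hy hz h hyz hzd).elim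
  by_contra hxd
  have main : ∀ {c : ZMod 7 → V}, Cyc G c → Far G c x → Far G c y → Far G c z → IsB G c 0 d →
      False := by
    intro c hc hx hy hz hd
    refine H.path [x, y, z, d, c 1, c 2, c 3, c 4, c 5] ?_ rfl
    have hxz : ¬G.Adj x z := fun h => H.tri hxy hyz h.symm
    have hyd : ¬G.Adj y d := fun h => H.tri hyz hzd h.symm
    simp [IsIndPath, hxy, hyz, hzd, hxz, hyd, hxd, hx _, hy _, hz _, hd _, hc.adj_iff H]
    decide
  exact main (hc.rot j) (hx.rot j) (hy.rot j) (hz.rot j) (by simpa using h.rot j)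

theorem common_nbr (H : NoShort G) (hc : Cyc G c) {s d e : V} {p q : ZMod 7} (hd : G.Adj s d)
    (he : G.Adj s e) (hp : G.Adj d (c p)) (hq : G.Adj e (c q)) : q ≠ p + 1 ∧ q ≠ p - 1 := by
  constructor
  · rintro rfl
    exact H.pent hd hp (hc p) hq.symm he.symm
  · rintro rfl
    have := hc (p - 1)
    rw [sub_add_cancel] at this
    exact H.pent hd hp this.symm hq.symm he.symm

theorem isA_isA (H : NoShort G) (hc : Cyc G c) {s d e : V} {i j : ZMod 7} (hd : G.Adj s d)
    (he : G.Adj s e) (hi : IsA G c i d) (hj : IsA G c j e) :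
    j = i ∨ j = i + 2 ∨ j = i - 2 ∨ j = i + 3 ∨ j = i - 3 := by
  have := common_nbr H hc hd he ((hi i).2 rfl) ((hj j).2 rfl)
  revert this
  clear * -
  revert i j; decide

theorem isA_isB (H : NoShort G) (hc : Cyc G c) {s d e : V} {i j : ZMod 7} (hd : G.Adj s d)
    (he : G.Adj s e) (hi : IsA G c i d) (hj : IsB G c j e) :
    i = j + 1 ∨ i = j - 1 ∨ i = j + 3 ∨ i = j - 3 := by
  have h1 := common_nbr H hc hd he ((hi i).2 rfl) ((hj (j + 1)).2 (Or.inl rfl))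
  have h2 := common_nbr H hc hd he ((hi i).2 rfl) ((hj (j - 1)).2 (Or.inr rfl))
  revert h1 h2
  clear * -
  revert i j; decide

theorem isB_isB (H : NoShort G) (hc : Cyc G c) {s d e : V} {i j : ZMod 7} (hd : G.Adj s d)
    (he : G.Adj s e) (hi : IsB G c i d) (hj : IsB G c j e) :
    j = i ∨ j = i + 2 ∨ j = i - 2 := by
  have h1 := common_nbr H hc hd he ((hi (i + 1)).2 (Or.inl rfl)) ((hj (j + 1)).2 (Or.inl rfl))
  have h2 := common_nbr H hc hd he ((hi (i + 1)).2 (Or.inl rfl)) ((hj (j - 1)).2 (Or.inr rfl))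
  have h3 := common_nbr H hc hd he ((hi (i - 1)).2 (Or.inr rfl)) ((hj (j + 1)).2 (Or.inl rfl))
  revert h1 h2 h3
  clear * -
  revert i j; decide

theorem isB_isB_edge (H : NoShort G) {s t d e : V} {i j : ZMod 7} (hst : G.Adj s t)
    (hd : G.Adj s d) (he : G.Adj t e) (hi : IsB G c i d) (hj : IsB G c j e) :
    j = i + 1 ∨ j = i - 1 ∨ j = i + 3 ∨ j = i - 3 := by
  have key : ∀ p, ¬(G.Adj d (c p) ∧ G.Adj e (c p)) :=
    fun p hp => H.pent hd hp.1 hp.2.symm he.symm hst.symm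
  have h1 := key (i + 1)
  have h2 := key (i - 1)
  simp only [hi _, hj _] at h1 h2
  revert h1 h2
  clear * -
  revert i j; decide

/-- A set of positions on the cycle that pairwise coincide or are two steps apart has at most two
elements. -/
theorem exists_pair {I : Set (ZMod 7)} (hI : I.Nonempty)
    (h : ∀ i ∈ I, ∀ j ∈ I, j = i ∨ j = i + 2 ∨ j = i - 2) :
    ∃ i ∈ I, ∃ j ∈ I, (j = i ∨ j = i + 2) ∧ ∀ k ∈ I, k = i ∨ k = j := by
  have step : ∀ i ∈ I, i + 2 ∈ I → ∃ i ∈ I, ∃ j ∈ I, (j = i ∨ j = i + 2) ∧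
      ∀ k ∈ I, k = i ∨ k = j := by
    intro i hi hi2
    refine ⟨i, hi, i + 2, hi2, Or.inr rfl, fun k hk => ?_⟩
    have h1 := h i hi k hk
    have h2 := h (i + 2) hi2 k hk
    revert h1 h2
    clear * -
    revert i k; decide
  obtain ⟨i, hi⟩ := hI
  by_cases h2 : i + 2 ∈ I
  · exact step i hi h2
  by_cases h3 : i - 2 ∈ I
  · exact step (i - 2) h3 (by rwa [sub_add_cancel])
  refine ⟨i, hi, i, hi, Or.inl rfl, fun k hk => ?_⟩
  rcases h i hi k hk with rfl | rfl | rfl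
  · exact Or.inl rfl
  · exact (h2 hk).elim
  · exact (h3 hk).elim

/-- The neighbours of `v` that are not far from the cycle. -/
def Near (G : SimpleGraph V) (c : ZMod 7 → V) (v : V) : Set V := {d | G.Adj v d ∧ ¬Far G c d}

/-- `c p` is adjacent to every vertex of `K`. -/
def Dominates (G : SimpleGraph V) (c : ZMod 7 → V) (p : ZMod 7) (K : Set V) : Prop :=
  ∀ d ∈ K, G.Adj (c p) d

theorem dominates_of_isB {K : Set V} {I : Set (ZMod 7)} {p : ZMod 7}
    (hK : ∀ d ∈ K, ∃ i ∈ I, IsB G c i d) (hp : ∀ i ∈ I, p = i + 1 ∨ p = i - 1) :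
    Dominates G c p K := by
  intro d hd
  obtain ⟨i, hi, h⟩ := hK d hd
  exact ((h p).2 (hp i hi)).symm

/-- The positions of the neighbours of type `IsB`. -/
def idxB (G : SimpleGraph V) (c : ZMod 7 → V) (v : V) : Set (ZMod 7) :=
  {i | ∃ d, G.Adj v d ∧ IsB G c i d}

theorem idxB_pair (H : NoShort G) (hc : Cyc G c) {v : V} (hv : (idxB G c v).Nonempty) :
    ∃ i ∈ idxB G c v, ∃ j ∈ idxB G c v, (j = i ∨ j = i + 2) ∧ ∀ k ∈ idxB G c v, k = i ∨ k = j :=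
  exists_pair hv fun _ ⟨_, h1, h2⟩ _ ⟨_, h3, h4⟩ => isB_isB H hc h1 h3 h2 h4

theorem near_isB (H : NoShort G) (hc : Cyc G c) {s : V} (hA : ∀ j a, G.Adj s a → ¬IsA G c j a) :
    ∀ d ∈ Near G c s, ∃ i ∈ idxB G c s, IsB G c i d := by
  intro d hd
  rcases trichotomy H hc d with h | ⟨j, h⟩ | ⟨j, h⟩
  · exact (hd.2 h).elim
  · exact (hA j d hd.1 h).elim
  · exact ⟨j, ⟨d, hd.1, h⟩, h⟩

theorem exists_dominates (H : NoShort G) (hc : Cyc G c) {s : V}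
    (hA : ∀ j a, G.Adj s a → ¬IsA G c j a) : ∃ p, Dominates G c p (Near G c s) := by
  by_cases hne : (idxB G c s).Nonempty
  · obtain ⟨i, -, j, -, hij, hk⟩ := idxB_pair H hc hne
    refine ⟨i + 1, dominates_of_isB (near_isB H hc hA) fun k hk' => ?_⟩
    have := hk k hk'
    revert hij this
    clear * -
    revert i j k; decide
  · refine ⟨0, fun d hd => ?_⟩
    obtain ⟨i, hi, -⟩ := near_isB H hc hA d hd
    exact (hne ⟨i, hi⟩).elim

/-- The two sides of an edge far from the cycle fold onto an edge of the cycle. -/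
theorem exists_dominates_edge (H : NoShort G) (hc : Cyc G c) {s t : V} (hs : Far G c s)
    (ht : Far G c t) (hst : G.Adj s t) (hKs : (Near G c s).Nonempty) (hKt : (Near G c t).Nonempty) :
    ∃ p q, G.Adj (c p) (c q) ∧ Dominates G c p (Near G c s) ∧ Dominates G c q (Near G c t) := by
  have hAs : ∀ j a, G.Adj s a → ¬IsA G c j a :=
    fun j a h1 h2 => isA_far_far H hc ht hs h2 hst.symm h1
  have hAt : ∀ j a, G.Adj t a → ¬IsA G c j a :=
    fun j a h1 h2 => isA_far_far H hc hs ht h2 hst h1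
  have hBs := near_isB H hc hAs
  have hBt := near_isB H hc hAt
  obtain ⟨i, hi, i', hi', hii, hI⟩ := idxB_pair H hc (v := s)
    (by obtain ⟨d, hd⟩ := hKs; obtain ⟨i, hi, -⟩ := hBs d hd; exact ⟨i, hi⟩)
  obtain ⟨j, hj, j', hj', hjj, hJ⟩ := idxB_pair H hc (v := t)
    (by obtain ⟨d, hd⟩ := hKt; obtain ⟨i, hi, -⟩ := hBt d hd; exact ⟨i, hi⟩)
  have cross : ∀ i ∈ idxB G c s, ∀ j ∈ idxB G c t,
      j = i + 1 ∨ j = i - 1 ∨ j = i + 3 ∨ j = i - 3 :=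
    fun _ ⟨_, h1, h2⟩ _ ⟨_, h3, h4⟩ => isB_isB_edge H hst h1 h3 h2 h4
  have h1 := cross i hi j hj
  have h2 := cross i hi j' hj'
  have h3 := cross i' hi' j hj
  have h4 := cross i' hi' j' hj'
  have : ∃ p q : ZMod 7, (q = p + 1 ∨ q = p - 1) ∧ (p = i + 1 ∨ p = i - 1) ∧
      (p = i' + 1 ∨ p = i' - 1) ∧ (q = j + 1 ∨ q = j - 1) ∧ (q = j' + 1 ∨ q = j' - 1) := by
    rcases hii with h | h <;> rcases hjj with h' | h' <;> simp only [h, h'] at h1 h2 h3 h4 ⊢ <;>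
      revert h1 h2 h3 h4 <;> clear * - <;> revert i j <;> decide
  obtain ⟨p, q, hpq, hp, hp', hq, hq'⟩ := this
  refine ⟨p, q, (hc.adj_iff H p q).2 hpq, dominates_of_isB hBs fun k hk => ?_,
    dominates_of_isB hBt fun k hk => ?_⟩
  · rcases hI k hk with rfl | rfl <;> assumption
  · rcases hJ k hk with rfl | rfl <;> assumption

end Cycle

/-- A far vertex with a neighbour of type `IsA` at position `0` is adjacent to every vertex of this
type at position `2`. -/
theorem adj_of_isA_two (H : NoShort G) {c : ZMod 7 → V} (hc : Cyc G c) {s a a' : V}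
    (hs : Far G c s) (ha : IsA G c 0 a) (ha' : IsA G c 2 a') (hsa : G.Adj s a) : G.Adj s a' := by
  by_contra hsa'
  refine H.path [s, a, c 0, c 6, c 5, c 4, c 3, c 2, a'] ?_ rfl
  have haa : ¬G.Adj a a' := fun h =>
    H.pent ((ha 0).2 rfl) (hc 0) (hc 1) ((ha' 2).2 rfl).symm h.symm
  have ha'' : ∀ i, G.Adj (c i) a' ↔ i = 2 := fun i => by rw [G.adj_comm]; exact ha' i
  simp [IsIndPath, hsa, hsa', haa, hs _, ha _, ha'', hc.adj_iff H]
  decide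

/-- If `N(x) ∩ X` is as large as possible among the `x` in two classes `P`, `Q` whose traces on `X`
are comparable across the classes, and each member of `X` has neighbours in both classes, then `x`
is adjacent to all of `X`. -/
theorem exists_cover_of_nested [Finite V] {P Q X : V → Prop}
    (hP : ∀ s, X s → ∃ a, P a ∧ G.Adj s a) (hQ : ∀ s, X s → ∃ b, Q b ∧ G.Adj s b)
    (hne : ∃ s, X s)
    (h : ∀ s t a b, X s → X t → P a → Q b → G.Adj s a → G.Adj t b → G.Adj s b ∨ G.Adj t a) :
    ∃ v, (P v ∨ Q v) ∧ ∀ s, X s → G.Adj s v := by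
  classical
  cases nonempty_fintype V
  obtain ⟨s0, hs0⟩ := hne
  obtain ⟨a0, ha0, -⟩ := hP s0 hs0
  obtain ⟨v, hv, hmax⟩ := Finset.exists_max_image (Finset.univ.filter fun v => P v ∨ Q v)
    (fun v => (Finset.univ.filter fun s => X s ∧ G.Adj s v).card) ⟨a0, by simp [ha0]⟩
  simp only [Finset.mem_filter, Finset.mem_univ, true_and] at hv hmax
  refine ⟨v, hv, fun t ht => ?_⟩
  by_contra htv
  -- a neighbour of the uncovered `t` in the opposite class has a strictly larger trace
  have big : ∀ w, (P w ∨ Q w) → G.Adj t w → (∀ s, X s → G.Adj s v → G.Adj s w) → False := by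
    intro w hw htw hsub
    refine absurd (hmax w hw) (not_le.2 (Finset.card_lt_card ?_))
    refine Finset.ssubset_iff_subset_ne.2 ⟨fun s hs => ?_, fun he => ?_⟩
    · simp only [Finset.mem_filter, Finset.mem_univ, true_and] at hs ⊢
      exact ⟨hs.1, hsub s hs.1 hs.2⟩
    · have : t ∈ Finset.univ.filter fun s => X s ∧ G.Adj s w := by simp [ht, htw]
      rw [← he] at this
      simp [htv] at this
  rcases hv with hv | hv
  · obtain ⟨b, hb, htb⟩ := hQ t ht
    exact big b (Or.inr hb) htb fun s hs hsv =>
      (h s t v b hs ht hv hb hsv htb).resolve_right htv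
  · obtain ⟨a, ha, hta⟩ := hP t ht
    exact big a (Or.inl ha) hta fun s hs hsv =>
      (h t s a v ht hs ha hv hta hsv).resolve_left htv

/-- One vertex is adjacent to all the far vertices that have neighbours of type `IsA` at both of the
positions `0` and `3`. -/
theorem exists_cover_isA_isA [Finite V] (H : NoShort G) {c : ZMod 7 → V} (hc : Cyc G c) :
    ∃ v, (G.Adj v (c 0) ∨ G.Adj v (c 3)) ∧ ∀ s, Far G c s → (∃ a, IsA G c 0 a ∧ G.Adj s a) →
      (∃ a, IsA G c 3 a ∧ G.Adj s a) → G.Adj s v := by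
  by_cases hX : ∃ s, Far G c s ∧ (∃ a, IsA G c 0 a ∧ G.Adj s a) ∧ ∃ a, IsA G c 3 a ∧ G.Adj s a
  · obtain ⟨v, hv, h⟩ := exists_cover_of_nested (G := G) (P := IsA G c 0) (Q := IsA G c 3)
      (X := fun s => Far G c s ∧ (∃ a, IsA G c 0 a ∧ G.Adj s a) ∧ ∃ a, IsA G c 3 a ∧ G.Adj s a)
      (fun s hs => hs.2.1) (fun s hs => hs.2.2) hX (by
        rintro s t a b ⟨hs, -, -⟩ ⟨ht, ⟨a2, ha2, hta2⟩, -⟩ ha hb hsa htb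
        by_contra hcon
        push Not at hcon
        obtain ⟨hsb, hta⟩ := hcon
        have hab : ¬G.Adj a b := fun h =>
          H.pent h htb.symm hta2 ((ha2 0).2 rfl) ((ha 0).2 rfl).symm
        have hst : ¬G.Adj s t := fun h => isA_far_far H hc hs ht hb h htb
        have hat : ¬G.Adj a t := fun h => hta h.symm
        refine H.path [s, a, c 0, c 6, c 5, c 4, c 3, b, t] ?_ rfl
        have hb' : ∀ i, G.Adj (c i) b ↔ i = 3 := fun i => by rw [G.adj_comm]; exact hb i
        have ht' : ∀ i, ¬G.Adj (c i) t := fun i h => ht i h.symm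
        simp [IsIndPath, hsa, hsb, hst, hab, hat, htb.symm, hs _, ha _, hb', ht', hc.adj_iff H]
        decide)
    refine ⟨v, ?_, fun s h1 h2 h3 => h s ⟨h1, h2, h3⟩⟩
    rcases hv with hv | hv
    · exact Or.inl ((hv 0).2 rfl)
    · exact Or.inr ((hv 3).2 rfl)
  · exact ⟨c 1, Or.inl (hc 0).symm, fun s h1 h2 h3 => (hX ⟨s, h1, h2, h3⟩).elim⟩

/-- At most five vertices, none of them far from the cycle, dominate the far vertices that have a
neighbour of type `IsA` at position `3` and one of type `IsB` at position `0`. Two neighbours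
`a`, `b` of such a vertex `s` close up to another cycle of length seven, through `s`, `a` and four
vertices of the given cycle; most of the other vertices in question have neighbours of type `IsA` on
both sides of the new cycle, and `exists_cover_isA_isA` applies to them. -/
theorem exists_cover_isA_isB [Finite V] (H : NoShort G) {c : ZMod 7 → V} (hc : Cyc G c) :
    ∃ W : Finset V, W.card ≤ 5 ∧ (∀ w ∈ W, ¬Far G c w) ∧ ∀ s, Far G c s →
      (∃ a, IsA G c 3 a ∧ G.Adj s a) → (∃ b, IsB G c 0 b ∧ G.Adj s b) → ∃ w ∈ W, G.Adj s w := by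
  classical
  cases nonempty_fintype V
  let X : V → Prop := fun s => Far G c s ∧ (∃ a, IsA G c 3 a ∧ G.Adj s a) ∧
    ∃ b, IsB G c 0 b ∧ G.Adj s b
  let NA : V → Finset V := fun s => Finset.univ.filter fun a => IsA G c 3 a ∧ G.Adj s a
  let NB : V → Finset V := fun s => Finset.univ.filter fun b => IsB G c 0 b ∧ G.Adj s b
  have hNA : ∀ {s a}, a ∈ NA s ↔ IsA G c 3 a ∧ G.Adj s a := by intro s a; simp [NA]
  have hNB : ∀ {s b}, b ∈ NB s ↔ IsB G c 0 b ∧ G.Adj s b := by intro s b; simp [NB]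
  -- the two classes are independent, and no edges run between them
  have hAB : ∀ {a b}, IsA G c 3 a → IsB G c 0 b → ¬G.Adj a b := fun ha hb h =>
    H.pent h ((hb 1).2 (by decide)) (hc 1) (hc 2) ((ha 3).2 rfl).symm
  have hBB : ∀ {b b'}, IsB G c 0 b → IsB G c 0 b' → ¬G.Adj b b' := fun hb hb' h =>
    H.tri h ((hb' 1).2 (by decide)) ((hb 1).2 (by decide)).symm
  have hAA : ∀ {a a'}, IsA G c 3 a → IsA G c 3 a' → ¬G.Adj a a' := fun ha ha' h =>
    H.tri h ((ha' 3).2 rfl) ((ha 3).2 rfl).symm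
  have hXX : ∀ {s t}, X s → Far G c t → ¬G.Adj s t := fun hs ht h => by
    obtain ⟨a, ha, hsa⟩ := hs.2.1
    exact isA_far_far H hc ht hs.1 ha h.symm hsa
  by_cases hX : ∃ s, X s
  swap
  · exact ⟨∅, by simp, by simp, fun s h1 h2 h3 => (hX ⟨s, h1, h2, h3⟩).elim⟩
  obtain ⟨s0, hs0, hmin⟩ := Finset.exists_min_image (Finset.univ.filter X) (fun s => (NA s).card)
    (by obtain ⟨s, hs⟩ := hX; exact ⟨s, by simp [hs]⟩)
  simp only [Finset.mem_filter, Finset.mem_univ, true_and] at hs0 hmin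
  obtain ⟨a0, ha0, hsa0⟩ := hs0.2.1
  obtain ⟨b0, hb0, hsb0⟩ := hs0.2.2
  let c' : ZMod 7 → V := (![c 6, c 5, c 4, c 3, a0, s0, b0] : Fin 7 → V)
  have cases7 : ∀ {P : ZMod 7 → Prop}, P 0 → P 1 → P 2 → P 3 → P 4 → P 5 → P 6 → ∀ i, P i := by
    intro P h0 h1 h2 h3 h4 h5 h6 i
    have : ∀ d : ZMod 7, d = 0 ∨ d = 1 ∨ d = 2 ∨ d = 3 ∨ d = 4 ∨ d = 5 ∨ d = 6 := by decide
    rcases this i with rfl | rfl | rfl | rfl | rfl | rfl | rfl <;> assumption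
  have hc' : Cyc G c' := by
    refine cases7 ?_ ?_ ?_ ?_ ?_ ?_ ?_
    · exact (hc 5).symm
    · exact (hc 4).symm
    · exact (hc 3).symm
    · exact ((ha0 3).2 rfl).symm
    · exact hsa0.symm
    · exact hsb0
    · exact (hb0 6).2 (by decide)
  obtain ⟨v, hv, hcov⟩ := exists_cover_isA_isA H hc'
  have hvf : ¬Far G c v := by
    rcases hv with h | h
    · exact fun hf => hf 6 h
    · exact fun hf => hf 3 h
  have hcov' : ∀ s, X s → ¬G.Adj s a0 → ¬G.Adj s b0 → (∃ a ∈ NA s, ¬G.Adj s0 a) →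
      (∃ b ∈ NB s, ¬G.Adj s0 b) → G.Adj s v := by
    rintro s hs hsa hsb ⟨a, ha, hna⟩ ⟨b, hb, hnb⟩
    rw [hNA] at ha
    rw [hNB] at hb
    have e1 : ∀ i, ¬G.Adj s (c i) := hs.1
    have e2 : ¬G.Adj s s0 := hXX hs hs0.1
    have e3 : ∀ i, G.Adj a (c i) ↔ i = 3 := ha.1
    have e4 : ∀ i, G.Adj b (c i) ↔ i = 0 + 1 ∨ i = 0 - 1 := hb.1
    refine hcov s ?_ ⟨b, ?_, hb.2⟩ ⟨a, ?_, ha.2⟩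
    · refine cases7 ?_ ?_ ?_ ?_ ?_ ?_ ?_ <;> simp [c', e1, e2, hsa, hsb]
    · have e5 := hBB hb.1 hb0
      have e6 : ¬G.Adj b a0 := fun h => hAB ha0 hb.1 h.symm
      have e7 : ¬G.Adj b s0 := fun h => hnb h.symm
      refine cases7 ?_ ?_ ?_ ?_ ?_ ?_ ?_ <;> simp [c', e4, e5, e6, e7] <;> decide
    · have e5 := hAB ha.1 hb0
      have e6 := hAA ha.1 ha0
      have e7 : ¬G.Adj a s0 := fun h => hna h.symm
      refine cases7 ?_ ?_ ?_ ?_ ?_ ?_ ?_ <;> simp [c', e3, e5, e6, e7] <;> decide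
  -- the vertices that `a0`, `b0` and `v` do not dominate
  let R : V → Prop := fun s => X s ∧ ¬G.Adj s a0 ∧ ¬G.Adj s b0 ∧ ¬G.Adj s v
  have hR : ∀ s, R s → (∃ a ∈ NA s, ¬G.Adj s0 a) ∧ ∀ b ∈ NB s, G.Adj s0 b := by
    rintro s ⟨hs, h1, h2, h3⟩
    have hA : ∃ a ∈ NA s, ¬G.Adj s0 a := by
      by_contra hcon
      push Not at hcon
      have hsub : NA s ⊆ NA s0 := fun a ha => hNA.2 ⟨(hNA.1 ha).1, hcon a ha⟩
      have := Finset.eq_of_subset_of_card_le hsub (hmin s hs)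
      exact h1 (hNA.1 (this ▸ hNA.2 ⟨ha0, hsa0⟩ : a0 ∈ NA s)).2
    refine ⟨hA, fun b hb => ?_⟩
    by_contra hcon
    exact h3 (hcov' s hs h1 h2 hA ⟨b, hb, hcon⟩)
  by_cases hRne : ∃ s, R s
  swap
  · refine ⟨{a0, b0, v}, Finset.card_le_three.trans (by norm_num), ?_, fun s h1 h2 h3 => ?_⟩
    · simp [ha0.not_far, hb0.not_far, hvf]
    · by_contra hcon
      simp at hcon
      exact hRne ⟨s, ⟨h1, h2, h3⟩, hcon⟩
  obtain ⟨s1, hs1, hmin1⟩ := Finset.exists_min_image (Finset.univ.filter R) (fun s => (NB s).card)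
    (by obtain ⟨s, hs⟩ := hRne; exact ⟨s, by simp [hs]⟩)
  simp only [Finset.mem_filter, Finset.mem_univ, true_and] at hs1 hmin1
  obtain ⟨b1, hb1, hsb1⟩ := hs1.1.2.2
  obtain ⟨⟨a1, ha1, hna1⟩, hB1⟩ := hR s1 hs1
  rw [hNA] at ha1
  refine ⟨{a0, b0, v, a1, b1}, Finset.card_le_five, ?_, fun s h1 h2 h3 => ?_⟩
  · simp [ha0.not_far, hb0.not_far, hvf, ha1.1.not_far, hb1.not_far]
  by_contra hcon
  simp only [Finset.mem_insert, Finset.mem_singleton, exists_eq_or_imp, exists_eq_left,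
    not_or] at hcon
  obtain ⟨k1, k2, k3, k4, k5⟩ := hcon
  have hRs : R s := ⟨⟨h1, h2, h3⟩, k1, k2, k3⟩
  obtain ⟨b2, hb2, hn2⟩ : ∃ b ∈ NB s, ¬G.Adj s1 b := by
    by_contra hall
    push Not at hall
    have hsub : NB s ⊆ NB s1 := fun b hb => hNB.2 ⟨(hNB.1 hb).1, hall b hb⟩
    have := Finset.eq_of_subset_of_card_le hsub (hmin1 s hRs)
    exact k5 (hNB.1 (this ▸ hNB.2 ⟨hb1, hsb1⟩ : b1 ∈ NB s)).2
  have hs0b2 := (hR s hRs).2 b2 hb2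
  have hs0b1 := hB1 b1 (hNB.2 ⟨hb1, hsb1⟩)
  rw [hNB] at hb2
  have m1 : ¬G.Adj a1 b1 := hAB ha1.1 hb1
  have m2 : ¬G.Adj a1 b2 := hAB ha1.1 hb2.1
  have m3 : ¬G.Adj b1 b2 := hBB hb1 hb2.1
  have m4 : ¬G.Adj s1 s0 := hXX hs1.1 hs0.1
  have m5 : ¬G.Adj s1 s := hXX hs1.1 h1
  have m6 : ¬G.Adj s0 s := hXX hs0 h1
  have m7 : ¬G.Adj a1 s0 := fun h => hna1 h.symm
  have m8 : ¬G.Adj a1 s := fun h => k4 h.symm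
  have m9 : ¬G.Adj b1 s := fun h => k5 h.symm
  have ca : ∀ i, G.Adj (c i) a1 ↔ i = 3 := fun i => by rw [G.adj_comm]; exact ha1.1 i
  have cb1 : ∀ i, G.Adj (c i) b1 ↔ i = 0 + 1 ∨ i = 0 - 1 := fun i => by
    rw [G.adj_comm]; exact hb1 i
  have cb2 : ∀ i, G.Adj (c i) b2 ↔ i = 0 + 1 ∨ i = 0 - 1 := fun i => by
    rw [G.adj_comm]; exact hb2.1 i
  have cs : ∀ {s}, Far G c s → ∀ i, ¬G.Adj (c i) s := fun hs i h => hs i h.symm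
  refine H.path [c 5, c 4, c 3, a1, s1, b1, s0, b2, s] ?_ rfl
  simp [IsIndPath, m1, m2, m3, m4, m5, m6, m7, m8, m9, ca, cb1, cb2, cs h1, cs hs0.1, cs hs1.1.1,
    hc.adj_iff H, ha1.2.symm, hsb1, hs0b1.symm, hs0b2, hn2, hb2.2.symm]
  decide

/-! ### Recolouring the vertices far from a cycle of length seven -/

/-- For each position `k` there are at most twelve vertices, none of them far from the cycle, such
that the following neighbours `d`, `e` of a far vertex `s` do not occur unless `s` is adjacent to
one of the twelve: `d` of type `IsA` at `k` and `e` of type `IsA` at `k + 2` or `k + 3`, or `d` of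
type `IsB` at `k` and `e` of type `IsA` at `k ± 3`. In all other cases `d` and `e` have a common
neighbour on the cycle. -/
theorem exists_cover_at [Finite V] (H : NoShort G) {c : ZMod 7 → V} (hc : Cyc G c) (k : ZMod 7) :
    ∃ W : Finset V, W.card ≤ 12 ∧ (∀ w ∈ W, ¬Far G c w) ∧ ∀ s, Far G c s →
      (∀ w ∈ W, ¬G.Adj s w) → ∀ d e, G.Adj s d → G.Adj s e →
        ((IsA G c k d ∧ ¬IsA G c (k + 2) e ∧ ¬IsA G c (k + 3) e) ∨
          (IsB G c k d ∧ ¬IsA G c (k + 3) e ∧ ¬IsA G c (k - 3) e) ∨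
            ¬IsA G c k d ∧ ¬IsB G c k d) := by
  classical
  obtain ⟨W, hWc, hWf, hW⟩ := exists_cover_isA_isB H (hc.rot k)
  obtain ⟨W', hWc', hWf', hW'⟩ := exists_cover_isA_isB H ((hc.rot k).refl)
  obtain ⟨v, hvf, hv⟩ := exists_cover_isA_isA H (hc.rot k)
  obtain ⟨x, hxf, hx⟩ : ∃ x, ¬Far G c x ∧ ((∃ a, IsA G c (k + 2) a) → IsA G c (k + 2) x) := by
    by_cases h : ∃ a, IsA G c (k + 2) a
    · obtain ⟨a, ha⟩ := h
      exact ⟨a, ha.not_far, fun _ => ha⟩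
    · exact ⟨c 0, (hc.isB H 0).not_far, fun h' => (h h').elim⟩
  refine ⟨insert x (insert v (W ∪ W')), ?_, ?_, ?_⟩
  · have h1 := Finset.card_insert_le x (insert v (W ∪ W'))
    have h2 := Finset.card_insert_le v (W ∪ W')
    have h3 := Finset.card_union_le W W'
    omega
  · intro w hw
    simp only [Finset.mem_insert, Finset.mem_union] at hw
    rcases hw with rfl | rfl | hw | hw
    · exact hxf
    · rcases hvf with h | h
      · exact fun hf => hf _ h
      · exact fun hf => hf _ h
    · exact fun hf => hWf w hw (hf.rot k)
    · exact fun hf => hWf' w hw (hf.rot k).refl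
  · intro s hs hsW d e hd he
    have n1 : ¬G.Adj s x := hsW x (by simp)
    have n2 : ¬G.Adj s v := hsW v (by simp)
    have n3 : ∀ w ∈ W, ¬G.Adj s w := fun w hw => hsW w (by simp [hw])
    have n4 : ∀ w ∈ W', ¬G.Adj s w := fun w hw => hsW w (by simp [hw])
    by_cases hdA : IsA G c k d
    · left
      have hd0 : IsA G (fun i => c (i + k)) 0 d := by simpa using hdA.rot k
      refine ⟨hdA, fun hA => ?_, fun hA => ?_⟩
      · have := (hx ⟨e, hA⟩).rot k
        rw [add_sub_cancel_left] at this
        exact n1 (adj_of_isA_two H (hc.rot k) (hs.rot k) hd0 this hd)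
      · have he3 := hA.rot k
        rw [add_sub_cancel_left] at he3
        exact n2 (hv s (hs.rot k) ⟨d, hd0, hd⟩ ⟨e, he3, he⟩)
    by_cases hdB : IsB G c k d
    · right; left
      have hd0 : IsB G (fun i => c (i + k)) 0 d := by simpa using hdB.rot k
      refine ⟨hdB, fun hA => ?_, fun hA => ?_⟩
      · have he3 := hA.rot k
        rw [add_sub_cancel_left] at he3
        obtain ⟨w, hw, hsw⟩ := hW s (hs.rot k) ⟨e, he3, he⟩ ⟨d, hd0, hd⟩
        exact n3 w hw hsw
      · have he3 := (hA.rot k).refl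
        have hd1 := hd0.refl
        have e1 : -(k - 3 - k) = 3 := by ring
        rw [e1] at he3
        rw [neg_zero] at hd1
        obtain ⟨w, hw, hsw⟩ := hW' s (hs.rot k).refl ⟨e, he3, he⟩ ⟨d, hd1, hd⟩
        exact n4 w hw hsw
    · exact Or.inr (Or.inr ⟨hdA, hdB⟩)

/-- A bounded number of vertices, none far from the cycle, such that each far vertex without far
neighbours is adjacent to one of them or is dominated by a vertex of the cycle. -/
theorem exists_cover [Finite V] (H : NoShort G) {c : ZMod 7 → V} (hc : Cyc G c) :
    ∃ W : Finset V, W.card ≤ 84 ∧ (∀ w ∈ W, ¬Far G c w) ∧ ∀ s, Far G c s →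
      (∀ w ∈ W, ¬G.Adj s w) → ∃ p, Dominates G c p (Near G c s) := by
  classical
  choose W hWc hWf hW using exists_cover_at H hc
  refine ⟨Finset.univ.biUnion W, ?_, ?_, ?_⟩
  · have := Finset.card_biUnion_le_card_mul Finset.univ W 12 (fun k _ => hWc k)
    simpa [ZMod.card] using this
  · intro w hw
    obtain ⟨k, -, hk⟩ := Finset.mem_biUnion.1 hw
    exact hWf k w hk
  · intro s hs hsW
    have hW' := fun k => hW k s hs
      (fun w hw => hsW w (Finset.mem_biUnion.2 ⟨k, Finset.mem_univ _, hw⟩))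
    by_cases hA : ∃ j a, G.Adj s a ∧ IsA G c j a
    · obtain ⟨j, a, hsa, ha⟩ := hA
      refine ⟨j, fun d hd => ?_⟩
      rcases trichotomy H hc d with h | ⟨i, h⟩ | ⟨i, h⟩
      · exact (hd.2 h).elim
      · -- both neighbours have type `IsA`
        have h1 := hW' i d a hd.1 hsa
        have h2 := hW' j a d hsa hd.1
        have nAB : ∀ {v k}, IsA G c k v → ¬IsB G c k v := fun {v k} hv hv' => by
          have := (hv (k + 1)).1 ((hv' _).2 (Or.inl rfl))
          revert this; clear * -; revert k; decide
        rcases isA_isA H hc hd.1 hsa h ha with rfl | rfl | rfl | rfl | rfl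
        · exact ((h _).2 rfl).symm
        · rcases h1 with h1 | h1 | h1
          · exact (h1.2.1 ha).elim
          · exact (nAB h h1.1).elim
          · exact (h1.1 h).elim
        · rcases h2 with h2 | h2 | h2
          · exact (h2.2.1 (by rwa [sub_add_cancel])).elim
          · exact (nAB ha h2.1).elim
          · exact (h2.1 ha).elim
        · rcases h1 with h1 | h1 | h1
          · exact (h1.2.2 ha).elim
          · exact (nAB h h1.1).elim
          · exact (h1.1 h).elim
        · rcases h2 with h2 | h2 | h2
          · exact (h2.2.2 (by rwa [sub_add_cancel])).elim
          · exact (nAB ha h2.1).elim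
          · exact (h2.1 ha).elim
      · have h1 := hW' i d a hd.1 hsa
        have nAB : ¬IsA G c i d := fun hv => by
          have := (hv (i + 1)).1 ((h _).2 (Or.inl rfl))
          revert this; clear * -; revert i; decide
        rcases h1 with h1 | h1 | h1
        · exact (nAB h1.1).elim
        · rcases isA_isB H hc hsa hd.1 ha h with rfl | rfl | rfl | rfl
          · exact ((h _).2 (Or.inl rfl)).symm
          · exact ((h _).2 (Or.inr rfl)).symm
          · exact (h1.2.1 ha).elim
          · exact (h1.2.2 ha).elim
        · exact (h1.2 h).elim
    · push Not at hA
      exact exists_dominates H hc hA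

/-- A choice for ordered pairs that respects swapping the pair. -/
theorem exists_symm_choice {α β : Type*} [Nonempty β] (R : α → α → β → β → Prop)
    (hR : ∀ K K' p p', R K K' p p' → R K' K p' p) :
    ∃ h : α → α → β, ∀ K K', K ≠ K' → (∃ p p', R K K' p p') → R K K' (h K K') (h K' K) := by
  classical
  have hex : ∀ K K', ∃ q : β × β, (∃ p p', R K K' p p') → R K K' q.1 q.2 := by
    intro K K'
    by_cases h : ∃ p p', R K K' p p'
    · obtain ⟨p, p', h⟩ := h
      exact ⟨(p, p'), fun _ => h⟩
    · exact ⟨(Classical.arbitrary β, Classical.arbitrary β), fun h' => (h h').elim⟩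
  choose q hq using hex
  refine ⟨fun K K' => if WellOrderingRel K K' then (q K K').1 else (q K' K).2, ?_⟩
  intro K K' hne hK
  have hK' : ∃ p p', R K' K p p' := by
    obtain ⟨p, p', h⟩ := hK
    exact ⟨p', p, hR _ _ _ _ h⟩
  rcases trichotomous_of (WellOrderingRel (α := α)) K K' with h | h | h
  · have h' : ¬WellOrderingRel K' K := asymm h
    simp only [h, h', if_true, if_false]
    exact hq K K' hK
  · exact (hne h).elim
  · have h' : ¬WellOrderingRel K K' := asymm h
    simp only [h, h', if_true, if_false]
    exact hR _ _ _ _ (hq K' K hK')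

/-- The lists that a colouring `f` of `W₁ ∪ W₂` leaves are respected by `g` at `v`, and `g` is
proper there. If `v` has neighbours in `W₁ ∪ W₂`, then its list consists of the colours that do not
occur on these. Otherwise it consists of the colours that each neighbour of `v` with a neighbour in
`W₁` has lost to a neighbour in `W₁`; if there is no such neighbour of `v`, the list is `{0, 1}`. -/
structure Respects (G : SimpleGraph V) (f : V → Fin 3) (W₁ W₂ : Finset V) (g : V → Fin 3) (v : V) :
    Prop where
  proper : ∀ u, G.Adj v u → g v ≠ g u
  seen : ∀ w, w ∈ W₁ ∨ w ∈ W₂ → G.Adj w v → f w ≠ g v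
  unseen : (∀ w, w ∈ W₁ ∨ w ∈ W₂ → ¬G.Adj w v) → ∀ u, G.Adj v u → (∃ w ∈ W₁, G.Adj w u) →
    ∃ w ∈ W₁, G.Adj w u ∧ f w = g v
  two : g v = 2 → (∃ w, (w ∈ W₁ ∨ w ∈ W₂) ∧ G.Adj w v) ∨ ∃ u, G.Adj v u ∧ ∃ w ∈ W₁, G.Adj w u

theorem near_nonempty_of_reachable (H : NoShort G) {c : ZMod 7 → V} (hc : Cyc G c) {v : V}
    (hv : G.Reachable (c 0) v) :
    ¬Far G c v ∨ (Near G c v).Nonempty ∨ ∃ x, Far G c x ∧ G.Adj v x ∧ (Near G c x).Nonempty := by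
  rw [SimpleGraph.reachable_iff_reflTransGen] at hv
  induction hv with
  | refl => exact Or.inl (hc.isB H 0).not_far
  | @tail v u _ hvu ih =>
    by_cases hu : Far G c u
    swap
    · exact Or.inl hu
    right
    by_cases hvf : Far G c v
    swap
    · exact Or.inl ⟨v, hvu.symm, hvf⟩
    rcases ih with h | h | ⟨x, hx, hvx, d, hxd, hd⟩
    · exact (h hvf).elim
    · exact Or.inr ⟨v, hvf, hvu.symm, h⟩
    · exact Or.inl ⟨d, far_link H hc hu hvf hx hvu.symm hvx hxd hd, hd⟩

theorem near_eq (H : NoShort G) {c : ZMod 7 → V} (hc : Cyc G c) {x y z : V} (hx : Far G c x)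
    (hy : Far G c y) (hz : Far G c z) (hyx : G.Adj y x) (hyz : G.Adj y z) :
    Near G c x = Near G c z := by
  ext d
  exact ⟨fun h => ⟨far_link H hc hz hy hx hyz.symm hyx h.1 h.2, h.2⟩,
    fun h => ⟨far_link H hc hx hy hz hyx.symm hyz h.1 h.2, h.2⟩⟩

/-- In the component of a cycle of length seven, a bounded part of any colouring determines lists of
size two that can still be respected. The far vertices that see none of the guessed vertices are
recoloured with the colours of vertices of the cycle that dominate their neighbourhoods. -/
theorem exists_respects_of_cyc [Finite V] (H : NoShort G) {c : ZMod 7 → V} (hc : Cyc G c)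
    (f : V → Fin 3) (hf : ∀ u v, G.Adj u v → f u ≠ f v) :
    ∃ W₁ W₂ : Finset V, W₁.card ≤ 9 ∧ W₂.card ≤ 84 ∧ ∃ g : V → Fin 3,
      ∀ v, G.Reachable (c 0) v → Respects G f W₁ W₂ g v := by
  classical
  obtain ⟨W, hWc, hWf, hW⟩ := exists_cover H hc
  let W₁ : Finset V := Finset.univ.image c
  have hW₁ : ∀ {w}, w ∈ W₁ ↔ ∃ i, c i = w := by simp [W₁]
  have hW₁c : W₁.card ≤ 9 := Finset.card_image_le.trans (by simp [ZMod.card])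
  have hWn : ∀ w, w ∈ W₁ ∨ w ∈ W → ¬Far G c w := by
    rintro w (hw | hw)
    · obtain ⟨i, rfl⟩ := hW₁.1 hw
      exact (hc.isB H i).not_far
    · exact hWf w hw
  obtain ⟨h, hh⟩ := exists_symm_choice
    (fun (K K' : Set V) p p' => G.Adj (c p) (c p') ∧ Dominates G c p K ∧ Dominates G c p' K')
    (fun K K' p p' hp => ⟨hp.1.symm, hp.2.2, hp.2.1⟩)
  let K : V → Set V := Near G c
  let K' : V → Set V := fun v => {d | ∃ x, Far G c x ∧ G.Adj v x ∧ d ∈ K x}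
  have hK' : ∀ {v x}, Far G c v → Far G c x → G.Adj v x → K' v = K x := by
    intro v x hv hx hvx
    ext d
    exact ⟨fun ⟨z, hz, hvz, hd⟩ => (near_eq H hc hz hv hx hvz hvx).le hd,
      fun hd => ⟨x, hx, hvx, hd⟩⟩
  let sees : V → Prop := fun v => ∃ w, (w ∈ W₁ ∨ w ∈ W) ∧ G.Adj w v
  let keep : V → Prop := fun v => ¬Far G c v ∨ (∀ x, Far G c x → ¬G.Adj v x) ∧ sees v
  -- the colour of the cycle vertex onto which `v` is folded, and a way out of it within `{0, 1}`
  let col : V → Fin 3 := fun v => f (c (h (K v) (K' v)))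
  let out : V → Fin 3 := fun v => if f (c (h (K' v) ∅)) = 0 then 1 else 0
  let g : V → Fin 3 := fun v => if keep v then f v else if K v = ∅ then out v else col v
  -- the folding is defined on all far vertices of the component that have near neighbours
  have pair : ∀ v, ¬keep v → (K v).Nonempty → G.Reachable (c 0) v →
      G.Adj (c (h (K v) (K' v))) (c (h (K' v) (K v))) ∧ Dominates G c (h (K v) (K' v)) (K v) := by
    intro v hk hne hr
    have hvf : Far G c v := by
      by_contra hcon
      exact hk (Or.inl hcon)
    have hKK : K v ≠ K' v := by
      intro he
      obtain ⟨d, hd⟩ := hne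
      obtain ⟨x, hx, hvx, hd'⟩ := he ▸ hd
      exact H.tri hvx hd'.1 hd.1.symm
    have hex : ∃ p p', G.Adj (c p) (c p') ∧ Dominates G c p (K v) ∧ Dominates G c p' (K' v) := by
      have triv : K' v = ∅ → (∃ p, Dominates G c p (K v)) →
          ∃ p p', G.Adj (c p) (c p') ∧ Dominates G c p (K v) ∧ Dominates G c p' (K' v) :=
        fun h0 ⟨p, hp⟩ =>
        ⟨p, p + 1, hc p, hp, by rw [h0]; intro d hd; exact hd.elim⟩
      by_cases hx : ∃ x, Far G c x ∧ G.Adj v x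
      · obtain ⟨x, hx, hvx⟩ := hx
        rcases (K' v).eq_empty_or_nonempty with h0 | h0
        · exact triv h0 (exists_dominates H hc fun j a h1 h2 =>
            isA_far_far H hc hx hvf h2 hvx.symm h1)
        · rw [hK' hvf hx hvx] at h0 ⊢
          exact exists_dominates_edge H hc hvf hx hvx hne h0
      · push Not at hx
        refine triv ?_ (hW v hvf fun w hw hvw => ?_)
        · ext d
          simp only [Set.mem_empty_iff_false, iff_false]
          rintro ⟨x, hxf, hvx, -⟩
          exact hx x hxf hvx
        · exact hk (Or.inr ⟨hx, w, Or.inr hw, hvw.symm⟩)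
    have := hh (K v) (K' v) hKK hex
    exact ⟨this.1, this.2.1⟩
  have gkeep : ∀ {v}, keep v → g v = f v := fun hv => by simp [g, hv]
  have gcol : ∀ {v}, ¬keep v → (K v).Nonempty → g v = col v := fun hv hne => by
    simp [g, hv, hne.ne_empty]
  have gout : ∀ {v}, ¬keep v → K v = ∅ → g v = out v := fun hv he => by simp [g, hv, he]
  have hreach : ∀ {v u}, G.Reachable (c 0) v → G.Adj v u → G.Reachable (c 0) u :=
    fun hv hvu => hv.trans hvu.reachable
  -- the case distinction below is symmetric in the two ends of an edge
  have near_far : ∀ {d v}, ¬Far G c d → Far G c v → G.Adj v d → G.Reachable (c 0) v →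
      g v ≠ g d := by
    intro d v hd hv hvd hr
    rw [gkeep (Or.inl hd)]
    by_cases hk : keep v
    · rw [gkeep hk]; exact hf _ _ hvd
    · have hne : (K v).Nonempty := ⟨d, hvd, hd⟩
      rw [gcol hk hne]
      exact hf _ _ ((pair v hk hne hr).2 d ⟨hvd, hd⟩)
  have out_col : ∀ {v u}, Far G c v → Far G c u → G.Adj v u → K v = ∅ → (K u).Nonempty →
      g v ≠ g u := by
    intro v u hv hu hvu h0 hne
    have kv : ¬keep v := by
      rintro (h1 | h1)
      · exact h1 hv
      · exact h1.1 u hu hvu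
    have ku : ¬keep u := by
      rintro (h1 | h1)
      · exact h1 hu
      · exact h1.1 v hv hvu.symm
    rw [gout kv h0, gcol ku hne]
    simp only [out, col]
    rw [hK' hv hu hvu, hK' hu hv hvu.symm, h0]
    split_ifs with h1
    · rw [h1]; decide
    · exact fun h2 => h1 h2.symm
  refine ⟨W₁, W, hW₁c, hWc, g, fun v hr => ⟨fun u hvu => ?_, fun w hw hwv => ?_, ?_, ?_⟩⟩
  · by_cases hv : Far G c v <;> by_cases hu : Far G c u
    · have kv : ¬keep v := by
        rintro (h1 | h1)
        · exact h1 hv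
        · exact h1.1 u hu hvu
      have ku : ¬keep u := by
        rintro (h1 | h1)
        · exact h1 hu
        · exact h1.1 v hv hvu.symm
      rcases (K v).eq_empty_or_nonempty with h0 | h0 <;>
        rcases (K u).eq_empty_or_nonempty with h1 | h1
      · exfalso
        rcases near_nonempty_of_reachable H hc hr with h2 | h2 | ⟨x, hx, hvx, hne⟩
        · exact h2 hv
        · exact h2.ne_empty h0
        · rw [near_eq H hc hx hv hu hvx hvu] at hne
          exact hne.ne_empty h1
      · exact out_col hv hu hvu h0 h1
      · exact (out_col hu hv hvu.symm h1 h0).symm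
      · rw [gcol kv h0, gcol ku h1]
        have := (pair v kv h0 hr).1
        simp only [col]
        rw [hK' hu hv hvu.symm]
        rw [hK' hv hu hvu] at this ⊢
        exact hf _ _ this
    · exact near_far hu hv hvu hr
    · exact (near_far hv hu hvu.symm (hreach hr hvu)).symm
    · rw [gkeep (Or.inl hv), gkeep (Or.inl hu)]
      exact hf _ _ hvu
  · by_cases hk : keep v
    · rw [gkeep hk]; exact hf _ _ hwv
    · have hne : (K v).Nonempty := ⟨w, hwv.symm, hWn w hw⟩
      rw [gcol hk hne]
      exact (hf _ _ ((pair v hk hne hr).2 w ⟨hwv.symm, hWn w hw⟩)).symm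
  · intro hno u hvu ⟨w, hw, hwu⟩
    have hk : ¬keep v := by
      rintro (h1 | ⟨-, w, hw, hwv⟩)
      · simp only [Far, not_forall, not_not] at h1
        obtain ⟨i, hi⟩ := h1
        exact hno (c i) (Or.inl (hW₁.2 ⟨i, rfl⟩)) hi.symm
      · exact hno w hw hwv
    obtain ⟨i, rfl⟩ := hW₁.1 hw
    have hu : u ∈ K v := ⟨hvu, fun hfar => hfar i hwu.symm⟩
    rw [gcol hk ⟨u, hu⟩]
    exact ⟨_, hW₁.2 ⟨_, rfl⟩, (pair v hk ⟨u, hu⟩ hr).2 u hu, rfl⟩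
  · intro h2
    by_cases hk : keep v
    · left
      rcases hk with h1 | ⟨-, h1⟩
      · simp only [Far, not_forall, not_not] at h1
        obtain ⟨i, hi⟩ := h1
        exact ⟨c i, Or.inl (hW₁.2 ⟨i, rfl⟩), hi.symm⟩
      · exact h1
    · right
      rcases (K v).eq_empty_or_nonempty with h0 | ⟨u, hvu, hu⟩
      · rw [gout hk h0] at h2
        simp only [out] at h2
        split_ifs at h2 <;> exact absurd h2 (by decide)
      · simp only [Far, not_forall, not_not] at hu
        obtain ⟨i, hi⟩ := hu
        exact ⟨u, hvu, c i, hW₁.2 ⟨i, rfl⟩, hi.symm⟩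

/-! ### Shortest odd closed walks -/

theorem IsIndPath.adj_iff : ∀ {l : List V}, IsIndPath G l → ∀ i j (hi : i < l.length)
    (hj : j < l.length), i < j → (G.Adj l[i] l[j] ↔ i + 1 = j)
  | [], _, i, _, hi, _, _ => by simp at hi
  | [_], _, i, j, hi, hj, hij => by simp at hi hj; omega
  | a :: b :: l, ⟨hab, hal, hl⟩, i, j, hi, hj, hij => by
    obtain ⟨j, rfl⟩ : ∃ j', j = j' + 1 := ⟨j - 1, by omega⟩
    rcases i with _ | i
    · rcases j with _ | j
      · simpa using hab
      · have := hal (l[j]'(by simpa using hj)) (List.getElem_mem _)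
        simpa using this
    · have := IsIndPath.adj_iff hl i j (by simpa using hi) (by simpa using hj) (by omega)
      simpa using this

/-- Five consecutive vertices of a closed walk of length five are distinct and span no further
edges, since otherwise there would be a triangle. -/
theorem noShort (h9 : IsInducedFree (SimpleGraph.pathGraph 9) G)
    (h3 : IsInducedFree (SimpleGraph.cycleGraph 3) G)
    (h5 : IsInducedFree (SimpleGraph.cycleGraph 5) G) : NoShort G := by
  have tri : ∀ {a b c}, G.Adj a b → G.Adj b c → G.Adj c a → False := by
    intro a b c hab hbc hca
    refine h3 ⟨⟨⟨![a, b, c], ?_⟩, ?_⟩⟩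
    · intro i j
      fin_cases i <;> fin_cases j <;>
        simp [hab.ne, hbc.ne, hca.ne, hab.ne.symm, hbc.ne.symm, hca.ne.symm]
    · intro i j
      rw [SimpleGraph.cycleGraph_three_eq_top]
      change G.Adj (![a, b, c] i) (![a, b, c] j) ↔ _
      fin_cases i <;> fin_cases j <;> simp [hab, hbc, hca, hab.symm, hbc.symm, hca.symm]
  refine ⟨tri, ?_, ?_⟩
  · intro a b c d e hab hbc hcd hde hea
    have ac : ¬G.Adj a c := fun h => tri hab hbc h.symm
    have ad : ¬G.Adj a d := fun h => tri h hde hea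
    have bd : ¬G.Adj b d := fun h => tri hbc hcd h.symm
    have be : ¬G.Adj b e := fun h => tri hab h hea
    have ce : ¬G.Adj c e := fun h => tri hcd hde h.symm
    have nac : a ≠ c := by rintro rfl; exact tri hcd hde hea
    have nad : a ≠ d := by rintro rfl; exact tri hab hbc hcd
    have nbd : b ≠ d := by rintro rfl; exact be hde
    have nbe : b ≠ e := by rintro rfl; exact ce hbc.symm
    have nce : c ≠ e := by rintro rfl; exact ac hea.symm
    refine h5 ⟨⟨⟨![a, b, c, d, e], ?_⟩, ?_⟩⟩
    · intro i j
      fin_cases i <;> fin_cases j <;>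
        simp [hab.ne, hbc.ne, hcd.ne, hde.ne, hea.ne, hab.ne.symm, hbc.ne.symm, hcd.ne.symm,
          hde.ne.symm, hea.ne.symm, nac, nad, nbd, nbe, nce, nac.symm, nad.symm, nbd.symm,
          nbe.symm, nce.symm]
    · intro i j
      rw [SimpleGraph.cycleGraph_adj]
      change G.Adj (![a, b, c, d, e] i) (![a, b, c, d, e] j) ↔ _
      fin_cases i <;> fin_cases j <;>
        simp [hab, hbc, hcd, hde, hea, hab.symm, hbc.symm, hcd.symm,
          hde.symm, hea.symm, ac, ad, bd, be, ce, G.adj_comm c a, G.adj_comm d a, G.adj_comm d b,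
          G.adj_comm e b, G.adj_comm e c] <;> decide
  · intro l hl hlen
    have hadj := hl.adj_iff
    have hadj' : ∀ i j : Fin 9, G.Adj (l[i.val]'(by omega)) (l[j.val]'(by omega)) ↔
        i.val + 1 = j.val ∨ j.val + 1 = i.val := by
      intro i j
      rcases lt_trichotomy i.val j.val with h | h | h
      · rw [hadj i j (by omega) (by omega) h]; omega
      · have : i = j := Fin.ext h
        subst this
        simp
      · rw [G.adj_comm, hadj j i (by omega) (by omega) h]; omega
    refine h9 ⟨⟨⟨fun i : Fin 9 => l[i.val]'(by omega), ?_⟩, ?_⟩⟩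
    · -- vertices at distance two or more have different neighbours on the path
      intro i j hij
      have h : ∀ k : Fin 9, (i.val + 1 = k.val ∨ k.val + 1 = i.val) ↔
          (j.val + 1 = k.val ∨ k.val + 1 = j.val) := by
        intro k
        rw [← hadj' i k, ← hadj' j k]
        simp only at hij
        rw [hij]
      clear * - h
      revert i j; decide
    · intro i j
      change G.Adj (l[i.val]'_) (l[j.val]'_) ↔ _
      rw [hadj' i j, SimpleGraph.pathGraph_adj]

/-- A closed walk of length nine. -/
def Cyc9 (G : SimpleGraph V) (c : ZMod 9 → V) : Prop := ∀ i, G.Adj (c i) (c (i + 1))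

/-- No closed walk of length seven meets the image of `c`. -/
def NoSeven (G : SimpleGraph V) (c : ZMod 9 → V) : Prop :=
  ∀ i a₁ a₂ a₃ a₄ a₅ a₆, G.Adj (c i) a₁ → G.Adj a₁ a₂ → G.Adj a₂ a₃ → G.Adj a₃ a₄ → G.Adj a₄ a₅ →
    G.Adj a₅ a₆ → G.Adj a₆ (c i) → False

theorem Cyc9.rot {c : ZMod 9 → V} (hc : Cyc9 G c) (k : ZMod 9) : Cyc9 G (fun i => c (i + k)) := by
  intro i
  have := hc (i + k)
  rwa [add_right_comm] at this

theorem NoSeven.rot {c : ZMod 9 → V} (hc : NoSeven G c) (k : ZMod 9) :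
    NoSeven G (fun i => c (i + k)) := fun i => hc (i + k)

theorem Cyc9.refl {c : ZMod 9 → V} (hc : Cyc9 G c) : Cyc9 G (fun i => c (-i)) := by
  intro i
  have := hc (-i - 1)
  rw [sub_add_cancel] at this
  simpa [neg_add, sub_eq_add_neg, add_comm] using this.symm

theorem NoSeven.refl {c : ZMod 9 → V} (hc : NoSeven G c) : NoSeven G (fun i => c (-i)) :=
  fun i => hc (-i)

theorem Cyc9.adj_iff (H : NoShort G) {c : ZMod 9 → V} (hc : Cyc9 G c) (h7 : NoSeven G c)
    (i j : ZMod 9) : G.Adj (c i) (c j) ↔ j = i + 1 ∨ j = i - 1 := by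
  have main : ∀ {c : ZMod 9 → V}, Cyc9 G c → NoSeven G c → ∀ d, G.Adj (c 0) (c d) →
      d = 1 ∨ d = -1 := by
    intro c hc h7 d h
    have h0 : G.Adj (c 0) (c 1) := hc 0
    have h1 : G.Adj (c 1) (c 2) := hc 1
    have h2 : G.Adj (c 2) (c 3) := hc 2
    have h3 : G.Adj (c 3) (c 4) := hc 3
    have h4 : G.Adj (c 4) (c 5) := hc 4
    have h5 : G.Adj (c 5) (c 6) := hc 5
    have h6 : G.Adj (c 6) (c 7) := hc 6
    have h7' : G.Adj (c 7) (c 8) := hc 7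
    have h8 : G.Adj (c 8) (c 0) := hc 8
    have : ∀ d : ZMod 9, d = 0 ∨ d = 1 ∨ d = 2 ∨ d = 3 ∨ d = 4 ∨ d = 5 ∨ d = 6 ∨ d = 7 ∨ d = 8 := by
      decide
    rcases this d with rfl | rfl | rfl | rfl | rfl | rfl | rfl | rfl | rfl
    · exact (G.irrefl h).elim
    · exact Or.inl rfl
    · exact (H.tri h0 h1 h.symm).elim
    · exact (h7 _ _ _ _ _ _ _ h h3 h4 h5 h6 h7' h8).elim
    · exact (H.pent h0 h1 h2 h3 h.symm).elim
    · exact (H.pent h h5 h6 h7' h8).elim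
    · exact (h7 _ _ _ _ _ _ _ h0 h1 h2 h3 h4 h5 h.symm).elim
    · exact (H.tri h h7' h8).elim
    · exact Or.inr (by decide)
  constructor
  · intro h
    have := main (hc.rot i) (h7.rot i) (j - i) (by simpa using h)
    revert this; clear * -; revert i j; decide
  · rintro (rfl | rfl)
    · exact hc i
    · have := hc (i - 1)
      rw [sub_add_cancel] at this
      exact this.symm

theorem Cyc9.nbr (H : NoShort G) {c : ZMod 9 → V} (hc : Cyc9 G c) (h7 : NoSeven G c) {v : V}
    {i j : ZMod 9} (hi : G.Adj v (c i)) (hj : G.Adj v (c j)) : j = i ∨ j = i + 2 ∨ j = i - 2 := by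
  have main : ∀ {c : ZMod 9 → V}, Cyc9 G c → NoSeven G c → ∀ d, G.Adj v (c 0) → G.Adj v (c d) →
      d ≠ 1 ∧ d ≠ 3 ∧ d ≠ 5 := by
    intro c hc h7 d hd h
    have h0 : G.Adj (c 0) (c 1) := hc 0
    have h1 : G.Adj (c 1) (c 2) := hc 1
    have h2 : G.Adj (c 2) (c 3) := hc 2
    have h3 : G.Adj (c 3) (c 4) := hc 3
    have h4 : G.Adj (c 4) (c 5) := hc 4
    refine ⟨?_, ?_, ?_⟩ <;> rintro rfl
    · exact H.tri hd h0 h.symm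
    · exact H.pent hd h0 h1 h2 h.symm
    · exact h7 _ _ _ _ _ _ _ h0 h1 h2 h3 h4 h.symm hd
  have h1 := main (hc.rot i) (h7.rot i) (j - i) (by simpa using hi) (by simpa using hj)
  have h2 := main (hc.rot j) (h7.rot j) (i - j) (by simpa using hj) (by simpa using hi)
  revert h1 h2; clear * -; revert i j; decide

/-- Every vertex in the component of a cycle of length nine has a neighbour on it: a vertex at
distance two from the cycle would extend a path along the cycle to an induced path on nine vertices.
-/
theorem Cyc9.exists_nbr (H : NoShort G) {c : ZMod 9 → V} (hc : Cyc9 G c) (h7 : NoSeven G c) {v : V}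
    (hv : G.Reachable (c 0) v) : ∃ i, G.Adj v (c i) := by
  rw [SimpleGraph.reachable_iff_reflTransGen] at hv
  induction hv with
  | refl => exact ⟨1, hc 0⟩
  | @tail v s _ hvs ih =>
    by_contra hs
    push Not at hs
    obtain ⟨i, hi⟩ := ih
    have main : ∀ {c : ZMod 9 → V}, Cyc9 G c → NoSeven G c → (∀ i, ¬G.Adj s (c i)) →
        G.Adj v (c 0) → ¬G.Adj v (c 2) := by
      intro c hc h7 hs h0 h2
      have hvc : ∀ j, G.Adj v (c j) ↔ j = 0 ∨ j = 2 := fun j => by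
        constructor
        · intro hj
          have h1 := hc.nbr H h7 h0 hj
          have h2 := hc.nbr H h7 h2 hj
          revert h1 h2; clear * -; revert j; decide
        · rintro (rfl | rfl) <;> assumption
      refine H.path [s, v, c 2, c 3, c 4, c 5, c 6, c 7, c 8] ?_ rfl
      simp [IsIndPath, hvs.symm, hs, hvc, hc.adj_iff H h7]
      repeat' apply And.intro
      all_goals decide
    by_cases h2 : G.Adj v (c (i + 2))
    · refine main (hc.rot i) (h7.rot i) (fun j => hs _) (by simpa using hi) ?_
      simpa [add_comm] using h2
    by_cases h3 : G.Adj v (c (i - 2))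
    · refine main (hc.rot i).refl (h7.rot i).refl (fun j => hs _) (by simpa using hi) ?_
      have : -2 + i = i - 2 := by ring
      simpa [this] using h3
    · have hvc : ∀ j, G.Adj v (c (j + i)) ↔ j = 0 := fun j => by
        constructor
        · intro hj
          rcases hc.nbr H h7 hi hj with h | h | h
          · simpa using h
          · exact (h2 (h ▸ hj)).elim
          · exact (h3 (h ▸ hj)).elim
        · rintro rfl; simpa using hi
      have hadj := (hc.rot i).adj_iff H (h7.rot i)
      refine H.path [v, c (0 + i), c (1 + i), c (2 + i), c (3 + i), c (4 + i), c (5 + i),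
        c (6 + i), c (7 + i)] ?_ rfl
      simp only [IsIndPath, hvc, hadj, List.mem_cons, List.not_mem_nil, forall_eq_or_imp, or_false,
        forall_eq, IsEmpty.forall_iff, implies_true]
      repeat' apply And.intro
      all_goals decide

/-- Without odd cycles of smaller length, every vertex sees a colour on a cycle of length nine, so
that no recolouring is necessary. -/
theorem exists_respects_of_cyc9 [Finite V] (H : NoShort G) {c : ZMod 9 → V} (hc : Cyc9 G c)
    (h7 : NoSeven G c) (f : V → Fin 3) (hf : ∀ u v, G.Adj u v → f u ≠ f v) :
    ∃ W₁ W₂ : Finset V, W₁.card ≤ 9 ∧ W₂.card ≤ 84 ∧ ∃ g : V → Fin 3,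
      ∀ v, G.Reachable (c 0) v → Respects G f W₁ W₂ g v := by
  classical
  refine ⟨Finset.univ.image c, ∅, Finset.card_image_le.trans (by simp [ZMod.card]), by simp, f,
    fun v hr => ?_⟩
  obtain ⟨i, hi⟩ := hc.exists_nbr H h7 hr
  have hw : c i ∈ Finset.univ.image c := by simp
  exact ⟨fun u => hf v u, fun w _ => hf w v, fun h => (h _ (Or.inl hw) hi.symm).elim,
    fun _ => Or.inl ⟨_, Or.inl hw, hi.symm⟩⟩

/-- There is a closed walk of length `m` in the component of `r`. -/
def HasClosedWalk (G : SimpleGraph V) (r : V) (m : ℕ) : Prop :=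
  ∃ v, G.Reachable r v ∧ ∃ p : G.Walk v v, p.length = m

theorem respects_of_bipartite {r : V} (h : ∀ m, Odd m → ¬HasClosedWalk G r m) (f : V → Fin 3) :
    ∃ g : V → Fin 3, ∀ v, G.Reachable r v → Respects G f ∅ ∅ g v := by
  classical
  refine ⟨fun v => if Even (G.dist r v) then 0 else 1, fun v hv => ⟨fun u hvu he => ?_, ?_, ?_, ?_⟩⟩
  · obtain ⟨p, hp⟩ := hv.exists_walk_length_eq_dist
    obtain ⟨q, hq⟩ := (hv.trans hvu.reachable).exists_walk_length_eq_dist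
    refine h (p.length + 1 + q.length) ?_ ⟨r, SimpleGraph.Reachable.refl r,
      (p.concat hvu).append q.reverse, by simp⟩
    have : Even (G.dist r v) ↔ Even (G.dist r u) := by
      split_ifs at he with h1 h2 h2
      · tauto
      · exact absurd he (by decide)
      · exact absurd he (by decide)
      · tauto
    rw [hp, hq]
    by_cases h1 : Even (G.dist r v)
    · exact (h1.add_one).add_even (this.1 h1)
    · have h2 : Odd (G.dist r u) := Nat.not_even_iff_odd.1 (fun h2 => h1 (this.2 h2))
      exact ((Nat.not_even_iff_odd.1 h1).add_one).add_odd h2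
  · simp
  · simp
  · intro h2
    split_ifs at h2 <;> exact absurd h2 (by decide)

theorem exists_subwalk {q : ℕ → V} {m : ℕ} (hq : ∀ i < m, G.Adj (q i) (q (i + 1))) (i : ℕ) :
    ∀ d, i + d ≤ m → ∃ w : G.Walk (q i) (q (i + d)), w.length = d
  | 0, _ => ⟨SimpleGraph.Walk.nil, rfl⟩
  | d + 1, h => by
    obtain ⟨w, hw⟩ := exists_subwalk hq i d (by omega)
    exact ⟨w.concat (hq (i + d) (by omega)), by simp [hw]⟩

/-- A shortest odd closed walk in a component has no chords. -/
theorem chordless {r : V} {q : ℕ → V} {m : ℕ} (hq : ∀ i < m, G.Adj (q i) (q (i + 1)))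
    (hm : Odd m) (hqm : q m = q 0) (hr : G.Reachable r (q 0))
    (hmin : ∀ k < m, Odd k → ¬HasClosedWalk G r k) {i j : ℕ} (hij : i < j) (hj : j < m)
    (h : G.Adj (q i) (q j)) : j = i + 1 ∨ j - i + 1 = m := by
  obtain ⟨d, rfl⟩ : ∃ d, j = i + d := ⟨j - i, by omega⟩
  by_contra hcon
  push Not at hcon
  obtain ⟨w0, -⟩ := exists_subwalk hq 0 i (by omega)
  rw [zero_add] at w0
  have hri : G.Reachable r (q i) := hr.trans ⟨w0⟩
  rcases Nat.even_or_odd d with hd | hd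
  · obtain ⟨w, hw⟩ := exists_subwalk hq i d (by omega)
    refine hmin (d + 1) (by omega) hd.add_one ⟨_, hri, w.concat h.symm, by simp [hw]⟩
  · have hw := exists_subwalk hq (i + d) (m - (i + d)) (by omega)
    have hw' := exists_subwalk hq 0 i (by omega)
    rw [Nat.add_sub_cancel' hj.le, hqm] at hw
    rw [zero_add] at hw'
    obtain ⟨w, hw⟩ := hw
    obtain ⟨w', hw'⟩ := hw'
    have hodd : Odd (m - d + 1) := (Nat.Odd.sub_odd hm hd).add_one
    refine hmin (m - d + 1) (by omega) hodd ⟨_, hri, SimpleGraph.Walk.cons h (w.append w'), ?_⟩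
    rw [SimpleGraph.Walk.length_cons, SimpleGraph.Walk.length_append, hw, hw']
    omega

/-- In each component, a bounded part of any colouring determines lists of size two that can still
be respected. -/
theorem exists_respects [Finite V] (H : NoShort G) (f : V → Fin 3)
    (hf : ∀ u v, G.Adj u v → f u ≠ f v) (r : V) :
    ∃ W₁ W₂ : Finset V, W₁.card ≤ 9 ∧ W₂.card ≤ 84 ∧ ∃ g : V → Fin 3,
      ∀ v, G.Reachable r v → Respects G f W₁ W₂ g v := by
  classical
  by_cases hbip : ∃ m, Odd m ∧ HasClosedWalk G r m
  swap
  · push Not at hbip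
    obtain ⟨g, hg⟩ := respects_of_bipartite hbip f
    exact ⟨∅, ∅, by simp, by simp, g, hg⟩
  obtain ⟨hm, v, hrv, p, hp⟩ := Nat.find_spec hbip
  have hmin : ∀ k < Nat.find hbip, Odd k → ¬HasClosedWalk G r k :=
    fun k hk hodd h => Nat.find_min hbip hk ⟨hodd, h⟩
  generalize Nat.find hbip = m at hm hp hmin
  set q : ℕ → V := p.getVert with hqdef
  have hq : ∀ i < m, G.Adj (q i) (q (i + 1)) := fun i hi => p.adj_getVert_succ (by omega)
  have hqm : q m = q 0 := by
    rw [hqdef, ← hp, p.getVert_length, p.getVert_zero]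
  have hr0 : G.Reachable r (q 0) := by rwa [hqdef, p.getVert_zero]
  have last : ∀ i, i + 1 = m → G.Adj (q i) (q 0) := fun i hi => by
    rw [← hqm, ← hi]; exact hq i (by omega)
  have reach : ∀ {W₁ W₂ : Finset V} {g : V → Fin 3},
      (∀ v, G.Reachable (q 0) v → Respects G f W₁ W₂ g v) →
        ∀ v, G.Reachable r v → Respects G f W₁ W₂ g v :=
    fun h v hv => h v (hr0.symm.trans hv)
  have hm' : m = 1 ∨ m = 3 ∨ m = 5 ∨ m = 7 ∨ m = 9 ∨ 11 ≤ m := by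
    obtain ⟨k, rfl⟩ := hm
    omega
  rcases hm' with rfl | rfl | rfl | rfl | rfl | hm11
  · exact (G.irrefl (last 0 rfl)).elim
  · exact (H.tri (hq 0 (by omega)) (hq 1 (by omega)) (last 2 rfl)).elim
  · exact (H.pent (hq 0 (by omega)) (hq 1 (by omega)) (hq 2 (by omega)) (hq 3 (by omega))
      (last 4 rfl)).elim
  · have hc : Cyc G (fun i : ZMod 7 => q i.val) := by
      intro i
      by_cases hi : i.val = 6
      · obtain rfl : i = 6 := ZMod.val_injective 7 hi
        exact last 6 rfl
      · have h1 : (i + 1).val = i.val + 1 := by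
          revert hi; clear * -; revert i; decide
        change G.Adj (q i.val) (q (i + 1).val)
        rw [h1]
        exact hq _ (ZMod.val_lt i)
    obtain ⟨W₁, W₂, h1, h2, g, hg⟩ := exists_respects_of_cyc H hc f hf
    exact ⟨W₁, W₂, h1, h2, g, reach hg⟩
  · have hc : Cyc9 G (fun i : ZMod 9 => q i.val) := by
      intro i
      by_cases hi : i.val = 8
      · obtain rfl : i = 8 := ZMod.val_injective 9 hi
        exact last 8 rfl
      · have h1 : (i + 1).val = i.val + 1 := by
          revert hi; clear * -; revert i; decide
        change G.Adj (q i.val) (q (i + 1).val)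
        rw [h1]
        exact hq _ (ZMod.val_lt i)
    have h7 : NoSeven G (fun i : ZMod 9 => q i.val) := by
      intro i a₁ a₂ a₃ a₄ a₅ a₆ e0 e1 e2 e3 e4 e5 e6
      have hri : G.Reachable r (q i.val) := by
        obtain ⟨w, -⟩ := exists_subwalk hq 0 i.val (by have := ZMod.val_lt i; omega)
        rw [zero_add] at w
        exact hr0.trans ⟨w⟩
      exact hmin 7 (by omega) (by decide) ⟨_, hri, .cons e0 (.cons e1 (.cons e2 (.cons e3
        (.cons e4 (.cons e5 (.cons e6 .nil)))))), rfl⟩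
    obtain ⟨W₁, W₂, h1, h2, g, hg⟩ := exists_respects_of_cyc9 H hc h7 f hf
    exact ⟨W₁, W₂, h1, h2, g, reach hg⟩
  · -- nine consecutive vertices of a longer shortest odd closed walk form an induced path
    exfalso
    have hno : ∀ i j, i + 1 < j → j ≤ 8 → ¬G.Adj (q i) (q j) := fun i j hij hj h => by
      have := chordless hq hm hqm hr0 hmin (by omega) (by omega) h
      omega
    refine H.path [q 0, q 1, q 2, q 3, q 4, q 5, q 6, q 7, q 8] ?_ rfl
    simp only [IsIndPath, List.mem_cons, List.not_mem_nil, forall_eq_or_imp, or_false, forall_eq,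
      IsEmpty.forall_iff, implies_true, and_true]
    repeat' apply And.intro
    all_goals first
      | exact hq _ (by omega)
      | exact hno _ _ (by omega) (by omega)

end ShortOdd

/-! ### Programs with bounded loops -/

namespace LoopProg

open RAM

@[simp] theorem reg_setReg (s : State) (x v y : ℕ) :
    (s.setReg x v).reg y = if y = x then v else s.reg y := by
  simp [State.setReg, Function.update_apply]

@[simp] theorem arr_setReg (s : State) (x v : ℕ) : (s.setReg x v).arr = s.arr := rfl

@[simp] theorem reg_setArr (s : State) (a i v : ℕ) : (s.setArr a i v).reg = s.reg := rfl

@[simp] theorem arr_setArr (s : State) (a i v b : ℕ) :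
    (s.setArr a i v).arr b = if b = a then Function.update (s.arr a) i v else s.arr b := by
  simp only [State.setArr, Function.update_apply]

/-- Programs whose only loops are `rep x m c p`, that is, "for `x = 0, …, m * n + c - 1` do `p`",
where `n` is the content of register `0`. -/
inductive LProg where
  | skip
  | assign (x : ℕ) (e : Expr)
  | store (a : ℕ) (i e : Expr)
  | seq (p q : LProg)
  | ite (e : Expr) (p q : LProg)
  | rep (x m c : ℕ) (p : LProg)

namespace LProg

/-- The state transformation computed by a program. After `rep x m c p`, register `x` holds the
bound of the loop. -/
def den : LProg → State → State
  | skip, s => s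
  | assign x e, s => s.setReg x (e.eval s)
  | store a i e, s => s.setArr a (i.eval s) (e.eval s)
  | seq p q, s => q.den (p.den s)
  | ite e p q, s => if e.eval s ≠ 0 then p.den s else q.den s
  | rep x m c p, s =>
    (Nat.rec s (fun i t => p.den (t.setReg x i)) (m * s.reg 0 + c) : State).setReg x
      (m * s.reg 0 + c)

/-- The expression `m * n + c`, for `n` in register `0`. -/
def boundE : ℕ → ℕ → Expr
  | 0, c => .const c
  | m + 1, c => .add (.reg 0) (boundE m c)

theorem eval_boundE (s : State) (m c : ℕ) : (boundE m c).eval s = m * s.reg 0 + c := by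
  induction m with
  | zero => simp [boundE, Expr.eval]
  | succ m ih => simp only [boundE, Expr.eval, ih]; ring

/-- Translation to the random access machine. -/
def compile : LProg → Program
  | skip => .skip
  | assign x e => .assign x e
  | store a i e => .store a i e
  | seq p q => .seq p.compile q.compile
  | ite e p q => .ite e p.compile q.compile
  | rep x m c p => .seq (.assign x (.const 0)) (.loop (.sub (boundE m c) (.reg x))
      (.seq p.compile (.assign x (.add (.reg x) (.const 1)))))

/-- A bound for the number of steps, as a polynomial in `n`. -/
noncomputable def cost : LProg → Polynomial ℕ
  | skip => 1
  | assign _ e => Polynomial.C (e.cost + 1)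
  | store _ i e => Polynomial.C (i.cost + e.cost + 1)
  | seq p q => p.cost + q.cost
  | ite e p q => Polynomial.C (e.cost + 1) + (p.cost + q.cost)
  | rep _ m c p => 2 + (Polynomial.C m * Polynomial.X + Polynomial.C c) *
      (Polynomial.C ((boundE m c).cost + 1 + 1 + 1 + 4) + p.cost) +
        Polynomial.C ((boundE m c).cost + 1 + 1 + 1)

/-- The program does not write register `x`. -/
def KeepsReg (x : ℕ) : LProg → Prop
  | skip => True
  | assign y _ => y ≠ x
  | store _ _ _ => True
  | seq p q => p.KeepsReg x ∧ q.KeepsReg x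
  | ite _ p q => p.KeepsReg x ∧ q.KeepsReg x
  | rep y _ _ p => y ≠ x ∧ p.KeepsReg x

/-- The program does not write array `a`. -/
def KeepsArr (a : ℕ) : LProg → Prop
  | skip => True
  | assign _ _ => True
  | store b _ _ => b ≠ a
  | seq p q => p.KeepsArr a ∧ q.KeepsArr a
  | ite _ p q => p.KeepsArr a ∧ q.KeepsArr a
  | rep _ _ _ p => p.KeepsArr a

/-- No loop body writes its own loop variable or register `0`. -/
def WF : LProg → Prop
  | skip => True
  | assign _ _ => True
  | store _ _ _ => True
  | seq p q => p.WF ∧ q.WF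
  | ite _ p q => p.WF ∧ q.WF
  | rep x _ _ p => p.KeepsReg x ∧ p.KeepsReg 0 ∧ x ≠ 0 ∧ p.WF

theorem den_reg {x : ℕ} : ∀ {p : LProg}, p.KeepsReg x → ∀ s, (p.den s).reg x = s.reg x
  | skip, _, _ => rfl
  | assign y e, h, s => by simp only [den, reg_setReg]; rw [if_neg (Ne.symm h)]
  | store _ _ _, _, _ => rfl
  | seq p q, h, s => by simp only [den]; rw [den_reg h.2, den_reg h.1]
  | ite e p q, h, s => by
    simp only [den]
    split_ifs
    · exact den_reg h.1 s
    · exact den_reg h.2 s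
  | rep y m c p, h, s => by
    simp only [den, reg_setReg]
    rw [if_neg (Ne.symm h.1)]
    generalize m * s.reg 0 + c = k
    induction k with
    | zero => rfl
    | succ k ih =>
      simp only
      rw [den_reg h.2, reg_setReg, if_neg (Ne.symm h.1), ih]

theorem den_arr {a : ℕ} : ∀ {p : LProg}, p.KeepsArr a → ∀ s, (p.den s).arr a = s.arr a
  | skip, _, _ => rfl
  | assign y e, h, s => rfl
  | store b _ _, h, s => by simp only [den, arr_setArr]; rw [if_neg (Ne.symm h)]
  | seq p q, h, s => by simp only [den]; rw [den_arr h.2, den_arr h.1]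
  | ite e p q, h, s => by
    simp only [den]
    split_ifs
    · exact den_arr h.1 s
    · exact den_arr h.2 s
  | rep y m c p, h, s => by
    simp only [den, arr_setReg]
    generalize m * s.reg 0 + c = k
    induction k with
    | zero => rfl
    | succ k ih =>
      simp only
      rw [den_arr (p := p) h, arr_setReg, ih]

/-- The translated program computes the state transformation, in polynomial time. -/
theorem exec_compile : ∀ {p : LProg}, p.WF → p.KeepsReg 0 → ∀ s,
    ∃ t ≤ p.cost.eval (s.reg 0), Exec p.compile s (p.den s) t
  | skip, _, _, s => ⟨1, by simp [cost], Exec.skip s⟩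
  | assign x e, _, _, s => ⟨_, by simp [cost], Exec.assign s x e⟩
  | store a i e, _, _, s => ⟨_, by simp [cost], Exec.store s a i e⟩
  | seq p q, h, h0, s => by
    obtain ⟨t, ht, hp⟩ := exec_compile h.1 h0.1 s
    obtain ⟨t', ht', hq⟩ := exec_compile h.2 h0.2 (p.den s)
    rw [den_reg h0.1] at ht'
    exact ⟨t + t', by simp only [cost, Polynomial.eval_add]; omega, Exec.seq hp hq⟩
  | ite e p q, h, h0, s => by
    by_cases he : e.eval s = 0
    · obtain ⟨t, ht, hq⟩ := exec_compile h.2 h0.2 s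
      have hden : (ite e p q).den s = q.den s := by simp [den, he]
      rw [hden]
      refine ⟨_, ?_, Exec.ite_false he hq⟩
      simp only [cost, Polynomial.eval_add, Polynomial.eval_C]; omega
    · obtain ⟨t, ht, hq⟩ := exec_compile h.1 h0.1 s
      have hden : (ite e p q).den s = p.den s := by simp [den, he]
      rw [hden]
      refine ⟨_, ?_, Exec.ite_true he hq⟩
      simp only [cost, Polynomial.eval_add, Polynomial.eval_C]; omega
  | rep x m c p, ⟨hx, hp0, hx0, hwf⟩, h0, s => by
    set B := m * s.reg 0 + c with hB
    let It : ℕ → State := fun k => Nat.rec s (fun i t => p.den (t.setReg x i)) k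
    have hIt : ∀ k, It (k + 1) = p.den ((It k).setReg x k) := fun _ => rfl
    have hIt0 : ∀ k, (It k).reg 0 = s.reg 0 := by
      intro k
      induction k with
      | zero => rfl
      | succ k ih => rw [hIt, den_reg hp0, reg_setReg, if_neg (Ne.symm hx0), ih]
    let K := (boundE m c).cost + 1 + 1 + 1 + 4 + p.cost.eval (s.reg 0)
    -- the loop, entered with `B - d` in register `x`
    have loop : ∀ d ≤ B, ∃ t ≤ d * K + ((boundE m c).cost + 1 + 1 + 1),
        Exec (.loop (.sub (boundE m c) (.reg x))
          (.seq p.compile (.assign x (.add (.reg x) (.const 1)))))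
          ((It (B - d)).setReg x (B - d)) ((It B).setReg x B) t := by
      intro d
      induction d with
      | zero =>
        intro _
        refine ⟨_, ?_, Exec.loop_false ?_⟩
        · simp [Expr.cost]
        · simp [Expr.eval, eval_boundE, Ne.symm hx0, hIt0, hB]
      | succ d ih =>
        intro hd
        obtain ⟨t, ht, hloop⟩ := ih (by omega)
        obtain ⟨k, hk⟩ : ∃ k, k = B - (d + 1) := ⟨_, rfl⟩
        have hk' : B - d = k + 1 := by omega
        rw [hk'] at hloop
        rw [← hk]
        obtain ⟨t', ht', hbody⟩ := exec_compile hwf hp0 ((It k).setReg x k)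
        rw [reg_setReg, if_neg (Ne.symm hx0), hIt0] at ht'
        have hassign := Exec.assign (p.den ((It k).setReg x k)) x (.add (.reg x) (.const 1))
        have e1 : (Expr.add (.reg x) (.const 1)).eval (p.den ((It k).setReg x k)) = k + 1 := by
          simp [Expr.eval, den_reg hx]
        rw [e1, ← hIt] at hassign
        refine ⟨_, ?_, Exec.loop_true ?_ (Exec.seq hbody hassign) hloop⟩
        · simp only [Expr.cost] at *
          simp only [K] at *
          rw [add_mul, one_mul]
          omega
        · simp only [Expr.eval, eval_boundE, reg_setReg, if_true, if_neg (Ne.symm hx0), hIt0]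
          omega
    obtain ⟨t, ht, hl⟩ := loop B le_rfl
    rw [Nat.sub_self] at hl
    refine ⟨_, ?_, Exec.seq (Exec.assign s x (.const 0)) hl⟩
    simp only [cost, Polynomial.eval_add, Polynomial.eval_mul, Polynomial.eval_C,
      Polynomial.eval_X, Polynomial.eval_ofNat, Expr.cost, ← hB]
    simp only [K] at ht
    omega

/-- Induction along a loop. -/
theorem rep_induct {x m c : ℕ} {p : LProg} (P : ℕ → State → Prop) {s : State} (h0 : P 0 s)
    (hs : ∀ i < m * s.reg 0 + c, ∀ t, P i t → P (i + 1) (p.den (t.setReg x i))) :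
    ∃ t, P (m * s.reg 0 + c) t ∧ (rep x m c p).den s = t.setReg x (m * s.reg 0 + c) := by
  refine ⟨_, ?_, rfl⟩
  have : ∀ k ≤ m * s.reg 0 + c,
      P k (Nat.rec s (fun i t => p.den (t.setReg x i)) k : State) := by
    intro k
    induction k with
    | zero => exact fun _ => h0
    | succ k ih => exact fun hk => hs k (by omega) _ (ih (by omega))
  exact this _ le_rfl

/-- Nested loops. -/
def nest : List (ℕ × ℕ × ℕ) → LProg → LProg
  | [], p => p
  | y :: ys, p => rep y.1 y.2.1 y.2.2 (nest ys p)

theorem KeepsReg.nest {x : ℕ} {p : LProg} (hp : p.KeepsReg x) :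
    ∀ {ys : List (ℕ × ℕ × ℕ)}, (∀ y ∈ ys, y.1 ≠ x) → (LProg.nest ys p).KeepsReg x
  | [], _ => hp
  | _ :: _, h => ⟨h _ (by simp), KeepsReg.nest hp fun y hy => h y (by simp [hy])⟩

theorem KeepsArr.nest {a : ℕ} {p : LProg} (hp : p.KeepsArr a) :
    ∀ {ys : List (ℕ × ℕ × ℕ)}, (LProg.nest ys p).KeepsArr a
  | [] => hp
  | _ :: ys => KeepsArr.nest hp (ys := ys)

/-- The loop variables are different from one another and from register `0`, and the body `p` does
not write them. -/
def Loops (ys : List (ℕ × ℕ × ℕ)) (p : LProg) : Prop :=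
  (ys.map Prod.fst).Nodup ∧ ∀ y ∈ ys, y.1 ≠ 0 ∧ p.KeepsReg y.1

theorem Loops.tail {y : ℕ × ℕ × ℕ} {ys : List (ℕ × ℕ × ℕ)} {p : LProg} (h : Loops (y :: ys) p) :
    Loops ys p := by
  refine ⟨(List.nodup_cons.1 (by simpa using h.1)).2, fun z hz => h.2 z (by simp [hz])⟩

theorem Loops.ne {y : ℕ × ℕ × ℕ} {ys : List (ℕ × ℕ × ℕ)} {p : LProg} (h : Loops (y :: ys) p) :
    ∀ z ∈ ys, z.1 ≠ y.1 := by
  intro z hz he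
  have := (List.nodup_cons.1 (by simpa using h.1 : (y.1 :: ys.map Prod.fst).Nodup)).1
  exact this (he ▸ List.mem_map_of_mem hz)

theorem WF.nest {p : LProg} (hp : p.WF) (h0 : p.KeepsReg 0) :
    ∀ {ys : List (ℕ × ℕ × ℕ)}, Loops ys p → (LProg.nest ys p).WF
  | [], _ => hp
  | y :: _, h => ⟨(h.2 y (by simp)).2.nest h.ne, h0.nest fun z hz => (h.2 z (by simp [hz])).1,
      (h.2 y (by simp)).1, WF.nest hp h0 h.tail⟩

/-- The values `ρ` of the loop variables are within their bounds. -/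
def Valid (n : ℕ) (ys : List (ℕ × ℕ × ℕ)) (ρ : ℕ → ℕ) : Prop :=
  ∀ y ∈ ys, ρ y.1 < y.2.1 * n + y.2.2

/-- An invariant of the body is an invariant of nested loops. -/
theorem nest_inv {n : ℕ} {p : LProg} : ∀ {ys : List (ℕ × ℕ × ℕ)}, Loops ys p →
    ∀ {Inv : State → Prop}, (∀ s, Inv s → s.reg 0 = n) →
    (∀ s, ∀ y ∈ ys, ∀ i, Inv s → Inv (s.setReg y.1 i)) →
    (∀ s, Inv s → Valid n ys s.reg → Inv (p.den s)) →
    ∀ s, Inv s → Inv ((nest ys p).den s)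
  | [], _, _, _, _, hp, s, hs => hp s hs (by simp [Valid])
  | y :: ys, hl, Inv, h0, hreg, hp, s, hs => by
    obtain ⟨t, ht, he⟩ := rep_induct (x := y.1) (m := y.2.1) (c := y.2.2) (p := nest ys p)
      (fun _ t => Inv t) hs (by
        intro i hi t ht
        rw [h0 s hs] at hi
        refine (nest_inv hl.tail (Inv := fun s => Inv s ∧ s.reg y.1 = i) (fun s hs => h0 s hs.1)
          ?_ ?_ _ ⟨hreg _ y (by simp) i ht, by simp⟩).1
        · intro s z hz j hs
          refine ⟨hreg s z (by simp [hz]) j hs.1, ?_⟩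
          rw [reg_setReg, if_neg (hl.ne z hz).symm, hs.2]
        · intro s hs hv
          refine ⟨hp s hs.1 ?_, ?_⟩
          · intro z hz
            rcases List.mem_cons.1 hz with rfl | hz
            · rw [hs.2]; exact hi
            · exact hv z hz
          · rw [den_reg (hl.2 y (by simp)).2, hs.2])
    rw [nest, he]
    exact hreg _ y (by simp) _ ht

/-- What the body achieves for given values `ρ` of the loop variables, and does not destroy for any
others, is achieved by nested loops. -/
theorem nest_done {n : ℕ} {p : LProg} {ρ : ℕ → ℕ} : ∀ {ys : List (ℕ × ℕ × ℕ)}, Loops ys p →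
    Valid n ys ρ → ∀ {Inv D : State → Prop}, (∀ s, Inv s → s.reg 0 = n) →
    (∀ s, ∀ y ∈ ys, ∀ i, Inv s → Inv (s.setReg y.1 i)) →
    (∀ s, ∀ y ∈ ys, ∀ i, D s → D (s.setReg y.1 i)) →
    (∀ s, Inv s → Valid n ys s.reg → Inv (p.den s)) →
    (∀ s, Inv s → (∀ y ∈ ys, s.reg y.1 = ρ y.1) → D (p.den s)) →
    (∀ s, Inv s → D s → Valid n ys s.reg → D (p.den s)) →
    ∀ s, Inv s → D ((nest ys p).den s)
  | [], _, _, _, _, _, _, _, _, hD, _, s, hs => hD s hs (by simp)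
  | y :: ys, hl, hρ, Inv, D, h0, hreg, hregD, hp, hD, hpD, s, hs => by
    have hy : ρ y.1 < y.2.1 * n + y.2.2 := hρ y (by simp)
    -- one round of the outermost loop, with `i` in its variable
    have inner : ∀ {Q : State → Prop}, (∀ s, Q s → s.reg 0 = n) →
        (∀ s, ∀ z ∈ y :: ys, ∀ i, Q s → Q (s.setReg z.1 i)) →
        (∀ s, Q s → Valid n (y :: ys) s.reg → Q (p.den s)) →
        ∀ i < y.2.1 * n + y.2.2, ∀ t, Q t → Q ((nest ys p).den (t.setReg y.1 i)) := by
      intro Q q0 qreg qp i hi t ht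
      refine (nest_inv hl.tail (Inv := fun s => Q s ∧ s.reg y.1 = i) (fun s hs => q0 s hs.1)
        ?_ ?_ _ ⟨qreg _ y (by simp) i ht, by simp⟩).1
      · intro s z hz j hs
        refine ⟨qreg s z (by simp [hz]) j hs.1, ?_⟩
        rw [reg_setReg, if_neg (hl.ne z hz).symm, hs.2]
      · intro s hs hv
        refine ⟨qp s hs.1 ?_, ?_⟩
        · intro z hz
          rcases List.mem_cons.1 hz with rfl | hz
          · rw [hs.2]; exact hi
          · exact hv z hz
        · rw [den_reg (hl.2 y (by simp)).2, hs.2]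
    obtain ⟨t, ht, he⟩ := rep_induct (x := y.1) (m := y.2.1) (c := y.2.2) (p := nest ys p)
      (fun i t => Inv t ∧ (ρ y.1 < i → D t)) (s := s) ⟨hs, by simp⟩ (by
        intro i hi t ht
        rw [h0 s hs] at hi
        refine ⟨inner h0 hreg hp i hi t ht.1, fun hlt => ?_⟩
        rcases Nat.lt_succ_iff_lt_or_eq.1 hlt with hlt | heq
        · exact (inner (Q := fun s => Inv s ∧ D s) (fun s h => h0 s h.1)
            (fun s z hz i h => ⟨hreg s z hz i h.1, hregD s z hz i h.2⟩)
            (fun s h hv => ⟨hp s h.1 hv, hpD s h.1 h.2 hv⟩) i hi t ⟨ht.1, ht.2 hlt⟩).2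
        · refine nest_done hl.tail (fun z hz => hρ z (by simp [hz]))
            (Inv := fun s => Inv s ∧ s.reg y.1 = i) (D := D) (fun s h => h0 s h.1) ?_ ?_ ?_ ?_ ?_
            _ ⟨hreg _ y (by simp) i ht.1, by simp⟩
          · intro s z hz j h
            refine ⟨hreg s z (by simp [hz]) j h.1, ?_⟩
            rw [reg_setReg, if_neg (hl.ne z hz).symm, h.2]
          · exact fun s z hz j h => hregD s z (by simp [hz]) j h
          · intro s h hv
            refine ⟨hp s h.1 ?_, ?_⟩
            · intro z hz
              rcases List.mem_cons.1 hz with rfl | hz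
              · rw [h.2]; exact hi
              · exact hv z hz
            · rw [den_reg (hl.2 y (by simp)).2, h.2]
          · intro s h hv
            refine hD s h.1 fun z hz => ?_
            rcases List.mem_cons.1 hz with rfl | hz
            · rw [h.2, heq]
            · exact hv z hz
          · intro s h hd hv
            refine hpD s h.1 hd fun z hz => ?_
            rcases List.mem_cons.1 hz with rfl | hz
            · rw [h.2]; exact hi
            · exact hv z hz)
    rw [nest, he]
    exact hregD _ y (by simp) _ (ht.2 (by rw [h0 s hs]; exact hy))

end LProg

end LoopProg

namespace LoopProg

open RAM

/-! ### Tests, and loops that fill an array or check a condition -/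

/-- The expression has a nonzero value, that is, it holds as a test. -/
def Holds (s : State) (e : Expr) : Prop := e.eval s ≠ 0

/-- Negation of a test. -/
def eNot (e : Expr) : Expr := .sub (.const 1) e
/-- Disjunction of tests. -/
def eOr (e f : Expr) : Expr := .add e f
/-- Conjunction of tests. -/
def eAnd (e f : Expr) : Expr := eNot (eOr (eNot e) (eNot f))
/-- The test `e < f`. -/
def eLt (e f : Expr) : Expr := .sub f e
/-- The test `e = f`. -/
def eEq (e f : Expr) : Expr := eNot (eOr (eLt e f) (eLt f e))

section Holds

variable {s : State} {e f : Expr}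

@[simp] theorem holds_not : Holds s (eNot e) ↔ ¬Holds s e := by
  simp only [Holds, eNot, Expr.eval]; omega

@[simp] theorem holds_or : Holds s (eOr e f) ↔ Holds s e ∨ Holds s f := by
  simp only [Holds, eOr, Expr.eval]; omega

@[simp] theorem holds_and : Holds s (eAnd e f) ↔ Holds s e ∧ Holds s f := by
  simp only [eAnd, holds_not, holds_or]; tauto

@[simp] theorem holds_lt : Holds s (eLt e f) ↔ e.eval s < f.eval s := by
  simp only [Holds, eLt, Expr.eval]; omega

@[simp] theorem holds_eq : Holds s (eEq e f) ↔ e.eval s = f.eval s := by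
  simp only [eEq, holds_not, holds_or, holds_lt]; omega

end Holds

namespace LProg

/-- The states agree except in array `A` and the registers in `Z`. -/
def Off (A : ℕ) (Z : List ℕ) (s t : State) : Prop :=
  (∀ a, a ≠ A → t.arr a = s.arr a) ∧ ∀ x, x ∉ Z → t.reg x = s.reg x

/-- `ρ` and `ρ'` agree on the loop variables. -/
def Agree (ys : List (ℕ × ℕ × ℕ)) (ρ ρ' : ℕ → ℕ) : Prop := ∀ y ∈ ys, ρ y.1 = ρ' y.1

/-- Nested loops whose body writes one cell `I ρ` of the array `A`, with truth value `V ρ`, for the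
values `ρ` of the loop variables. The body may read cells of `A` itself; for these it is only known
that each is unchanged or already has its new truth value. -/
theorem den_fill {n A : ℕ} {ys : List (ℕ × ℕ × ℕ)} {p : LProg} {Z : List ℕ} {s : State}
    {I : (ℕ → ℕ) → ℕ} {V : (ℕ → ℕ) → Prop} (hl : Loops ys p) (hZ : ∀ y ∈ ys, y.1 ∈ Z)
    (h0 : s.reg 0 = n) (h0Z : 0 ∉ Z)
    (hext : ∀ ρ ρ', Agree ys ρ ρ' → I ρ = I ρ' ∧ (V ρ ↔ V ρ'))
    (hI : ∀ ρ ρ', Valid n ys ρ → Valid n ys ρ' → I ρ = I ρ' → (V ρ ↔ V ρ'))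
    (hp : ∀ t, Off A Z s t → Valid n ys t.reg →
      (∀ k, (t.arr A k ≠ 0 ↔ s.arr A k ≠ 0) ∨
        ∃ ρ, Valid n ys ρ ∧ I ρ = k ∧ (t.arr A k ≠ 0 ↔ V ρ)) →
      Off A Z t (p.den t) ∧ ∃ v, (p.den t).arr A = Function.update (t.arr A) (I t.reg) v ∧
        (v ≠ 0 ↔ V t.reg)) :
    Off A Z s ((nest ys p).den s) ∧
      (∀ ρ, Valid n ys ρ → (((nest ys p).den s).arr A (I ρ) ≠ 0 ↔ V ρ)) ∧
      ∀ k, (∀ ρ, Valid n ys ρ → I ρ ≠ k) → (((nest ys p).den s).arr A k ≠ 0 ↔ s.arr A k ≠ 0) := by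
  let Inv : State → Prop := fun t => Off A Z s t ∧
    ∀ k, (t.arr A k ≠ 0 ↔ s.arr A k ≠ 0) ∨ ∃ ρ, Valid n ys ρ ∧ I ρ = k ∧ (t.arr A k ≠ 0 ↔ V ρ)
  have offreg : ∀ t, ∀ y ∈ ys, ∀ i, Inv t → Inv (t.setReg y.1 i) := by
    intro t y hy i ht
    refine ⟨⟨ht.1.1, fun x hx => ?_⟩, ht.2⟩
    rw [reg_setReg, if_neg, ht.1.2 x hx]
    rintro rfl
    exact hx (hZ y hy)
  have inv0 : ∀ t, Inv t → t.reg 0 = n := fun t ht => by rw [ht.1.2 0 h0Z, h0]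
  have step : ∀ t, Inv t → Valid n ys t.reg → Inv (p.den t) := by
    intro t ht hv
    obtain ⟨hoff, v, hv1, hv2⟩ := hp t ht.1 hv ht.2
    refine ⟨⟨fun a ha => by rw [hoff.1 a ha, ht.1.1 a ha],
      fun x hx => by rw [hoff.2 x hx, ht.1.2 x hx]⟩, fun k => ?_⟩
    by_cases hk : k = I t.reg
    · right
      refine ⟨t.reg, hv, hk.symm, ?_⟩
      rw [hv1, hk, Function.update_self, hv2]
    · rw [hv1, Function.update_of_ne hk]
      exact ht.2 k
  have start : Inv s := ⟨⟨fun _ _ => rfl, fun _ _ => rfl⟩, fun k => Or.inl Iff.rfl⟩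
  have hfin := nest_inv hl inv0 offreg step s start
  have hdone : ∀ ρ, Valid n ys ρ → (((nest ys p).den s).arr A (I ρ) ≠ 0 ↔ V ρ) := by
    intro ρ hρ
    refine nest_done hl hρ (D := fun t => t.arr A (I ρ) ≠ 0 ↔ V ρ) inv0 offreg
      (fun t y _ i ht => by simpa using ht) step ?_ ?_ s start
    · intro t ht he
      have hv : Valid n ys t.reg := fun y hy => by rw [he y hy]; exact hρ y hy
      obtain ⟨-, v, hv1, hv2⟩ := hp t ht.1 hv ht.2
      obtain ⟨e1, e2⟩ := hext t.reg ρ he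
      rw [hv1, ← e1, Function.update_self, hv2, e2]
    · intro t ht hd hv
      obtain ⟨-, v, hv1, hv2⟩ := hp t ht.1 hv ht.2
      by_cases hk : I ρ = I t.reg
      · rw [hv1, hk, Function.update_self, hv2]
        exact hI _ _ hv hρ hk.symm
      · rw [hv1, Function.update_of_ne hk]
        exact hd
  refine ⟨hfin.1, hdone, fun k hk => ?_⟩
  rcases hfin.2 k with h | ⟨ρ, hρ, he, -⟩
  · exact h
  · exact (hk ρ hρ he).elim

/-- `den_fill` for a body that is a single store. -/
theorem den_fill_store {n A : ℕ} {ys : List (ℕ × ℕ × ℕ)} {i e : Expr} {s : State}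
    {I : (ℕ → ℕ) → ℕ} {V : (ℕ → ℕ) → Prop} (hnd : (ys.map Prod.fst).Nodup)
    (h0 : s.reg 0 = n) (h0y : ∀ y ∈ ys, y.1 ≠ 0)
    (hext : ∀ ρ ρ', Agree ys ρ ρ' → I ρ = I ρ' ∧ (V ρ ↔ V ρ'))
    (hI : ∀ ρ ρ', Valid n ys ρ → Valid n ys ρ' → I ρ = I ρ' → (V ρ ↔ V ρ'))
    (hp : ∀ t, Off A (ys.map Prod.fst) s t → Valid n ys t.reg →
      (∀ k, (t.arr A k ≠ 0 ↔ s.arr A k ≠ 0) ∨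
        ∃ ρ, Valid n ys ρ ∧ I ρ = k ∧ (t.arr A k ≠ 0 ↔ V ρ)) →
      i.eval t = I t.reg ∧ (Holds t e ↔ V t.reg)) :
    Off A (ys.map Prod.fst) s ((nest ys (store A i e)).den s) ∧
      (∀ ρ, Valid n ys ρ → (((nest ys (store A i e)).den s).arr A (I ρ) ≠ 0 ↔ V ρ)) ∧
      ∀ k, (∀ ρ, Valid n ys ρ → I ρ ≠ k) →
        (((nest ys (store A i e)).den s).arr A k ≠ 0 ↔ s.arr A k ≠ 0) := by
  refine den_fill ⟨hnd, fun y hy => ⟨h0y y hy, trivial⟩⟩ (fun y hy => List.mem_map_of_mem hy) h0 ?_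
    hext hI fun t ht hv hk => ?_
  · intro h
    obtain ⟨y, hy, he⟩ := List.mem_map.1 h
    exact h0y y hy he
  · obtain ⟨h1, h2⟩ := hp t ht hv hk
    refine ⟨⟨fun a ha => ?_, fun x _ => rfl⟩, e.eval t, ?_, h2⟩
    · simp [den, ha]
    · simp [den, h1]

/-- Set register `f` to a nonzero value if the test `e` holds for all values of the loop variables,
and to zero otherwise. -/
def checkAll (f : ℕ) (ys : List (ℕ × ℕ × ℕ)) (e : Expr) : LProg :=
  seq (assign f (.const 1)) (nest ys (ite e skip (assign f (.const 0))))

theorem den_checkAll {n f : ℕ} {ys : List (ℕ × ℕ × ℕ)} {e : Expr} {s : State}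
    {Q : (ℕ → ℕ) → Prop} (hnd : (ys.map Prod.fst).Nodup) (hy : ∀ y ∈ ys, y.1 ≠ 0 ∧ f ≠ y.1)
    (hf : f ≠ 0) (h0 : s.reg 0 = n) (hext : ∀ ρ ρ', Agree ys ρ ρ' → (Q ρ ↔ Q ρ'))
    (he : ∀ t, t.arr = s.arr → (∀ x, x ≠ f → x ∉ ys.map Prod.fst → t.reg x = s.reg x) →
      Valid n ys t.reg → (Holds t e ↔ Q t.reg)) :
    ((checkAll f ys e).den s).arr = s.arr ∧
      (∀ x, x ≠ f → x ∉ ys.map Prod.fst → ((checkAll f ys e).den s).reg x = s.reg x) ∧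
      (((checkAll f ys e).den s).reg f ≠ 0 ↔ ∀ ρ, Valid n ys ρ → Q ρ) := by
  have hl : Loops ys (ite e skip (assign f (.const 0))) :=
    ⟨hnd, fun y h => ⟨(hy y h).1, trivial, (hy y h).2⟩⟩
  let Inv : State → Prop := fun t => t.arr = s.arr ∧
    (∀ x, x ≠ f → x ∉ ys.map Prod.fst → t.reg x = s.reg x) ∧
      (t.reg f ≠ 0 ∨ ∃ ρ, Valid n ys ρ ∧ ¬Q ρ)
  have h0y : 0 ∉ ys.map Prod.fst := by
    intro h
    obtain ⟨y, h, he⟩ := List.mem_map.1 h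
    exact (hy y h).1 he
  have inv0 : ∀ t, Inv t → t.reg 0 = n := fun t ht => by rw [ht.2.1 0 hf.symm h0y, h0]
  have hreg : ∀ t, ∀ y ∈ ys, ∀ i, Inv t → Inv (t.setReg y.1 i) := by
    intro t y hyy i ht
    refine ⟨ht.1, fun x hx hx' => ?_, ?_⟩
    · rw [reg_setReg, if_neg, ht.2.1 x hx hx']
      rintro rfl
      exact hx' (List.mem_map_of_mem hyy)
    · rw [reg_setReg, if_neg (hy y hyy).2]
      exact ht.2.2
  have step : ∀ t, Inv t → Valid n ys t.reg → Inv ((ite e skip (assign f (.const 0))).den t) := by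
    intro t ht hv
    have := he t ht.1 ht.2.1 hv
    simp only [den]
    split_ifs with h
    · exact ht
    · refine ⟨ht.1, fun x hx hx' => ?_, Or.inr ⟨t.reg, hv, fun hq => h (this.2 hq)⟩⟩
      rw [reg_setReg, if_neg hx, ht.2.1 x hx hx']
  have start : Inv (s.setReg f 1) := ⟨rfl, fun x hx _ => by rw [reg_setReg, if_neg hx], by simp⟩
  have hfin := nest_inv hl inv0 hreg step _ start
  have hd : (checkAll f ys e).den s =
    (nest ys (ite e skip (assign f (.const 0)))).den (s.setReg f 1) := rfl
  rw [hd]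
  refine ⟨hfin.1, hfin.2.1, fun hne ρ hρ => ?_, fun hall => ?_⟩
  · have := nest_done hl hρ (D := fun t => t.reg f ≠ 0 → Q ρ) inv0 hreg ?_ step ?_ ?_ _ start
    · exact this hne
    · intro t y hyy i ht
      rw [reg_setReg, if_neg (hy y hyy).2]
      exact ht
    · intro t ht hv
      have hv' : Valid n ys t.reg := fun y hy => by rw [hv y hy]; exact hρ y hy
      have := he t ht.1 ht.2.1 hv'
      simp only [den]
      split_ifs with h
      · intro _
        exact (hext t.reg ρ hv).1 (this.1 h)
      · simp [Expr.eval]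
    · intro t ht hd hv
      simp only [den]
      split_ifs with h
      · exact hd
      · simp [Expr.eval]
  · rcases hfin.2.2 with h | ⟨ρ, hρ, hq⟩
    · exact h
    · exact (hq (hall ρ hρ)).elim

end LProg

/-! ### Addressing

The arrays are: `0` the adjacency matrix, `1` the output, `2` the multiples of `n` (the machine
cannot multiply), `3` the current component, `4` and `5` what vertices see of the guess, `6` lists
of colours, `7` constraints, `8` a colouring. A set of pairs of a colour `a` and a vertex `v` has
the pair at address `a * n + v`. -/

/-- Register `0` holds `n`, array `0` is `A`, and array `2` is a multiplication table for `n`. -/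
structure Base (n : ℕ) (A : ℕ → ℕ) (s : State) : Prop where
  reg : s.reg 0 = n
  adj : s.arr 0 = A
  mul : ∀ k < 9 * n + 9, s.arr 2 k = k * n

/-- The product with `n`. -/
def mulE (e : Expr) : Expr := .read 2 e
/-- The address of the pair of a colour (or vertex) `e` and a vertex `f`. -/
def litE (e f : Expr) : Expr := .add (mulE e) f
/-- The test for adjacency. -/
def adjE (e f : Expr) : Expr := .read 0 (litE e f)
/-- The address of a pair of coloured vertices. -/
def idxE (a u b w : Expr) : Expr := litE (litE (.add (.add (.add a a) a) b) u) w

/-- The value of `idxE`. -/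
def idx (n a u b w : ℕ) : ℕ := ((3 * a + b) * n + u) * n + w

theorem lit_inj {n a u a' u' : ℕ} (hu : u < n) (hu' : u' < n) (h : a * n + u = a' * n + u') :
    a = a' ∧ u = u' := by
  have h1 : u = u' := by
    have := congrArg (· % n) h
    simpa [Nat.mod_eq_of_lt hu, Nat.mod_eq_of_lt hu'] using this
  subst h1
  exact ⟨Nat.eq_of_mul_eq_mul_right (by omega) (Nat.add_right_cancel h), rfl⟩

theorem idx_inj {n a u b w a' u' b' w' : ℕ} (hu : u < n) (hw : w < n) (hu' : u' < n) (hw' : w' < n)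
    (hb : b < 3) (hb' : b' < 3) (h : idx n a u b w = idx n a' u' b' w') :
    a = a' ∧ u = u' ∧ b = b' ∧ w = w' := by
  obtain ⟨h1, rfl⟩ := lit_inj hw hw' h
  obtain ⟨h2, rfl⟩ := lit_inj hu hu' h1
  exact ⟨by omega, rfl, by omega, rfl⟩

section Base

variable {n : ℕ} {A : ℕ → ℕ} {s : State}

theorem Base.den {p : LProg} (h : Base n A s) (h0 : p.KeepsReg 0) (hA : p.KeepsArr 0)
    (h2 : p.KeepsArr 2) : Base n A (p.den s) :=
  ⟨by rw [LProg.den_reg h0, h.reg], by rw [LProg.den_arr hA, h.adj],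
    by rw [LProg.den_arr h2]; exact h.mul⟩

theorem Base.of_eq {t : State} (h : Base n A s) (h0 : t.reg 0 = s.reg 0) (hA : t.arr 0 = s.arr 0)
    (h2 : t.arr 2 = s.arr 2) : Base n A t :=
  ⟨by rw [h0, h.reg], by rw [hA, h.adj], by rw [h2]; exact h.mul⟩

theorem Base.eval_lit (h : Base n A s) {e f : Expr} (he : e.eval s < 9 * n + 9) :
    (litE e f).eval s = e.eval s * n + f.eval s := by
  simp only [litE, mulE, Expr.eval, h.mul _ he]

theorem Base.eval_idx (h : Base n A s) {a u b w : Expr} (ha : a.eval s < 3) (hb : b.eval s < 3)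
    (hu : u.eval s < n) :
    (idxE a u b w).eval s = idx n (a.eval s) (u.eval s) (b.eval s) (w.eval s) := by
  have e1 : (Expr.add (.add (.add a a) a) b).eval s = 3 * a.eval s + b.eval s := by
    simp only [Expr.eval]; ring
  have e2 : (litE (.add (.add (.add a a) a) b) u).eval s =
      (3 * a.eval s + b.eval s) * n + u.eval s := by
    rw [h.eval_lit (by rw [e1]; omega), e1]
  rw [idxE, h.eval_lit, e2, idx]
  rw [e2]
  have : (3 * a.eval s + b.eval s) * n ≤ 8 * n := Nat.mul_le_mul_right n (by omega)
  omega

end Base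

end LoopProg

/-! ### Binary constraints with lists of size two, by elimination of variables -/

namespace LoopProg

open RAM LProg

/-- Constraints `R a u b w`: the vertex `u` may have colour `a` while `w` has colour `b`. The list
of `v` consists of the colours `c` with `R c v c v`. -/
abbrev Rel := ℕ → ℕ → ℕ → ℕ → Prop

/-- `f` satisfies all constraints. -/
def Sol (n : ℕ) (R : Rel) (f : ℕ → ℕ) : Prop :=
  (∀ v < n, f v < 3) ∧ ∀ u < n, ∀ w < n, R (f u) u (f w) w

/-- `R` arises from `R₀` by adding the constraints between smaller vertices that each of the
vertices `v ≥ k` entails. -/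
structure Elim (n : ℕ) (R₀ R : Rel) (k : ℕ) : Prop where
  sub : ∀ a < 3, ∀ u < n, ∀ b < 3, ∀ w < n, R a u b w → R₀ a u b w
  symm : ∀ a < 3, ∀ u < n, ∀ b < 3, ∀ w < n, R a u b w → R b w a u
  closed : ∀ v < n, k ≤ v → ∀ a < 3, ∀ u < v, ∀ b < 3, ∀ w < v, R a u b w →
    ∃ c < 3, R a u c v ∧ R c v b w ∧ R c v c v
  sol : ∀ f, Sol n R₀ f → Sol n R f

/-- Elimination of one vertex `v`. -/
theorem Elim.step {n v : ℕ} {R₀ R R' : Rel} (h : Elim n R₀ R (v + 1)) (hv : v < n)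
    (hR : ∀ a < 3, ∀ u < n, ∀ b < 3, ∀ w < n, (R' a u b w ↔
      R a u b w ∧ (u < v → w < v → ∃ c < 3, R a u c v ∧ R c v b w ∧ R c v c v))) :
    Elim n R₀ R' v := by
  have keep : ∀ a < 3, ∀ u < n, ∀ b < 3, ∀ w < n, (v ≤ u ∨ v ≤ w) → R a u b w → R' a u b w :=
    fun a ha u hu b hb w hw hvw hr => (hR a ha u hu b hb w hw).2 ⟨hr, fun h1 h2 => by omega⟩
  refine ⟨fun a ha u hu b hb w hw hr => ?_, fun a ha u hu b hb w hw hr => ?_, ?_, ?_⟩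
  · exact h.sub a ha u hu b hb w hw ((hR a ha u hu b hb w hw).1 hr).1
  · obtain ⟨h1, h2⟩ := (hR a ha u hu b hb w hw).1 hr
    refine (hR b hb w hw a ha u hu).2 ⟨h.symm a ha u hu b hb w hw h1, fun hwv huv => ?_⟩
    obtain ⟨c, hc, k1, k2, k3⟩ := h2 huv hwv
    exact ⟨c, hc, h.symm c hc v hv b hb w hw k2, h.symm a ha u hu c hc v hv k1, k3⟩
  · intro v' hv' hle a ha u hu b hb w hw hr
    obtain ⟨h1, h2⟩ := (hR a ha u (by omega) b hb w (by omega)).1 hr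
    have : ∃ c < 3, R a u c v' ∧ R c v' b w ∧ R c v' c v' := by
      rcases Nat.lt_or_ge v v' with hlt | hge
      · exact h.closed v' hv' hlt a ha u hu b hb w hw h1
      · obtain rfl : v' = v := by omega
        exact h2 hu hw
    obtain ⟨c, hc, k1, k2, k3⟩ := this
    exact ⟨c, hc, keep a ha u (by omega) c hc v' hv' (Or.inr hle) k1,
      keep c hc v' hv' b hb w (by omega) (Or.inl hle) k2,
      keep c hc v' hv' c hc v' hv' (Or.inl hle) k3⟩
  · intro f hf
    have hf' := h.sol f hf
    refine ⟨hf'.1, fun u hu w hw => ?_⟩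
    exact (hR _ (hf'.1 u hu) u hu _ (hf'.1 w hw) w hw).2 ⟨hf'.2 u hu w hw,
      fun _ _ => ⟨f v, hf'.1 v hv, hf'.2 u hu v hv, hf'.2 v hv w hw, hf'.2 v hv v hv⟩⟩

/-- The colour `c` at `v` is compatible with the colours `col u` of the smaller vertices. -/
def Fits (R : Rel) (col : ℕ → ℕ) (v c : ℕ) : Prop :=
  R c v c v ∧ ∀ u < v, R (col u) u c v

/-- After all eliminations a solution is found greedily, since lists have size at most two: if each
of two colours were excluded by some smaller vertex, then these two smaller vertices would violate
the constraint that the elimination added. -/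
theorem Elim.sol_of_fits {n : ℕ} {R₀ R : Rel} (h : Elim n R₀ R 0)
    (hlist : ∀ v < n, ¬∀ c < 3, R₀ c v c v) (hsol : ∃ f, Sol n R₀ f) {col : ℕ → ℕ}
    (hcol : ∀ v < n, col v < 3) (hfit : ∀ v < n, (∃ c < 3, Fits R col v c) → Fits R col v (col v)) :
    Sol n R₀ col := by
  obtain ⟨f, hf⟩ := hsol
  have hfR := h.sol f hf
  suffices ∀ k ≤ n, ∀ u < k, ∀ w < k, R (col u) u (col w) w from
    ⟨hcol, fun u hu w hw => h.sub _ (hcol u hu) u hu _ (hcol w hw) w hw (this n le_rfl u hu w hw)⟩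
  intro k
  induction k with
  | zero => intro _ u hu; omega
  | succ v ih =>
    intro hv
    have ih := ih (by omega)
    have hex : ∃ c < 3, Fits R col v c := by
      by_contra hcon
      push Not at hcon
      have bad : ∀ c < 3, R c v c v → ∃ u < v, ¬R (col u) u c v := by
        intro c hc hcc
        by_contra hno
        push Not at hno
        exact hcon c hc ⟨hcc, hno⟩
      obtain ⟨u₁, hu₁, hn₁⟩ := bad (f v) (hf.1 v hv) (hfR.2 v hv v hv)
      obtain ⟨c₂, hc₂, k₁, -, k₃⟩ := h.closed v hv (Nat.zero_le _) _ (hcol u₁ (by omega)) u₁ hu₁ _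
        (hcol u₁ (by omega)) u₁ hu₁ (ih u₁ hu₁ u₁ hu₁)
      obtain ⟨u₂, hu₂, hn₂⟩ := bad c₂ hc₂ k₃
      obtain ⟨c₃, hc₃, m₁, m₂, m₃⟩ := h.closed v hv (Nat.zero_le _) _ (hcol u₁ (by omega)) u₁ hu₁ _
        (hcol u₂ (by omega)) u₂ hu₂ (ih u₁ hu₁ u₂ hu₂)
      have m₂ := h.symm _ hc₃ v hv _ (hcol u₂ (by omega)) u₂ (by omega) m₂
      -- now `f v`, `c₂` and `c₃` are three different colours in the list of `v`
      have e₁ : f v ≠ c₂ := fun e => hn₁ (e ▸ k₁)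
      have e₂ : f v ≠ c₃ := fun e => hn₁ (e ▸ m₁)
      have e₃ : c₂ ≠ c₃ := fun e => hn₂ (e ▸ m₂)
      have hfv := hf.1 v hv
      refine hlist v hv fun c hc => ?_
      refine h.sub c hc v hv c hc v hv ?_
      have : c = f v ∨ c = c₂ ∨ c = c₃ := by omega
      rcases this with rfl | rfl | rfl
      · exact hfR.2 v hv v hv
      · exact k₃
      · exact m₃
    have hgood := hfit v hv hex
    intro u hu w hw
    rcases Nat.lt_succ_iff_lt_or_eq.1 hu with hu | rfl <;>
      rcases Nat.lt_succ_iff_lt_or_eq.1 hw with hw | rfl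
    · exact ih u hu w hw
    · exact hgood.2 u hu
    · exact h.symm _ (hcol w (by omega)) w (by omega) _ (hcol u hv) u hv (hgood.2 w hw)
    · exact hgood.1

/-- The constraints held in array `7`. -/
def rel (n : ℕ) (s : State) : Rel := fun a u b w => s.arr 7 (idx n a u b w) ≠ 0

/-- Look up a constraint. -/
def relE (a u b w : Expr) : Expr := .read 7 (idxE a u b w)

/-- The loops over all pairs of coloured vertices, with the colours in registers `9` and `10` and
the vertices in registers `7` and `8`. -/
def pairLoops : List (ℕ × ℕ × ℕ) := [(9, 0, 3), (7, 1, 0), (10, 0, 3), (8, 1, 0)]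

/-- The address of the current pair of coloured vertices. -/
def pairIdx : Expr := idxE (.reg 9) (.reg 7) (.reg 10) (.reg 8)

theorem valid_pairLoops {n : ℕ} {ρ : ℕ → ℕ} :
    Valid n pairLoops ρ ↔ ρ 9 < 3 ∧ ρ 7 < n ∧ ρ 10 < 3 ∧ ρ 8 < n := by
  simp [Valid, pairLoops]

/-- Filling array `7` with constraints. -/
theorem fill_rel {n : ℕ} {A : ℕ → ℕ} {e : Expr} {s : State} (hs : Base n A s) {V : Rel}
    (hp : ∀ t a u b w, a < 3 → u < n → b < 3 → w < n → Base n A t →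
      (∀ k, k ≠ 7 → t.arr k = s.arr k) →
      (∀ x, x ≠ 9 → x ≠ 7 → x ≠ 10 → x ≠ 8 → t.reg x = s.reg x) →
      t.reg 9 = a → t.reg 7 = u → t.reg 10 = b → t.reg 8 = w →
      (∀ a' < 3, ∀ u' < n, ∀ b' < 3, ∀ w' < n,
        (rel n t a' u' b' w' ↔ rel n s a' u' b' w') ∨ (rel n t a' u' b' w' ↔ V a' u' b' w')) →
      (Holds t e ↔ V a u b w)) :
    ∀ a < 3, ∀ u < n, ∀ b < 3, ∀ w < n,
      (rel n ((nest pairLoops (store 7 pairIdx e)).den s) a u b w ↔ V a u b w) := by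
  have key := den_fill_store (n := n) (A := 7) (ys := pairLoops) (i := pairIdx) (e := e) (s := s)
    (I := fun ρ => idx n (ρ 9) (ρ 7) (ρ 10) (ρ 8)) (V := fun ρ => V (ρ 9) (ρ 7) (ρ 10) (ρ 8))
    (by decide) hs.reg (by decide) ?_ ?_ ?_
  · intro a ha u hu b hb w hw
    have := key.2.1 (fun x => if x = 9 then a else if x = 7 then u else if x = 10 then b else w)
      (valid_pairLoops.2 (by simp [ha, hu, hb, hw]))
    simpa [rel] using this
  · intro ρ ρ' h
    have h9 := h (9, 0, 3) (by simp [pairLoops])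
    have h7 := h (7, 1, 0) (by simp [pairLoops])
    have h10 := h (10, 0, 3) (by simp [pairLoops])
    have h8 := h (8, 1, 0) (by simp [pairLoops])
    simp only at h9 h7 h10 h8
    simp [h9, h7, h10, h8]
  · intro ρ ρ' h h' he
    rw [valid_pairLoops] at h h'
    obtain ⟨e1, e2, e3, e4⟩ := idx_inj h.2.1 h.2.2.2 h'.2.1 h'.2.2.2 h.2.2.1 h'.2.2.1 he
    simp [e1, e2, e3, e4]
  · intro t ht hv hk
    rw [valid_pairLoops] at hv
    have hb : Base n A t := hs.of_eq (ht.2 0 (by decide)) (ht.1 0 (by decide)) (ht.1 2 (by decide))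
    refine ⟨hb.eval_idx hv.1 hv.2.2.1 hv.2.1, ?_⟩
    refine hp t _ _ _ _ hv.1 hv.2.1 hv.2.2.1 hv.2.2.2 hb ht.1 (fun x h1 h2 h3 h4 => ht.2 x ?_)
      rfl rfl rfl rfl ?_
    · simp [pairLoops, h1, h2, h3, h4]
    · intro a' ha' u' hu' b' hb' w' hw'
      rcases hk (idx n a' u' b' w') with h | ⟨ρ, hρ, he, h⟩
      · exact Or.inl h
      · rw [valid_pairLoops] at hρ
        obtain ⟨rfl, rfl, rfl, rfl⟩ := idx_inj hρ.2.1 hρ.2.2.2 hu' hw' hρ.2.2.1 hb' he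
        exact Or.inr h

/-- Elimination of the vertex in register `6`. -/
def elimStep : LProg :=
  nest pairLoops (store 7 pairIdx (eAnd (.read 7 pairIdx)
    (eOr (eNot (eAnd (eLt (.reg 7) (.reg 6)) (eLt (.reg 8) (.reg 6))))
      (eOr (via 0) (eOr (via 1) (via 2))))))
where
  /-- Both ends of the pair are compatible with colour `c` at the eliminated vertex. -/
  via (c : ℕ) : Expr :=
    eAnd (relE (.reg 9) (.reg 7) (.const c) (.reg 6))
      (eAnd (relE (.const c) (.reg 6) (.reg 10) (.reg 8))
        (relE (.const c) (.reg 6) (.const c) (.reg 6)))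

theorem Base.holds_rel {n : ℕ} {A : ℕ → ℕ} {s : State} (h : Base n A s) {a u b w : Expr}
    (ha : a.eval s < 3) (hb : b.eval s < 3) (hu : u.eval s < n) :
    Holds s (relE a u b w) ↔ rel n s (a.eval s) (u.eval s) (b.eval s) (w.eval s) := by
  simp only [Holds, relE, Expr.eval, h.eval_idx ha hb hu, rel]

theorem exists_lt_three {P : ℕ → Prop} : (∃ c < 3, P c) ↔ P 0 ∨ P 1 ∨ P 2 := by
  constructor
  · rintro ⟨c, hc, h⟩
    interval_cases c <;> simp [h]
  · rintro (h | h | h)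
    · exact ⟨0, by omega, h⟩
    · exact ⟨1, by omega, h⟩
    · exact ⟨2, by omega, h⟩

theorem den_elimStep {n v : ℕ} {A : ℕ → ℕ} {s : State} (hs : Base n A s) (hv : s.reg 6 = v)
    (hvn : v < n) : ∀ a < 3, ∀ u < n, ∀ b < 3, ∀ w < n, (rel n (elimStep.den s) a u b w ↔
      rel n s a u b w ∧ (u < v → w < v →
        ∃ c < 3, rel n s a u c v ∧ rel n s c v b w ∧ rel n s c v c v)) := by
  refine fill_rel hs fun t a u b w ha hu hb hw ht _ hreg h9 h7 h10 h8 hcell => ?_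
  have h6 : t.reg 6 = v := by rw [hreg 6 (by decide) (by decide) (by decide) (by decide), hv]
  have own : Holds t (.read 7 pairIdx) ↔ rel n t a u b w := by
    have := ht.holds_rel (a := .reg 9) (u := .reg 7) (b := .reg 10) (w := .reg 8)
      (by simpa [Expr.eval, h9]) (by simpa [Expr.eval, h10]) (by simpa [Expr.eval, h7])
    simp only [Expr.eval, h9, h7, h10, h8] at this
    exact this
  -- the constraints that involve `v` are not changed
  have same : ∀ a < 3, ∀ u < n, ∀ b < 3, ∀ w < n, v ≤ u ∨ v ≤ w →
      (rel n t a u b w ↔ rel n s a u b w) := by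
    intro a ha u hu b hb w hw hle
    rcases hcell a ha u hu b hb w hw with h | h
    · exact h
    · rw [h]
      exact ⟨fun h => h.1, fun h => ⟨h, fun h1 h2 => by omega⟩⟩
  have hvia : ∀ c < 3, (Holds t (elimStep.via c) ↔
      rel n s a u c v ∧ rel n s c v b w ∧ rel n s c v c v) := by
    intro c hc
    have e1 := ht.holds_rel (a := .reg 9) (u := .reg 7) (b := .const c) (w := .reg 6)
      (by simpa [Expr.eval, h9]) (by simpa [Expr.eval]) (by simpa [Expr.eval, h7])
    have e2 := ht.holds_rel (a := .const c) (u := .reg 6) (b := .reg 10) (w := .reg 8)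
      (by simpa [Expr.eval]) (by simpa [Expr.eval, h10]) (by simpa [Expr.eval, h6])
    have e3 := ht.holds_rel (a := .const c) (u := .reg 6) (b := .const c) (w := .reg 6)
      (by simpa [Expr.eval]) (by simpa [Expr.eval]) (by simpa [Expr.eval, h6])
    simp only [Expr.eval, h6, h7, h8, h9, h10] at e1 e2 e3
    rw [elimStep.via, holds_and, holds_and, e1, e2, e3,
      same a ha u hu c hc v hvn (Or.inr le_rfl), same c hc v hvn b hb w hw (Or.inl le_rfl),
      same c hc v hvn c hc v hvn (Or.inl le_rfl)]
  have hE : (∃ c < 3, rel n s a u c v ∧ rel n s c v b w ∧ rel n s c v c v) ↔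
      Holds t (elimStep.via 0) ∨ Holds t (elimStep.via 1) ∨ Holds t (elimStep.via 2) := by
    rw [hvia 0 (by omega), hvia 1 (by omega), hvia 2 (by omega), exists_lt_three]
  have hc := hcell a ha u hu b hb w hw
  rw [holds_and, own, holds_or, holds_or, holds_or, ← hE, holds_not, holds_and, holds_lt, holds_lt]
  simp only [Expr.eval, h6, h7, h8]
  clear hcell hvia same own hE
  generalize rel n s a u b w = p at hc ⊢
  generalize rel n t a u b w = q at hc ⊢
  generalize (∃ c < 3, rel n s a u c v ∧ rel n s c v b w ∧ rel n s c v c v) = r at hc ⊢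
  by_cases h1 : u < v <;> by_cases h2 : w < v <;> simp only [h1, h2, and_true,
    not_true, not_false_eq_true, and_false, true_or, false_or, forall_true_left,
    false_implies, implies_true] at hc ⊢ <;> tauto

/-- Elimination of all vertices, from the largest to the smallest. -/
def elimP : LProg :=
  rep 5 1 0 (seq (assign 6 (.sub (.sub (.reg 0) (.const 1)) (.reg 5))) elimStep)

theorem den_elimP {n : ℕ} {A : ℕ → ℕ} {s : State} (hs : Base n A s)
    (hsymm : ∀ a < 3, ∀ u < n, ∀ b < 3, ∀ w < n, rel n s a u b w → rel n s b w a u) :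
    Elim n (rel n s) (rel n (elimP.den s)) 0 := by
  obtain ⟨t, ht, he⟩ := rep_induct (x := 5) (m := 1) (c := 0)
    (p := seq (assign 6 (.sub (.sub (.reg 0) (.const 1)) (.reg 5))) elimStep)
    (fun i t => Base n A t ∧ Elim n (rel n s) (rel n t) (n - i)) (s := s)
    ⟨hs, fun _ _ _ _ _ _ _ _ h => h, hsymm, fun v hv hle => by omega, fun f hf => hf⟩ (by
      intro i hi t ⟨hb, hE⟩
      rw [hs.reg] at hi
      let t' := (t.setReg 5 i).setReg 6 (n - 1 - i)
      have ht' : (seq (assign 6 (.sub (.sub (.reg 0) (.const 1)) (.reg 5))) elimStep).den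
          (t.setReg 5 i) = elimStep.den t' := by
        simp [den, Expr.eval, hb.reg, t']
      rw [ht']
      have hb' : Base n A t' := hb.of_eq (by simp [t']) rfl rfl
      refine ⟨hb'.den (by simp [elimStep, nest, pairLoops, KeepsReg])
        (by simp [elimStep, nest, pairLoops, KeepsArr])
        (by simp [elimStep, nest, pairLoops, KeepsArr]), ?_⟩
      have e1 : n - (i + 1) = n - 1 - i := by omega
      have e2 : n - i = n - 1 - i + 1 := by omega
      rw [e1]
      rw [e2] at hE
      exact hE.step (by omega) (den_elimStep hb' (by simp [t']) (by omega)))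
  have hrel : rel n (elimP.den s) = rel n t := by rw [elimP, he]; rfl
  rw [hrel]
  have := ht.2
  rwa [hs.reg, one_mul, add_zero, Nat.sub_self] at this

/-- Give the vertex in register `6` the colour in register `11`, in array `8`, if it fits. -/
def tryColour : LProg :=
  seq (checkAll 12 [(7, 1, 0)] (eOr (eNot (eLt (.reg 7) (.reg 6)))
      (relE (.read 8 (.reg 7)) (.reg 7) (.reg 11) (.reg 6))))
    (ite (eAnd (.reg 12) (relE (.reg 11) (.reg 6) (.reg 11) (.reg 6)))
      (store 8 (.reg 6) (.reg 11)) skip)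

/-- Colour the vertices in increasing order, each with a fitting colour if there is one. -/
def solveP : LProg :=
  rep 6 1 0 (seq (store 8 (.reg 6) (.const 0)) (rep 11 0 3 tryColour))

theorem fits_congr {R : Rel} {col col' : ℕ → ℕ} {v c : ℕ} (h : ∀ u < v, col u = col' u) :
    Fits R col v c ↔ Fits R col' v c := by
  refine and_congr Iff.rfl (forall₂_congr fun u hu => by rw [h u hu])

theorem den_tryColour {n v c : ℕ} {A : ℕ → ℕ} {t : State} (ht : Base n A t) (h6 : t.reg 6 = v)
    (h11 : t.reg 11 = c) (hc : c < 3) (hv : v < n) (hcol : ∀ u < v, t.arr 8 u < 3) :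
    (Fits (rel n t) (t.arr 8) v c → (tryColour.den t).arr 8 = Function.update (t.arr 8) v c) ∧
      (¬Fits (rel n t) (t.arr 8) v c → (tryColour.den t).arr 8 = t.arr 8) := by
  obtain ⟨k1, k2, k3⟩ := den_checkAll (n := n) (f := 12) (ys := [(7, 1, 0)])
    (e := eOr (eNot (eLt (.reg 7) (.reg 6)))
      (relE (.read 8 (.reg 7)) (.reg 7) (.reg 11) (.reg 6))) (s := t)
    (Q := fun ρ => ρ 7 < v → rel n t (t.arr 8 (ρ 7)) (ρ 7) c v)
    (by decide) (by decide) (by decide) ht.reg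
    (by
      intro ρ ρ' h
      have h7 : ρ 7 = ρ' 7 := h (7, 1, 0) (by simp)
      simp only [h7])
    (by
      intro t₃ h1 h2 h3
      have r6 : t₃.reg 6 = v := by rw [h2 6 (by decide) (by decide), h6]
      have r11 : t₃.reg 11 = c := by rw [h2 11 (by decide) (by decide), h11]
      have h3' : t₃.reg 7 < n := by simpa [Valid] using h3
      have hb₃ : Base n A t₃ := ht.of_eq (h2 0 (by decide) (by decide)) (by rw [h1]) (by rw [h1])
      have hrel : rel n t₃ = rel n t := by unfold rel; rw [h1]
      by_cases hlt : t₃.reg 7 < v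
      · have := hb₃.holds_rel (a := .read 8 (.reg 7)) (u := .reg 7) (b := .reg 11)
          (w := .reg 6) (by simp only [Expr.eval, h1]; exact hcol _ hlt)
          (by simpa [Expr.eval, r11]) (by simpa [Expr.eval])
        simp only [Expr.eval, r6, r11, h1, hrel] at this
        rw [holds_or, holds_not, holds_lt, this]
        simp only [Expr.eval, r6, hlt, not_true, false_or, forall_true_left]
      · rw [holds_or, holds_not, holds_lt]
        simp only [Expr.eval, r6, hlt, not_false_eq_true, true_or, false_implies])
  rw [tryColour]
  simp only [den]
  generalize (checkAll 12 [(7, 1, 0)] _).den t = t₃ at k1 k2 k3 ⊢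
  have r6 : t₃.reg 6 = v := by rw [k2 6 (by decide) (by decide), h6]
  have r11 : t₃.reg 11 = c := by rw [k2 11 (by decide) (by decide), h11]
  have hb₃ : Base n A t₃ := ht.of_eq (k2 0 (by decide) (by decide)) (by rw [k1]) (by rw [k1])
  have hrel₃ : rel n t₃ = rel n t := by unfold rel; rw [k1]
  have hrel := hb₃.holds_rel (a := .reg 11) (u := .reg 6) (b := .reg 11) (w := .reg 6)
    (by simpa [Expr.eval, r11]) (by simpa [Expr.eval, r11]) (by simpa [Expr.eval, r6])
  simp only [Expr.eval, r6, r11, hrel₃] at hrel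
  have htest : Holds t₃ (eAnd (.reg 12) (relE (.reg 11) (.reg 6) (.reg 11) (.reg 6))) ↔
      Fits (rel n t) (t.arr 8) v c := by
    rw [holds_and, hrel, Fits, and_comm]
    refine and_congr Iff.rfl (k3.trans ⟨fun h u hu => ?_, fun h ρ _ hρ => h _ hρ⟩)
    exact h (fun _ => u) (by simp [Valid]; omega) hu
  refine ⟨fun h => ?_, fun h => ?_⟩
  · have h' := htest.2 h
    rw [Holds] at h'
    rw [if_pos h']
    simp [Expr.eval, r6, r11, k1]
  · have h' := mt htest.1 h
    rw [Holds] at h'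
    rw [if_neg h', k1]

theorem den_solveP {n : ℕ} {A : ℕ → ℕ} {s : State} (hs : Base n A s) :
    (∀ v < n, (solveP.den s).arr 8 v < 3) ∧ ∀ v < n, (∃ c < 3,
      Fits (rel n s) ((solveP.den s).arr 8) v c) →
        Fits (rel n s) ((solveP.den s).arr 8) v ((solveP.den s).arr 8 v) := by
  have hb0 : ∀ {t : State}, t.reg 0 = s.reg 0 → (∀ k, k ≠ 8 → t.arr k = s.arr k) → Base n A t :=
    fun h1 h2 => hs.of_eq h1 (h2 0 (by decide)) (h2 2 (by decide))
  have k0 : tryColour.KeepsReg 0 := by simp [tryColour, checkAll, nest, KeepsReg]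
  have k6 : tryColour.KeepsReg 6 := by simp [tryColour, checkAll, nest, KeepsReg]
  have ka : ∀ k, k ≠ 8 → tryColour.KeepsArr k := fun k hk => by
    simp [tryColour, checkAll, nest, KeepsArr, Ne.symm hk]
  obtain ⟨t, ht, he⟩ := rep_induct (x := 6) (m := 1) (c := 0)
    (p := seq (store 8 (.reg 6) (.const 0)) (rep 11 0 3 tryColour))
    (fun i t => t.reg 0 = s.reg 0 ∧ (∀ k, k ≠ 8 → t.arr k = s.arr k) ∧ ∀ v < i, t.arr 8 v < 3 ∧
      ((∃ c < 3, Fits (rel n s) (t.arr 8) v c) → Fits (rel n s) (t.arr 8) v (t.arr 8 v)))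
    (s := s) ⟨rfl, fun _ _ => rfl, fun v hv => by omega⟩ (by
      intro v hv t ⟨hr, ha, hc⟩
      rw [hs.reg, one_mul, add_zero] at hv
      let t₀ := (t.setReg 6 v).setArr 8 v 0
      have hden : (store 8 (.reg 6) (.const 0)).den (t.setReg 6 v) = t₀ := by
        simp [den, Expr.eval, t₀]
      rw [den, hden]
      -- the loop over the colours `c` for `v`
      obtain ⟨t', ht', he'⟩ := rep_induct (x := 11) (m := 0) (c := 3) (p := tryColour)
        (fun i t' => t'.reg 0 = s.reg 0 ∧ t'.reg 6 = v ∧ (∀ k, k ≠ 8 → t'.arr k = s.arr k) ∧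
          (∀ u, u ≠ v → t'.arr 8 u = t.arr 8 u) ∧ t'.arr 8 v < 3 ∧
          ((∃ c < i, Fits (rel n s) (t.arr 8) v c) → Fits (rel n s) (t.arr 8) v (t'.arr 8 v)))
        (s := t₀) ⟨by simp [t₀, hr], by simp [t₀],
          fun k hk => by simp [t₀, hk, ha k hk], fun u hu => by simp [t₀, hu], by simp [t₀],
          fun ⟨c, hc, _⟩ => by omega⟩ (by
            intro c hc3 t₁ ⟨q0, q6, qa, qu, qv, qf⟩
            rw [zero_mul, zero_add] at hc3
            have hrel : rel n (t₁.setReg 11 c) = rel n s := by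
              unfold rel
              rw [arr_setReg, qa 7 (by decide)]
            have hfits : Fits (rel n (t₁.setReg 11 c)) ((t₁.setReg 11 c).arr 8) v c ↔
                Fits (rel n s) (t.arr 8) v c := by
              rw [hrel]
              exact fits_congr fun u hu => qu u hu.ne
            obtain ⟨m1, m2⟩ := den_tryColour (t := t₁.setReg 11 c) (v := v) (c := c)
              (hb0 (by simp [q0]) qa) (by simp [q6]) (by simp) hc3 hv (fun u hu => by
                rw [arr_setReg, qu u hu.ne]; exact (hc u hu).1)
            rw [hfits] at m1 m2
            refine ⟨by rw [den_reg k0]; simp [q0], by rw [den_reg k6]; simp [q6],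
              fun k hk => by rw [den_arr (ka k hk)]; exact qa k hk, ?_⟩
            by_cases hf : Fits (rel n s) (t.arr 8) v c
            · rw [m1 hf]
              refine ⟨fun u hu => by rw [Function.update_of_ne hu]; exact qu u hu, ?_, ?_⟩
              · rw [Function.update_self]; exact hc3
              · rw [Function.update_self]; exact fun _ => hf
            · rw [m2 hf]
              refine ⟨qu, qv, fun ⟨c', hc', hf'⟩ => qf ⟨c', ?_, hf'⟩⟩
              have : c' ≠ c := fun h => hf (h ▸ hf')
              omega)
      rw [he']
      obtain ⟨q0, q6, qa, qu, qv, qf⟩ := ht'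
      refine ⟨by simp [q0], qa, fun v' hv' => ?_⟩
      have agree : ∀ u < v', t'.arr 8 u = t.arr 8 u := fun u hu => qu u (by omega)
      simp only [arr_setReg]
      have hcongr : ∀ c, Fits (rel n s) (t'.arr 8) v' c ↔ Fits (rel n s) (t.arr 8) v' c :=
        fun c => fits_congr agree
      simp only [hcongr]
      rcases Nat.lt_succ_iff_lt_or_eq.1 hv' with hlt | rfl
      · rw [qu v' hlt.ne]
        exact hc v' hlt
      · exact ⟨qv, by simpa using qf⟩)
  rw [solveP, he]
  rw [hs.reg, one_mul, add_zero] at ht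
  simp only [arr_setReg]
  exact ⟨fun v hv => (ht.2.2 v hv).1, fun v hv => (ht.2.2 v hv).2⟩

end LoopProg

/-! ### The lists of a guess, and the search for a colouring that respects it -/

namespace LoopProg

open RAM LProg

/-- Adjacency, as read off from the adjacency matrix `A`. -/
def Edge (n : ℕ) (A : ℕ → ℕ) (u v : ℕ) : Prop := A (u * n + v) ≠ 0

/-- Array `K` as a set of pairs of a colour and a vertex. -/
def lits (n : ℕ) (s : State) (K a v : ℕ) : Prop := s.arr K (a * n + v) ≠ 0

/-- The loops over all colours, in register `9`, and all vertices, in register `6`. -/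
def litLoops : List (ℕ × ℕ × ℕ) := [(9, 0, 3), (6, 1, 0)]

theorem valid_litLoops {n : ℕ} {ρ : ℕ → ℕ} : Valid n litLoops ρ ↔ ρ 9 < 3 ∧ ρ 6 < n := by
  simp [Valid, litLoops]

section

variable {n : ℕ} {A : ℕ → ℕ} {s : State}

theorem Base.holds_lits (h : Base n A s) {K : ℕ} {e f : Expr} (he : e.eval s < 3) :
    Holds s (.read K (litE e f)) ↔ lits n s K (e.eval s) (f.eval s) := by
  simp only [Holds, Expr.eval, h.eval_lit (by omega : e.eval s < 9 * n + 9), lits]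

theorem Base.holds_edge (h : Base n A s) {e f : Expr} (he : e.eval s ≤ n) :
    Holds s (adjE e f) ↔ Edge n A (e.eval s) (f.eval s) := by
  simp only [Holds, adjE, Expr.eval, h.eval_lit (by omega : e.eval s < 9 * n + 9), h.adj, Edge]

/-- Filling an array with pairs of a colour and a vertex. -/
theorem fill_lits {K : ℕ} {p : LProg} {Z : List ℕ} (hs : Base n A s) {V : ℕ → ℕ → Prop}
    (hK : K ≠ 0 ∧ K ≠ 2) (hl : Loops litLoops p) (hZ : 9 ∈ Z ∧ 6 ∈ Z) (h0Z : 0 ∉ Z)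
    (hp : ∀ t a v, a < 3 → v < n → Base n A t → Off K Z s t → t.reg 9 = a → t.reg 6 = v →
      Off K Z t (p.den t) ∧ ∃ x, (p.den t).arr K = Function.update (t.arr K) (a * n + v) x ∧
        (x ≠ 0 ↔ V a v)) :
    Off K Z s ((nest litLoops p).den s) ∧
      ∀ a < 3, ∀ v < n, lits n ((nest litLoops p).den s) K a v ↔ V a v := by
  have key := den_fill (n := n) (A := K) (ys := litLoops) (p := p) (Z := Z) (s := s)
    (I := fun ρ => ρ 9 * n + ρ 6) (V := fun ρ => V (ρ 9) (ρ 6)) hl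
    (by simpa [litLoops] using hZ) hs.reg h0Z ?_ ?_ ?_
  · refine ⟨key.1, fun a ha v hv => ?_⟩
    have := key.2.1 (fun x => if x = 9 then a else v) (valid_litLoops.2 (by simp [ha, hv]))
    simpa [lits] using this
  · intro ρ ρ' h
    have h9 := h (9, 0, 3) (by simp [litLoops])
    have h6 := h (6, 1, 0) (by simp [litLoops])
    simp only at h9 h6
    simp [h9, h6]
  · intro ρ ρ' h h' he
    rw [valid_litLoops] at h h'
    obtain ⟨e1, e2⟩ := lit_inj h.2 h'.2 he
    simp [e1, e2]
  · intro t ht hv _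
    rw [valid_litLoops] at hv
    exact hp t _ _ hv.1 hv.2 (hs.of_eq (ht.2 0 h0Z) (ht.1 0 hK.1.symm) (ht.1 2 hK.2.symm)) ht
      rfl rfl

/-- `fill_lits` for a body that is a single store. -/
theorem fill_lits_store {K : ℕ} {e : Expr} (hs : Base n A s) {V : ℕ → ℕ → Prop}
    (hK : K ≠ 0 ∧ K ≠ 2)
    (hp : ∀ t a v, a < 3 → v < n → Base n A t → Off K [9, 6] s t → t.reg 9 = a → t.reg 6 = v →
      (Holds t e ↔ V a v)) :
    Off K [9, 6] s ((nest litLoops (store K (litE (.reg 9) (.reg 6)) e)).den s) ∧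
      ∀ a < 3, ∀ v < n,
        lits n ((nest litLoops (store K (litE (.reg 9) (.reg 6)) e)).den s) K a v ↔ V a v := by
  refine fill_lits hs hK ⟨by decide, by simp [litLoops, KeepsReg]⟩ (by simp) (by simp)
    fun t a v ha hv ht hoff h9 h6 => ⟨⟨fun k hk => by simp [den, hk], fun _ _ => rfl⟩, e.eval t, ?_,
      hp t a v ha hv ht hoff h9 h6⟩
  have : (litE (.reg 9) (.reg 6)).eval t = a * n + v := by
    rw [ht.eval_lit (by simp only [Expr.eval, h9]; omega)]
    simp [Expr.eval, h9, h6]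
  simp [den, this]

end

/-! A guess consists of 93 vertices, in the registers from `20` on, with their colours, in the
registers from `120` on. The value `n`, which is not a vertex and has no neighbours, stands for
the absence of a vertex. -/

/-- One of the first `k` guessed vertices has colour `a` and is adjacent to `v`. -/
def Sees (n : ℕ) (A ρ : ℕ → ℕ) (k a v : ℕ) : Prop :=
  ∃ j < k, ρ (120 + j) = a ∧ Edge n A (ρ (20 + j)) v

/-- The test for `Sees`, with the colour in register `9` and the vertex in register `6`. -/
def seesE : ℕ → Expr
  | 0 => .const 0
  | k + 1 => eOr (seesE k) (eAnd (eEq (.reg (120 + k)) (.reg 9)) (adjE (.reg (20 + k)) (.reg 6)))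

/-- The guess is within the bounds. -/
def Guess (n : ℕ) (ρ : ℕ → ℕ) : Prop := ∀ j < 93, ρ (20 + j) ≤ n ∧ ρ (120 + j) < 3

section

variable {n : ℕ} {A : ℕ → ℕ} {s : State}

theorem Base.holds_seesE (h : Base n A s) : ∀ {k : ℕ}, (∀ j < k, s.reg (20 + j) ≤ n) →
    (Holds s (seesE k) ↔ Sees n A s.reg k (s.reg 9) (s.reg 6))
  | 0, _ => by simp [seesE, Holds, Expr.eval, Sees]
  | k + 1, hk => by
    rw [seesE, holds_or, h.holds_seesE fun j hj => hk j (by omega), holds_and, holds_eq,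
      h.holds_edge (by simpa [Expr.eval] using hk k (by omega))]
    simp only [Expr.eval, Sees, Nat.lt_succ_iff_lt_or_eq, or_and_right, exists_or, exists_eq_left]

/-- Tabulate what the guessed vertices see, in arrays `4` (all of them) and `5` (the first nine). -/
def seesP : LProg :=
  seq (nest litLoops (store 4 (litE (.reg 9) (.reg 6)) (seesE 93)))
    (nest litLoops (store 5 (litE (.reg 9) (.reg 6)) (seesE 9)))

theorem sees_congr {ρ ρ' : ℕ → ℕ} {k a v : ℕ} (h : ∀ x ≥ 20, ρ x = ρ' x) :
    Sees n A ρ k a v ↔ Sees n A ρ' k a v := by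
  refine exists_congr fun j => and_congr Iff.rfl ?_
  rw [h _ (by omega), h _ (by omega)]

theorem den_seesP (hs : Base n A s) (hg : Guess n s.reg) :
    (∀ k, k ≠ 4 → k ≠ 5 → (seesP.den s).arr k = s.arr k) ∧
      (∀ a < 3, ∀ v < n, lits n (seesP.den s) 4 a v ↔ Sees n A s.reg 93 a v) ∧
      ∀ a < 3, ∀ v < n, lits n (seesP.den s) 5 a v ↔ Sees n A s.reg 9 a v := by
  have body : ∀ {K k : ℕ} {t₀ : State}, (∀ x ≥ 20, t₀.reg x = s.reg x) → k ≤ 93 →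
      ∀ t a v, a < 3 → v < n → Base n A t → Off K [9, 6] t₀ t → t.reg 9 = a → t.reg 6 = v →
      (Holds t (seesE k) ↔ Sees n A s.reg k a v) := by
    intro K k t₀ h₀ hk t a v ha hv hb hoff h9 h6
    have hreg : ∀ x ≥ 20, t.reg x = s.reg x := fun x hx => by
      rw [hoff.2 x (by simp; omega), h₀ x hx]
    rw [hb.holds_seesE fun j hj => by rw [hreg _ (by omega)]; exact (hg j (by omega)).1, h9, h6]
    exact sees_congr hreg
  obtain ⟨o1, l1⟩ := fill_lits_store (K := 4) hs (by decide) (body (fun _ _ => rfl) le_rfl)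
  rw [seesP, den]
  generalize (nest litLoops (store 4 (litE (.reg 9) (.reg 6)) (seesE 93))).den s = t at o1 l1 ⊢
  have hb : Base n A t := hs.of_eq (o1.2 0 (by decide)) (o1.1 0 (by decide)) (o1.1 2 (by decide))
  obtain ⟨o2, l2⟩ := fill_lits_store (K := 5) (V := Sees n A s.reg 9) hb (by decide)
    (body (fun x hx => o1.2 x (by simp; omega)) (by omega))
  refine ⟨fun k h4 h5 => by rw [o2.1 k h5, o1.1 k h4], fun a ha v hv => ?_, l2⟩
  rw [← l1 a ha v hv, lits, lits, o2.1 4 (by decide)]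

end

/-- The list of the vertex `v`. For `v` in the component `M` it consists of the colours not seen by
`v`, if `v` sees any, where `S` says what is seen from the guessed vertices. Otherwise it consists
of the colours `a` such that all neighbours of `v` that see one of the first nine guessed vertices
see colour `a` among these; `S₁` says what is seen from them. -/
def Listed (n : ℕ) (A : ℕ → ℕ) (M : ℕ → Prop) (S S₁ : ℕ → ℕ → Prop) (a v : ℕ) : Prop :=
  ¬M v ∨ ((∃ c < 3, S c v) ∧ ¬S a v) ∨
    ((¬∃ c < 3, S c v) ∧ ∀ u < n, Edge n A v u → (∃ c < 3, S₁ c u) → S₁ a u)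

/-- Some colour at `e` is marked in array `K`. -/
def anyE (K : ℕ) (e : Expr) : Expr :=
  eOr (.read K (litE (.const 0) e))
    (eOr (.read K (litE (.const 1) e)) (.read K (litE (.const 2) e)))

/-- Compute the lists, in array `6`. -/
def listP : LProg :=
  nest litLoops (seq
    (checkAll 12 [(7, 1, 0)] (eNot (eAnd (adjE (.reg 6) (.reg 7))
      (eAnd (anyE 5 (.reg 7)) (eNot (.read 5 (litE (.reg 9) (.reg 7))))))))
    (store 6 (litE (.reg 9) (.reg 6)) (eOr (eNot (.read 3 (.reg 6)))
      (eOr (eAnd (anyE 4 (.reg 6)) (eNot (.read 4 (litE (.reg 9) (.reg 6)))))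
        (eAnd (eNot (anyE 4 (.reg 6))) (.reg 12))))))

/-- The constraints: colourings of the component `M` with colours from the lists `L`, where colour
`2` is removed from lists that contain all colours. -/
def Con (n : ℕ) (A : ℕ → ℕ) (M : ℕ → Prop) (L : ℕ → ℕ → Prop) : Rel := fun a u b w =>
  ¬(M u ∧ a = b ∧ Edge n A u w) ∧ (u = w → a = b → L a u ∧ ¬(a = 2 ∧ L 0 u ∧ L 1 u))

/-- Compute the constraints, in array `7`. -/
def relP : LProg :=
  nest pairLoops (store 7 pairIdx (eAnd
    (eNot (eAnd (.read 3 (.reg 7)) (eAnd (eEq (.reg 9) (.reg 10)) (adjE (.reg 7) (.reg 8)))))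
    (eOr (eNot (eAnd (eEq (.reg 7) (.reg 8)) (eEq (.reg 9) (.reg 10))))
      (eAnd (.read 6 (litE (.reg 9) (.reg 7))) (eNot (eAnd (eEq (.reg 9) (.const 2))
        (eAnd (.read 6 (litE (.const 0) (.reg 7))) (.read 6 (litE (.const 1) (.reg 7))))))))))

section

variable {n : ℕ} {A : ℕ → ℕ} {s : State}

theorem Base.holds_anyE (h : Base n A s) {K : ℕ} {e : Expr} :
    Holds s (anyE K e) ↔ ∃ c < 3, lits n s K c (e.eval s) := by
  rw [exists_lt_three, anyE, holds_or, holds_or, h.holds_lits (by simp [Expr.eval]),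
    h.holds_lits (by simp [Expr.eval]), h.holds_lits (by simp [Expr.eval])]
  rfl

theorem den_listP (hs : Base n A s) :
    (∀ k, k ≠ 6 → (listP.den s).arr k = s.arr k) ∧ ∀ a < 3, ∀ v < n,
      (lits n (listP.den s) 6 a v ↔
        Listed n A (fun v => s.arr 3 v ≠ 0) (lits n s 4) (lits n s 5) a v) := by
  have key := fill_lits (K := 6) (Z := [9, 6, 7, 12]) (s := s)
    (V := Listed n A (fun v => s.arr 3 v ≠ 0) (lits n s 4) (lits n s 5)) hs (by decide)
    (p := seq
    (checkAll 12 [(7, 1, 0)] (eNot (eAnd (adjE (.reg 6) (.reg 7))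
      (eAnd (anyE 5 (.reg 7)) (eNot (.read 5 (litE (.reg 9) (.reg 7))))))))
    (store 6 (litE (.reg 9) (.reg 6)) (eOr (eNot (.read 3 (.reg 6)))
      (eOr (eAnd (anyE 4 (.reg 6)) (eNot (.read 4 (litE (.reg 9) (.reg 6)))))
        (eAnd (eNot (anyE 4 (.reg 6))) (.reg 12))))))
    ⟨by decide, by simp [litLoops, checkAll, nest, KeepsReg]⟩ (by simp) (by simp) ?_
  · exact ⟨key.1.1, key.2⟩
  intro t a v ha hv ht hoff h9 h6
  have hl : ∀ {t' : State} {K : ℕ}, K ≠ 6 → t'.arr = t.arr → lits n t' K = lits n s K := by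
    intro t' K hK h
    funext a v
    rw [lits, lits, h, hoff.1 K hK]
  obtain ⟨k1, k2, k3⟩ := den_checkAll (n := n) (f := 12) (ys := [(7, 1, 0)])
    (e := eNot (eAnd (adjE (.reg 6) (.reg 7))
      (eAnd (anyE 5 (.reg 7)) (eNot (.read 5 (litE (.reg 9) (.reg 7))))))) (s := t)
    (Q := fun ρ => Edge n A v (ρ 7) → (∃ c < 3, lits n s 5 c (ρ 7)) → lits n s 5 a (ρ 7))
    (by decide) (by decide) (by decide) ht.reg
    (by
      intro ρ ρ' h
      have h7 : ρ 7 = ρ' 7 := h (7, 1, 0) (by simp)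
      simp only [h7])
    (by
      intro t₃ h1 h2 h3
      have r6 : t₃.reg 6 = v := by rw [h2 6 (by decide) (by decide), h6]
      have r9 : t₃.reg 9 = a := by rw [h2 9 (by decide) (by decide), h9]
      have hb₃ : Base n A t₃ := ht.of_eq (h2 0 (by decide) (by decide)) (by rw [h1]) (by rw [h1])
      rw [holds_not, holds_and, holds_and, holds_not,
        hb₃.holds_edge (by simp only [Expr.eval, r6]; omega), hb₃.holds_anyE,
        hb₃.holds_lits (by simpa [Expr.eval, r9]), hl (by decide) h1]
      simp only [Expr.eval, r6, r9]
      rw [not_and, not_and, not_not])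
  rw [den]
  generalize (checkAll 12 [(7, 1, 0)] _).den t = t₃ at k1 k2 k3 ⊢
  have r6 : t₃.reg 6 = v := by rw [k2 6 (by decide) (by decide), h6]
  have r9 : t₃.reg 9 = a := by rw [k2 9 (by decide) (by decide), h9]
  have hb₃ : Base n A t₃ := ht.of_eq (k2 0 (by decide) (by decide)) (by rw [k1]) (by rw [k1])
  have haddr : (litE (.reg 9) (.reg 6)).eval t₃ = a * n + v := by
    rw [hb₃.eval_lit (by simp only [Expr.eval, r9]; omega)]
    simp [Expr.eval, r9, r6]
  refine ⟨⟨fun k hk => by simp [den, hk, k1], fun x hx => ?_⟩, _, by simp [den, haddr, k1]; rfl, ?_⟩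
  · simp only [List.mem_cons, List.not_mem_nil, or_false, not_or] at hx
    exact k2 x hx.2.2.2 (by simpa using hx.2.2.1)
  · change Holds t₃ _ ↔ _
    have h12 : Holds t₃ (.reg 12) ↔
        ∀ u < n, Edge n A v u → (∃ c < 3, lits n s 5 c u) → lits n s 5 a u := by
      refine k3.trans ⟨fun h u hu => h (fun _ => u) (by simpa [Valid]), fun h ρ hρ => h _ ?_⟩
      simpa [Valid] using hρ
    have h3 : Holds t₃ (.read 3 (.reg 6)) ↔ s.arr 3 v ≠ 0 := by
      rw [Holds, Expr.eval, Expr.eval, r6, k1, hoff.1 3 (by decide)]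
    rw [holds_or, holds_or, holds_and, holds_and, holds_not, holds_not, holds_not, h12, h3,
      hb₃.holds_anyE, hb₃.holds_lits (by simpa [Expr.eval, r9]), hl (by decide) k1]
    simp only [Expr.eval, r6, r9]
    rfl

theorem den_relP (hs : Base n A s) :
    ∀ a < 3, ∀ u < n, ∀ b < 3, ∀ w < n, (rel n (relP.den s) a u b w ↔
      Con n A (fun v => s.arr 3 v ≠ 0) (lits n s 6) a u b w) := by
  refine fill_rel hs fun t a u b w ha hu hb hw ht harr _ h9 h7 h10 h8 _ => ?_
  have hl : lits n t 6 = lits n s 6 := by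
    funext a v
    rw [lits, lits, harr 6 (by decide)]
  have h3 : Holds t (.read 3 (.reg 7)) ↔ s.arr 3 u ≠ 0 := by
    rw [Holds, Expr.eval, Expr.eval, h7, harr 3 (by decide)]
  simp only [holds_and, holds_or, holds_not, holds_eq]
  rw [h3, ht.holds_edge (by simp only [Expr.eval, h7]; omega),
    ht.holds_lits (by simpa [Expr.eval, h9]), ht.holds_lits (by simp [Expr.eval]),
    ht.holds_lits (by simp [Expr.eval]), hl]
  simp only [Expr.eval, h7, h8, h9, h10, Con]
  tauto

/-- The colouring `o` is a proper colouring of `M` with three colours. -/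
def Good (n : ℕ) (A : ℕ → ℕ) (M : ℕ → Prop) (o : ℕ → ℕ) : Prop :=
  ∀ u < n, M u → o u < 3 ∧ ∀ w < n, Edge n A u w → o u ≠ o w

/-- Check the colouring in array `8`, and copy it to array `1` if it is proper; register `2` keeps
track of success. -/
def copyP : LProg :=
  seq (checkAll 3 [(7, 1, 0), (8, 1, 0)] (eNot (eAnd (.read 3 (.reg 7))
      (eAnd (adjE (.reg 7) (.reg 8)) (eEq (.read 8 (.reg 7)) (.read 8 (.reg 8)))))))
    (ite (.reg 3) (seq (assign 2 (.const 1))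
      (nest [(6, 1, 0)] (ite (.read 3 (.reg 6)) (store 1 (.reg 6) (.read 8 (.reg 6))) skip))) skip)

theorem den_copyP (hs : Base n A s) (hcol : ∀ v < n, s.arr 8 v < 3)
    (hclosed : ∀ u < n, ∀ w < n, s.arr 3 u ≠ 0 → Edge n A u w → s.arr 3 w ≠ 0) :
    (∀ v, s.arr 3 v = 0 → (copyP.den s).arr 1 v = s.arr 1 v) ∧
      (Good n A (fun v => s.arr 3 v ≠ 0) (s.arr 8) → (copyP.den s).reg 2 ≠ 0) ∧
      (((copyP.den s).reg 2 ≠ 0 ∧ Good n A (fun v => s.arr 3 v ≠ 0) ((copyP.den s).arr 1)) ∨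
        (copyP.den s).reg 2 = s.reg 2 ∧ (copyP.den s).arr 1 = s.arr 1) := by
  obtain ⟨k1, k2, k3⟩ := den_checkAll (n := n) (f := 3) (ys := [(7, 1, 0), (8, 1, 0)])
    (e := eNot (eAnd (.read 3 (.reg 7))
      (eAnd (adjE (.reg 7) (.reg 8)) (eEq (.read 8 (.reg 7)) (.read 8 (.reg 8)))))) (s := s)
    (Q := fun ρ => s.arr 3 (ρ 7) ≠ 0 → Edge n A (ρ 7) (ρ 8) → s.arr 8 (ρ 7) ≠ s.arr 8 (ρ 8))
    (by decide) (by decide) (by decide) hs.reg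
    (by
      intro ρ ρ' h
      have h7 : ρ 7 = ρ' 7 := h (7, 1, 0) (by simp)
      have h8 : ρ 8 = ρ' 8 := h (8, 1, 0) (by simp)
      simp only [h7, h8])
    (by
      intro t h1 h2 h3
      have h7 : t.reg 7 < n := by
        have := h3 (7, 1, 0) (by simp)
        simpa using this
      have hb : Base n A t := hs.of_eq (h2 0 (by decide) (by decide)) (by rw [h1]) (by rw [h1])
      rw [holds_not, holds_and, holds_and, holds_eq,
        hb.holds_edge (by simpa [Expr.eval] using h7.le)]
      simp only [Holds, Expr.eval, h1]
      tauto)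
  have hgood : (∀ ρ, Valid n [(7, 1, 0), (8, 1, 0)] ρ →
      s.arr 3 (ρ 7) ≠ 0 → Edge n A (ρ 7) (ρ 8) → s.arr 8 (ρ 7) ≠ s.arr 8 (ρ 8)) ↔
      Good n A (fun v => s.arr 3 v ≠ 0) (s.arr 8) := by
    constructor
    · intro h u hu hM
      refine ⟨hcol u hu, fun w hw hE => ?_⟩
      have := h (fun x => if x = 7 then u else w) (by simp [Valid, hu, hw])
      simp only [if_true, if_neg (by decide : (8 : ℕ) ≠ 7)] at this
      exact this hM hE
    · intro h ρ hρ hM hE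
      simp only [Valid, List.mem_cons, List.not_mem_nil, or_false, forall_eq_or_imp, forall_eq,
        one_mul, add_zero] at hρ
      exact (h _ hρ.1 hM).2 _ hρ.2 hE
  rw [hgood] at k3
  rw [copyP, den]
  generalize (checkAll 3 [(7, 1, 0), (8, 1, 0)] _).den s = t at k1 k2 k3 ⊢
  simp only [den]
  by_cases h3 : t.reg 3 = 0
  · rw [if_neg (by simpa [Expr.eval] using h3), k1]
    exact ⟨fun _ _ => rfl, fun h => (k3.2 h h3).elim,
      Or.inr ⟨k2 2 (by decide) (by decide), rfl⟩⟩
  · rw [if_pos (by simpa [Expr.eval] using h3)]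
    obtain ⟨t', ht', he⟩ := rep_induct (x := 6) (m := 1) (c := 0)
      (p := ite (.read 3 (.reg 6)) (store 1 (.reg 6) (.read 8 (.reg 6))) skip)
      (fun i t' => t'.reg 2 = 1 ∧ (∀ k, k ≠ 1 → t'.arr k = s.arr k) ∧
        ∀ v, t'.arr 1 v = if v < i ∧ s.arr 3 v ≠ 0 then s.arr 8 v else s.arr 1 v)
      (s := t.setReg 2 1) ⟨by simp, fun k _ => by simp [k1], fun v => by simp [k1]⟩ (by
        intro i _ t' ⟨p1, p2, p3⟩
        simp only [den, Expr.eval, arr_setReg, reg_setReg, if_true, p2 3 (by decide),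
          p2 8 (by decide)]
        by_cases hi : s.arr 3 i = 0
        · rw [if_neg (by simpa using hi)]
          refine ⟨by simp [p1], p2, fun v => ?_⟩
          rw [arr_setReg, p3]
          by_cases hv : v = i
          · subst hv; simp [hi]
          · have : v < i + 1 ↔ v < i := by omega
            simp only [this]
        · rw [if_pos hi]
          refine ⟨by simp [p1], fun k hk => by simp [hk, p2 k hk], fun v => ?_⟩
          rw [arr_setArr, if_pos rfl, arr_setReg]
          by_cases hv : v = i
          · subst hv; simp [hi]
          · rw [Function.update_of_ne hv, p3]
            have : v < i + 1 ↔ v < i := by omega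
            simp only [this])
    have hr0 : (t.setReg 2 1).reg 0 = n := by
      rw [reg_setReg, if_neg (by decide), k2 0 (by decide) (by decide), hs.reg]
    rw [hr0, one_mul, add_zero] at ht'
    obtain ⟨p1, -, p3⟩ := ht'
    have hd : (nest [(6, 1, 0)] (ite (.read 3 (.reg 6)) (store 1 (.reg 6) (.read 8 (.reg 6)))
        skip)).den (t.setReg 2 ((Expr.const 1).eval t)) =
        t'.setReg 6 (1 * (t.setReg 2 1).reg 0 + 0) :=
      he
    rw [hd]
    simp only [arr_setReg, reg_setReg, if_neg (by decide : (2 : ℕ) ≠ 6), p1]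
    refine ⟨fun v hv => by rw [p3, if_neg (by simp [hv])], fun _ => one_ne_zero,
      Or.inl ⟨one_ne_zero, fun u hu hM => ?_⟩⟩
    have hG := k3.1 h3 u hu hM
    rw [p3 u, if_pos ⟨hu, hM⟩]
    refine ⟨hG.1, fun w hw hE => ?_⟩
    rw [p3 w, if_pos ⟨hw, hclosed u hu w hw hM hE⟩]
    exact hG.2 w hw hE

end

/-- The search for a colouring of the component in array `3` that respects the current guess. -/
def leafP : LProg := seq seesP (seq listP (seq relP (seq elimP (seq solveP copyP))))

theorem leafP_keepsReg {x : ℕ} (hx : x = 0 ∨ x = 1 ∨ x = 4 ∨ 13 ≤ x) : leafP.KeepsReg x := by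
  simp only [leafP, seesP, listP, relP, elimP, elimStep, solveP, tryColour, copyP, checkAll, nest,
    litLoops, pairLoops, KeepsReg]
  simp only [and_true, true_and]
  omega

theorem leafP_keepsArr {k : ℕ} (hk : k = 0 ∨ k = 2 ∨ k = 3) : leafP.KeepsArr k := by
  simp only [leafP, seesP, listP, relP, elimP, elimStep, solveP, tryColour, copyP, checkAll, nest,
    litLoops, pairLoops, KeepsArr]
  simp only [and_true, true_and]
  omega

theorem leafP_wf : leafP.WF := by
  simp [leafP, seesP, listP, relP, elimP, elimStep, solveP, tryColour, copyP, checkAll, nest,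
    litLoops, pairLoops, KeepsReg, WF]

/-- The constraints that the guess `ρ` imposes on colourings of `M`. -/
def GuessCon (n : ℕ) (A : ℕ → ℕ) (M : ℕ → Prop) (ρ : ℕ → ℕ) : Rel :=
  Con n A M (Listed n A M (Sees n A ρ 93) (Sees n A ρ 9))

theorem listed_congr {n : ℕ} {A : ℕ → ℕ} {M : ℕ → Prop} {S S₁ S' S₁' : ℕ → ℕ → Prop}
    (h : ∀ a < 3, ∀ v < n, S a v ↔ S' a v) (h₁ : ∀ a < 3, ∀ v < n, S₁ a v ↔ S₁' a v) {a v : ℕ}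
    (ha : a < 3) (hv : v < n) : Listed n A M S S₁ a v ↔ Listed n A M S' S₁' a v := by
  have e : (∃ c < 3, S c v) ↔ ∃ c < 3, S' c v :=
    exists_congr fun c => and_congr_right fun hc => h c hc v hv
  have e₁ : ∀ u < n, ((∃ c < 3, S₁ c u) ↔ ∃ c < 3, S₁' c u) := fun u hu =>
    exists_congr fun c => and_congr_right fun hc => h₁ c hc u hu
  unfold Listed
  rw [e, h a ha v hv]
  refine or_congr Iff.rfl (or_congr Iff.rfl (and_congr_right fun _ => ?_))
  refine forall₂_congr fun u hu => ?_
  rw [e₁ u hu, h₁ a ha u hu]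

theorem con_congr {n : ℕ} {A : ℕ → ℕ} {M : ℕ → Prop} {L L' : ℕ → ℕ → Prop}
    (h : ∀ a < 3, ∀ v < n, L a v ↔ L' a v) {a u b w : ℕ} (ha : a < 3) (hu : u < n) :
    Con n A M L a u b w ↔ Con n A M L' a u b w := by
  unfold Con
  rw [h a ha u hu, h 0 (by omega) u hu, h 1 (by omega) u hu]

theorem sol_congr {n : ℕ} {R R' : Rel} {f : ℕ → ℕ}
    (h : ∀ a < 3, ∀ u < n, ∀ b < 3, ∀ w < n, R a u b w ↔ R' a u b w) : Sol n R f ↔ Sol n R' f :=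
  and_congr_right fun hf => forall₂_congr fun u hu => forall₂_congr fun w hw =>
    h _ (hf u hu) u hu _ (hf w hw) w hw

theorem den_leafP {n : ℕ} {A : ℕ → ℕ} {s : State} (hs : Base n A s)
    (hsymm : ∀ u < n, ∀ w < n, Edge n A u w → Edge n A w u) (hg : Guess n s.reg)
    (hclosed : ∀ u < n, ∀ w < n, s.arr 3 u ≠ 0 → Edge n A u w → s.arr 3 w ≠ 0) :
    (∀ v, s.arr 3 v = 0 → (leafP.den s).arr 1 v = s.arr 1 v) ∧
      ((∃ f, Sol n (GuessCon n A (fun v => s.arr 3 v ≠ 0) s.reg) f) →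
        (leafP.den s).reg 2 ≠ 0) ∧
      (((leafP.den s).reg 2 ≠ 0 ∧ Good n A (fun v => s.arr 3 v ≠ 0) ((leafP.den s).arr 1)) ∨
        (leafP.den s).reg 2 = s.reg 2 ∧ (leafP.den s).arr 1 = s.arr 1) := by
  simp only [leafP, den]
  -- what the parts before `copyP` preserve
  have pres : ∀ {p : LProg} {t : State}, Base n A t ∧ t.arr 3 = s.arr 3 ∧ t.arr 1 = s.arr 1 ∧
      t.reg 2 = s.reg 2 → p.KeepsReg 0 → p.KeepsReg 2 → p.KeepsArr 0 → p.KeepsArr 1 →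
      p.KeepsArr 2 → p.KeepsArr 3 → Base n A (p.den t) ∧ (p.den t).arr 3 = s.arr 3 ∧
      (p.den t).arr 1 = s.arr 1 ∧ (p.den t).reg 2 = s.reg 2 := by
    intro p t h r0 r2 a0 a1 a2 a3
    exact ⟨h.1.den r0 a0 a2, by rw [den_arr a3, h.2.1], by rw [den_arr a1, h.2.2.1],
      by rw [den_reg r2, h.2.2.2]⟩
  have I₁ := pres (p := seesP) ⟨hs, rfl, rfl, rfl⟩ (by simp [seesP, litLoops, nest, KeepsReg])
    (by simp [seesP, litLoops, nest, KeepsReg]) (by simp [seesP, litLoops, nest, KeepsArr])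
    (by simp [seesP, litLoops, nest, KeepsArr]) (by simp [seesP, litLoops, nest, KeepsArr])
    (by simp [seesP, litLoops, nest, KeepsArr])
  obtain ⟨-, l4, l5⟩ := den_seesP hs hg
  generalize seesP.den s = t₁ at I₁ l4 l5 ⊢
  have I₂ := pres (p := listP) I₁ (by simp [listP, checkAll, litLoops, nest, KeepsReg])
    (by simp [listP, checkAll, litLoops, nest, KeepsReg])
    (by simp [listP, checkAll, litLoops, nest, KeepsArr])
    (by simp [listP, checkAll, litLoops, nest, KeepsArr])
    (by simp [listP, checkAll, litLoops, nest, KeepsArr])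
    (by simp [listP, checkAll, litLoops, nest, KeepsArr])
  obtain ⟨-, l6⟩ := den_listP I₁.1
  rw [I₁.2.1] at l6
  generalize listP.den t₁ = t₂ at I₂ l6 ⊢
  have I₃ := pres (p := relP) I₂ (by simp [relP, pairLoops, nest, KeepsReg])
    (by simp [relP, pairLoops, nest, KeepsReg]) (by simp [relP, pairLoops, nest, KeepsArr])
    (by simp [relP, pairLoops, nest, KeepsArr]) (by simp [relP, pairLoops, nest, KeepsArr])
    (by simp [relP, pairLoops, nest, KeepsArr])
  have l7 := den_relP I₂.1
  rw [I₂.2.1] at l7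
  generalize relP.den t₂ = t₃ at I₃ l7 ⊢
  have I₄ := pres (p := elimP) I₃ (by simp [elimP, elimStep, pairLoops, nest, KeepsReg])
    (by simp [elimP, elimStep, pairLoops, nest, KeepsReg])
    (by simp [elimP, elimStep, pairLoops, nest, KeepsArr])
    (by simp [elimP, elimStep, pairLoops, nest, KeepsArr])
    (by simp [elimP, elimStep, pairLoops, nest, KeepsArr])
    (by simp [elimP, elimStep, pairLoops, nest, KeepsArr])
  have hE := den_elimP I₃.1 (by
    intro a ha u hu b hb w hw h
    rw [l7 a ha u hu b hb w hw] at h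
    rw [l7 b hb w hw a ha u hu]
    refine ⟨fun ⟨h1, h2, h3⟩ => h.1 ⟨?_, h2.symm, hsymm w hw u hu h3⟩, ?_⟩
    · exact hclosed w hw u hu h1 h3
    · rintro rfl rfl
      exact h.2 rfl rfl)
  generalize elimP.den t₃ = t₄ at I₄ hE ⊢
  have I₅ := pres (p := solveP) I₄ (by simp [solveP, tryColour, checkAll, nest, KeepsReg])
    (by simp [solveP, tryColour, checkAll, nest, KeepsReg])
    (by simp [solveP, tryColour, checkAll, nest, KeepsArr])
    (by simp [solveP, tryColour, checkAll, nest, KeepsArr])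
    (by simp [solveP, tryColour, checkAll, nest, KeepsArr])
    (by simp [solveP, tryColour, checkAll, nest, KeepsArr])
  obtain ⟨hcol, hfit⟩ := den_solveP I₄.1
  generalize solveP.den t₄ = t₅ at I₅ hcol hfit ⊢
  obtain ⟨c1, c2, c3⟩ := den_copyP I₅.1 hcol (by rw [I₅.2.1]; exact hclosed)
  rw [I₅.2.1, I₅.2.2.1] at c1
  rw [I₅.2.1] at c2
  rw [I₅.2.1, I₅.2.2.1, I₅.2.2.2] at c3
  refine ⟨c1, fun ⟨f, hf⟩ => c2 ?_, c3⟩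
  have hf₃ : Sol n (rel n t₃) f := by
    refine (sol_congr fun a ha u hu b hb w hw => ?_).2 hf
    rw [l7 a ha u hu b hb w hw]
    refine con_congr (fun a ha v hv => ?_) ha hu
    rw [l6 a ha v hv]
    exact listed_congr l4 l5 ha hv
  have hsol := hE.sol_of_fits (fun v hv hall => ?_) ⟨f, hf₃⟩ hcol hfit
  · intro u hu hM
    refine ⟨hcol u hu, fun w hw hEd heq => ?_⟩
    have := (l7 _ (hcol u hu) u hu _ (hcol w hw) w hw).1 (hsol.2 u hu w hw)
    exact this.1 ⟨hM, heq, hEd⟩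
  · have h0 := ((l7 0 (by omega) v hv 0 (by omega) v hv).1 (hall 0 (by omega))).2 rfl rfl
    have h1 := ((l7 1 (by omega) v hv 1 (by omega) v hv).1 (hall 1 (by omega))).2 rfl rfl
    have h2 := ((l7 2 (by omega) v hv 2 (by omega) v hv).1 (hall 2 (by omega))).2 rfl rfl
    exact h2.2 ⟨rfl, h0.1, h1.1⟩

end LoopProg

/-! ### The algorithm -/

namespace LoopProg

open RAM LProg

theorem den_seq (p q : LProg) (s : State) : (seq p q).den s = q.den (p.den s) := rfl

/-- Fill the multiplication table in array `2`. -/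
def setupP : LProg :=
  rep 6 9 9 (store 2 (.add (.reg 6) (.const 1)) (.add (.read 2 (.reg 6)) (.reg 0)))

/-- Mark in array `3` the connected component of the vertex in register `4`. -/
def maskP : LProg :=
  seq (nest [(6, 1, 0)] (store 3 (.reg 6) (.const 0))) (seq (store 3 (.reg 4) (.const 1))
    (rep 5 1 0 (nest [(7, 1, 0), (6, 1, 0)]
      (ite (eAnd (.read 3 (.reg 7)) (adjE (.reg 7) (.reg 6)))
        (store 3 (.reg 6) (.const 1)) skip))))

/-- The loops over all guesses. -/
def guessLoops : List (ℕ × ℕ × ℕ) :=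
  (List.range 93).map (fun j => (20 + j, 1, 1)) ++ (List.range 93).map (fun j => (120 + j, 0, 3))

/-- Colour the component of the vertex in register `4`; register `1` keeps track of failure. -/
def roundP : LProg :=
  seq (assign 2 (.const 0)) (seq maskP (seq (nest guessLoops leafP)
    (ite (.reg 2) skip (assign 1 (.const 1)))))

/-- The algorithm, up to the output of the answer. -/
def mainP : LProg := seq setupP (rep 4 1 0 roundP)

/-- `A` is the adjacency matrix of `G`, with an additional row of zeros. -/
def IsMatrix {n : ℕ} (G : SimpleGraph (Fin n)) (A : ℕ → ℕ) : Prop :=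
  (∀ u v : Fin n, Edge n A u v ↔ G.Adj u v) ∧ ∀ v < n, ¬Edge n A n v

theorem isMatrix_graphInput {n : ℕ} (G : SimpleGraph (Fin n)) :
    IsMatrix G ((graphInput G).arr 0) := by
  refine ⟨fun u v => ?_, fun v hv => ?_⟩
  · simp only [Edge, graphInput, true_and, ne_eq, ite_eq_right_iff, one_ne_zero, imp_false,
      not_not]
    refine ⟨fun ⟨u', v', h, he⟩ => ?_, fun h => ⟨u, v, h, rfl⟩⟩
    obtain ⟨h1, h2⟩ := lit_inj v.2 v'.2 he
    rwa [Fin.ext h1, Fin.ext h2]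
  · simp only [Edge, graphInput, true_and, ne_eq, ite_eq_right_iff, one_ne_zero, imp_false,
      not_not]
    rintro ⟨u', v', -, he⟩
    exact u'.2.ne (lit_inj hv v'.2 he).1.symm

theorem den_setupP {n : ℕ} (G : SimpleGraph (Fin n)) :
    Base n ((graphInput G).arr 0) (setupP.den (graphInput G)) := by
  obtain ⟨t, ⟨h0, hA, hmul⟩, he⟩ := rep_induct (x := 6) (m := 9) (c := 9)
    (p := store 2 (.add (.reg 6) (.const 1)) (.add (.read 2 (.reg 6)) (.reg 0)))
    (fun i t => t.reg 0 = n ∧ t.arr 0 = (graphInput G).arr 0 ∧ ∀ k ≤ i, t.arr 2 k = k * n)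
    (s := graphInput G)
    ⟨rfl, rfl, fun k hk => by obtain rfl : k = 0 := by omega
                              simp [graphInput]⟩ (by
      intro i _ t ⟨h0, hA, hm⟩
      refine ⟨by simp [den, h0], by simp [den, hA], fun k hk => ?_⟩
      simp only [den, Expr.eval, arr_setArr, if_true, arr_setReg, reg_setReg,
        if_neg (by decide : (0 : ℕ) ≠ 6), h0]
      by_cases hki : k = i + 1
      · subst hki
        rw [Function.update_self, hm i le_rfl]; ring
      · rw [Function.update_of_ne hki]
        exact hm k (by omega))
  have hn : (graphInput G).reg 0 = n := rfl
  rw [hn] at hmul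
  rw [setupP, he]
  exact ⟨by simp [h0], hA, fun k hk => hmul k hk.le⟩

section

variable {n : ℕ} {A : ℕ → ℕ} {s : State} {G : SimpleGraph (Fin n)}

theorem den_maskP (hs : Base n A s) (hA : IsMatrix G A) {r : Fin n} (hr : s.reg 4 = r) (v : Fin n) :
    (maskP.den s).arr 3 v ≠ 0 ↔ G.Reachable r v := by
  obtain ⟨⟨a1, a2⟩, a3, -⟩ := den_fill_store (n := n) (A := 3) (ys := [(6, 1, 0)]) (i := .reg 6)
    (e := .const 0) (s := s) (I := fun ρ => ρ 6) (V := fun _ => False) (by decide) hs.reg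
    (by decide) (fun ρ ρ' h => ⟨h (6, 1, 0) (by simp), Iff.rfl⟩) (fun _ _ _ _ _ => Iff.rfl)
    (fun t _ _ _ => ⟨rfl, by simp [Holds, Expr.eval]⟩)
  have a3 : ∀ v < n, ((nest [(6, 1, 0)] (store 3 (.reg 6) (.const 0))).den s).arr 3 v = 0 := by
    intro v hv
    simpa using a3 (fun _ => v) (by simpa [Valid])
  rw [maskP, den]
  generalize (nest [(6, 1, 0)] (store 3 (.reg 6) (.const 0))).den s = t at a1 a2 a3 ⊢
  have ht4 : t.reg 4 = r := by rw [a2 4 (by simp), hr]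
  have hd : (store 3 (.reg 4) (.const 1)).den t = t.setArr 3 r 1 := by
    simp [den, Expr.eval, ht4]
  rw [den, hd]
  have hb : Base n A (t.setArr 3 r 1) :=
    hs.of_eq (a2 0 (by simp)) (by simp [a1]) (by simp [a1])
  have hl : Loops [(7, 1, 0), (6, 1, 0)] (ite (eAnd (.read 3 (.reg 7)) (adjE (.reg 7) (.reg 6)))
      (store 3 (.reg 6) (.const 1)) skip) := ⟨by decide, by simp [KeepsReg]⟩
  -- after `i` rounds, the ends of all walks of length at most `i` are marked
  let P : ℕ → State → Prop := fun i t => Base n A t ∧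
    (∀ v : Fin n, t.arr 3 v ≠ 0 → G.Reachable r v) ∧
    ∀ v : Fin n, (∃ p : G.Walk r v, p.length ≤ i) → t.arr 3 v ≠ 0
  have base : P 0 (t.setArr 3 r 1) := by
    refine ⟨hb, fun v hv => ?_, ?_⟩
    · by_cases h : v = r
      · rw [h]
      · rw [arr_setArr, if_pos rfl, Function.update_of_ne (fun h' => h (Fin.ext h'))] at hv
        exact (hv (a3 v v.2)).elim
    · rintro v ⟨p, hp⟩
      obtain rfl := SimpleGraph.Walk.eq_of_length_eq_zero (Nat.le_zero.1 hp)
      simp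
  have round : ∀ i t, P i t → P (i + 1) ((nest [(7, 1, 0), (6, 1, 0)]
      (ite (eAnd (.read 3 (.reg 7)) (adjE (.reg 7) (.reg 6)))
        (store 3 (.reg 6) (.const 1)) skip)).den (t.setReg 5 i)) := by
    intro i t ⟨hb, hsound, hcompl⟩
    let Inv : State → Prop := fun t' => Base n A t' ∧
      (∀ v : Fin n, t'.arr 3 v ≠ 0 → G.Reachable r v) ∧ ∀ v, t.arr 3 v ≠ 0 → t'.arr 3 v ≠ 0
    have inv0 : ∀ t', Inv t' → t'.reg 0 = n := fun t' h => h.1.reg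
    have hreg : ∀ t', ∀ y ∈ [(7, 1, 0), (6, 1, 0)], ∀ i, Inv t' → Inv (t'.setReg y.1 i) := by
      intro t' y hy i h
      refine ⟨h.1.of_eq ?_ rfl rfl, h.2⟩
      rw [reg_setReg, if_neg (hl.2 y hy).1.symm]
    -- the effect of the innermost program
    have eff : ∀ t', Inv t' → Valid n [(7, 1, 0), (6, 1, 0)] t'.reg → ∃ u v : Fin n,
        t'.reg 7 = u ∧ t'.reg 6 = v ∧
        (t'.arr 3 u ≠ 0 → G.Adj u v → (ite (eAnd (.read 3 (.reg 7)) (adjE (.reg 7) (.reg 6)))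
          (store 3 (.reg 6) (.const 1)) skip).den t' = t'.setArr 3 v 1) ∧
        (¬(t'.arr 3 u ≠ 0 ∧ G.Adj u v) → (ite (eAnd (.read 3 (.reg 7)) (adjE (.reg 7) (.reg 6)))
          (store 3 (.reg 6) (.const 1)) skip).den t' = t') := by
      intro t' h hv
      have h7 : t'.reg 7 < n := by simpa using hv (7, 1, 0) (by simp)
      have h6 : t'.reg 6 < n := by simpa using hv (6, 1, 0) (by simp)
      have htest : Holds t' (eAnd (.read 3 (.reg 7)) (adjE (.reg 7) (.reg 6))) ↔
          t'.arr 3 (t'.reg 7) ≠ 0 ∧ G.Adj ⟨_, h7⟩ ⟨_, h6⟩ := by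
        rw [holds_and, h.1.holds_edge (by simpa [Expr.eval] using h7.le), ← hA.1]
        rfl
      refine ⟨⟨_, h7⟩, ⟨_, h6⟩, rfl, rfl, fun h1 h2 => ?_, fun h1 => ?_⟩
      · have : (eAnd (.read 3 (.reg 7)) (adjE (.reg 7) (.reg 6))).eval t' ≠ 0 := htest.2 ⟨h1, h2⟩
        rw [den, if_pos this]
        rfl
      · have : ¬(eAnd (.read 3 (.reg 7)) (adjE (.reg 7) (.reg 6))).eval t' ≠ 0 := mt htest.1 h1
        rw [den, if_neg this]
        rfl
    have step : ∀ t', Inv t' → Valid n [(7, 1, 0), (6, 1, 0)] t'.reg →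
        Inv ((ite (eAnd (.read 3 (.reg 7)) (adjE (.reg 7) (.reg 6)))
          (store 3 (.reg 6) (.const 1)) skip).den t') := by
      intro t' h hv
      obtain ⟨u, v, -, -, e1, e2⟩ := eff t' h hv
      by_cases hc : t'.arr 3 u ≠ 0 ∧ G.Adj u v
      · rw [e1 hc.1 hc.2]
        refine ⟨h.1.of_eq rfl (by simp) (by simp), fun x hx => ?_, fun x hx => ?_⟩
        · by_cases hxv : x = v
          · rw [hxv]
            exact (h.2.1 u hc.1).trans hc.2.reachable
          · rw [arr_setArr, if_pos rfl, Function.update_of_ne (fun h' => hxv (Fin.ext h'))] at hx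
            exact h.2.1 x hx
        · rw [arr_setArr, if_pos rfl]
          by_cases hxv : x = v
          · rw [hxv, Function.update_self]; exact one_ne_zero
          · rw [Function.update_of_ne hxv]; exact h.2.2 x hx
      · rw [e2 hc]
        exact h
    have start : Inv (t.setReg 5 i) := ⟨hb.of_eq (by simp) rfl rfl, hsound, fun _ h => h⟩
    have hfin := nest_inv hl inv0 hreg step _ start
    refine ⟨hfin.1, hfin.2.1, ?_⟩
    rintro v ⟨p, hp⟩
    rcases Nat.lt_or_ge p.length (i + 1) with hlt | hge
    · exact hfin.2.2 v (hcompl v ⟨p, by omega⟩)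
    · obtain ⟨u, q, huv, hq⟩ : ∃ (u : Fin n) (q : G.Walk r u), G.Adj u v ∧ q.length ≤ i := by
        have hnil : ¬p.Nil := fun h => by
          have := SimpleGraph.Walk.length_eq_zero_iff.2 h
          omega
        exact ⟨p.penultimate, p.dropLast, p.adj_penultimate hnil, by
          have := SimpleGraph.Walk.length_dropLast_add_one hnil
          omega⟩
      have hu := hcompl u ⟨q, hq⟩
      refine nest_done hl (ρ := fun x => if x = 7 then u else v) (by simp [Valid])
        (D := fun t' => t'.arr 3 v ≠ 0) inv0 hreg (fun t' y _ i h => h) step ?_ ?_ _ start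
      · intro t' h he
        have h7 := he (7, 1, 0) (by simp)
        have h6 := he (6, 1, 0) (by simp)
        simp only [if_true, if_neg (by decide : (6 : ℕ) ≠ 7)] at h7 h6
        obtain ⟨u', v', k7, k6, e1, -⟩ := eff t' h (by simp [Valid, h7, h6])
        obtain rfl : u' = u := Fin.ext (k7.symm.trans h7)
        obtain rfl : v' = v := Fin.ext (k6.symm.trans h6)
        rw [e1 (h.2.2 _ hu) huv]
        simp
      · intro t' h hd hv
        obtain ⟨u', v', -, -, e1, e2⟩ := eff t' h hv
        by_cases hc : t'.arr 3 u' ≠ 0 ∧ G.Adj u' v'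
        · rw [e1 hc.1 hc.2, arr_setArr, if_pos rfl, Function.update_apply]
          split_ifs
          · exact one_ne_zero
          · exact hd
        · rwa [e2 hc]
  obtain ⟨t', ⟨-, hsound, hcompl⟩, he⟩ := rep_induct (x := 5) (m := 1) (c := 0) P base
    fun i _ t => round i t
  rw [he]
  refine ⟨fun h => hsound v h, fun h => hcompl v ?_⟩
  obtain ⟨p⟩ := h
  classical
  refine ⟨p.toPath, ?_⟩
  have := p.toPath.2.length_lt
  rw [Fintype.card_fin] at this
  rw [hb.reg]
  omega

theorem valid_guessLoops {ρ : ℕ → ℕ} : Valid n guessLoops ρ ↔ Guess n ρ := by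
  simp only [Valid, guessLoops, List.mem_append, List.mem_map, List.mem_range, Guess]
  constructor
  · intro h j hj
    have h1 := h _ (Or.inl ⟨j, hj, rfl⟩)
    have h2 := h _ (Or.inr ⟨j, hj, rfl⟩)
    simp only at h1 h2
    omega
  · rintro h y (⟨j, hj, rfl⟩ | ⟨j, hj, rfl⟩)
    · have := (h j hj).1
      simp only
      omega
    · have := (h j hj).2
      simp only
      omega

theorem mem_guessLoops {y : ℕ × ℕ × ℕ} (hy : y ∈ guessLoops) : 13 ≤ y.1 := by
  simp only [guessLoops, List.mem_append, List.mem_map, List.mem_range] at hy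
  rcases hy with ⟨j, hj, rfl⟩ | ⟨j, hj, rfl⟩ <;> simp only <;> omega

theorem loops_guessLoops : Loops guessLoops leafP := by
  refine ⟨?_, fun y hy => ?_⟩
  · simp only [guessLoops, List.map_append, List.map_map]
    rw [List.nodup_append']
    refine ⟨List.nodup_range.map fun a b h => ?_, List.nodup_range.map fun a b h => ?_, ?_⟩
    · simpa using h
    · simpa using h
    · intro x h1 h2
      simp only [List.mem_map, List.mem_range, Function.comp] at h1 h2
      obtain ⟨a, ha, rfl⟩ := h1
      obtain ⟨b, hb, h⟩ := h2
      omega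
  · have := mem_guessLoops hy
    exact ⟨by omega, leafP_keepsReg (by omega)⟩

/-- Two sets of at most nine and at most 84 vertices fit into the slots of a guess. -/
theorem exists_slots {V : Type*} {W₁ W₂ : Finset V} (h₁ : W₁.card ≤ 9) (h₂ : W₂.card ≤ 84) :
    ∃ slot : ℕ → Option V, (∀ w, w ∈ W₁ ↔ ∃ j < 9, slot j = some w) ∧
      ∀ w, w ∈ W₁ ∨ w ∈ W₂ ↔ ∃ j < 93, slot j = some w := by
  have key : ∀ (W : Finset V) (w : V), w ∈ W ↔ ∃ j < W.card, W.toList[j]? = some w := by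
    intro W w
    rw [← Finset.mem_toList, List.mem_iff_getElem?]
    refine exists_congr fun j => ⟨fun h => ⟨?_, h⟩, fun h => h.2⟩
    have := (List.getElem?_eq_some_iff.1 h).1
    rwa [Finset.length_toList] at this
  have small : ∀ {W : Finset V} {w : V} {j : ℕ}, W.toList[j]? = some w → w ∈ W := fun h =>
    Finset.mem_toList.1 (List.mem_of_getElem? h)
  refine ⟨fun j => if j < 9 then W₁.toList[j]? else W₂.toList[j - 9]?, fun w => ?_, fun w => ?_⟩
  · constructor
    · intro h
      obtain ⟨j, hj, e⟩ := (key W₁ w).1 h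
      exact ⟨j, by omega, by beta_reduce; rw [if_pos (by omega), e]⟩
    · rintro ⟨j, hj, e⟩
      beta_reduce at e
      rw [if_pos hj] at e
      exact small e
  · constructor
    · rintro (h | h)
      · obtain ⟨j, hj, e⟩ := (key W₁ w).1 h
        exact ⟨j, by omega, by beta_reduce; rw [if_pos (by omega), e]⟩
      · obtain ⟨j, hj, e⟩ := (key W₂ w).1 h
        exact ⟨9 + j, by omega, by beta_reduce; rw [if_neg (by omega), Nat.add_sub_cancel_left, e]⟩
    · rintro ⟨j, hj, e⟩
      beta_reduce at e
      split_ifs at e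
      · exact Or.inl (small e)
      · exact Or.inr (small e)

/-- A colouring that respects a coloured set of vertices, as in `ShortOdd.exists_respects`,
satisfies the constraints of the corresponding guess. -/
theorem exists_guess (hA : IsMatrix G A) {r : Fin n} {f g : Fin n → Fin 3} {W₁ W₂ : Finset (Fin n)}
    (hf : ∀ u v, G.Adj u v → f u ≠ f v) (h₁ : W₁.card ≤ 9) (h₂ : W₂.card ≤ 84)
    (hg : ∀ v, G.Reachable r v → ShortOdd.Respects G f W₁ W₂ g v) {M : ℕ → Prop}
    (hM : ∀ v : Fin n, M v ↔ G.Reachable r v) :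
    ∃ ρ, Guess n ρ ∧ ∃ F, Sol n (GuessCon n A M ρ) F := by
  obtain ⟨slot, s1, s2⟩ := exists_slots h₁ h₂
  let ρ : ℕ → ℕ := fun x => if x < 120 then (slot (x - 20)).elim n Fin.val
    else (slot (x - 120)).elim 0 fun w => (f w).val
  have ρ1 : ∀ j < 93, ρ (20 + j) = (slot j).elim n Fin.val := fun j hj => by
    simp only [ρ]
    rw [if_pos (by omega), Nat.add_sub_cancel_left]
  have ρ2 : ∀ j, ρ (120 + j) = (slot j).elim 0 fun w => (f w).val := fun j => by
    simp only [ρ]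
    rw [if_neg (by omega), Nat.add_sub_cancel_left]
  have hsees : ∀ k ≤ 93, ∀ (a : ℕ) (v : Fin n), Sees n A ρ k a v ↔
      ∃ w, (∃ j < k, slot j = some w) ∧ (f w).val = a ∧ G.Adj w v := by
    intro k hk a v
    constructor
    · rintro ⟨j, hj, e1, e2⟩
      rw [ρ1 j (by omega)] at e2
      rw [ρ2] at e1
      cases hsl : slot j with
      | none =>
        rw [hsl] at e2
        exact (hA.2 v v.2 e2).elim
      | some w =>
        rw [hsl] at e1 e2
        exact ⟨w, ⟨j, hj, hsl⟩, e1, (hA.1 w v).1 e2⟩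
    · rintro ⟨w, ⟨j, hj, e⟩, e1, e2⟩
      refine ⟨j, hj, ?_, ?_⟩
      · rw [ρ2, e]; exact e1
      · rw [ρ1 j (by omega), e]; exact (hA.1 w v).2 e2
  have see₁ : ∀ (a : ℕ) (v : Fin n), Sees n A ρ 9 a v ↔
      ∃ w, w ∈ W₁ ∧ (f w).val = a ∧ G.Adj w v := fun a v => by
    rw [hsees 9 (by omega)]
    simp only [← s1]
  have see : ∀ (a : ℕ) (v : Fin n), Sees n A ρ 93 a v ↔
      ∃ w, (w ∈ W₁ ∨ w ∈ W₂) ∧ (f w).val = a ∧ G.Adj w v := fun a v => by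
    rw [hsees 93 le_rfl]
    simp only [← s2]
  have any₁ : ∀ v : Fin n, (∃ c < 3, Sees n A ρ 9 c v) ↔ ∃ w, w ∈ W₁ ∧ G.Adj w v := by
    intro v
    simp only [see₁]
    exact ⟨fun ⟨_, _, w, h1, _, h2⟩ => ⟨w, h1, h2⟩, fun ⟨w, h1, h2⟩ => ⟨_, (f w).2, w, h1, rfl, h2⟩⟩
  have any : ∀ v : Fin n, (∃ c < 3, Sees n A ρ 93 c v) ↔ ∃ w, (w ∈ W₁ ∨ w ∈ W₂) ∧ G.Adj w v := by
    intro v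
    simp only [see]
    exact ⟨fun ⟨_, _, w, h1, _, h2⟩ => ⟨w, h1, h2⟩, fun ⟨w, h1, h2⟩ => ⟨_, (f w).2, w, h1, rfl, h2⟩⟩
  refine ⟨ρ, fun j hj => ?_, ?_⟩
  · rw [ρ1 j hj, ρ2]
    cases slot j with
    | none => exact ⟨le_rfl, by simp⟩
    | some w => exact ⟨w.2.le, (f w).2⟩
  classical
  let F : ℕ → ℕ := fun v => if h : ∃ hv : v < n, G.Reachable r ⟨v, hv⟩ then (g ⟨v, h.1⟩).val else 0
  have F1 : ∀ v : Fin n, G.Reachable r v → F v = g v := fun v h => by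
    simp only [F]
    rw [dif_pos ⟨v.2, h⟩]
  have F2 : ∀ v : Fin n, ¬G.Reachable r v → F v = 0 := fun v h => by
    simp only [F]
    rw [dif_neg fun h' => h h'.2]
  refine ⟨F, fun v hv => ?_, fun u hu w hw => ⟨?_, ?_⟩⟩
  · by_cases h : G.Reachable r ⟨v, hv⟩
    · rw [F1 ⟨v, hv⟩ h]; exact (g _).2
    · rw [F2 ⟨v, hv⟩ h]; decide
  · rintro ⟨hMu, heq, hE⟩
    have hr := (hM ⟨u, hu⟩).1 hMu
    have hadj : G.Adj ⟨u, hu⟩ ⟨w, hw⟩ := (hA.1 _ _).1 hE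
    rw [F1 ⟨u, hu⟩ hr, F1 ⟨w, hw⟩ (hr.trans hadj.reachable)] at heq
    exact (hg _ hr).proper _ hadj (Fin.ext heq)
  · rintro rfl -
    obtain ⟨v, rfl⟩ : ∃ v : Fin n, v.val = u := ⟨⟨u, hu⟩, rfl⟩
    by_cases hr : G.Reachable r v
    swap
    · rw [F2 v hr]
      exact ⟨Or.inl (mt (hM v).1 hr), by omega⟩
    have hR := hg v hr
    rw [F1 v hr]
    by_cases hany : ∃ w, (w ∈ W₁ ∨ w ∈ W₂) ∧ G.Adj w v
    · refine ⟨Or.inr (Or.inl ⟨(any v).2 hany, ?_⟩), fun ⟨h2, h0, h1⟩ => ?_⟩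
      · rw [see]
        rintro ⟨w, hw, he, hadj⟩
        exact hR.seen w hw hadj (Fin.ext he)
      · obtain ⟨w, hw, hadj⟩ := hany
        have hne : (f w).val ≠ 2 := fun h => hR.seen w hw hadj (Fin.ext (h.trans h2.symm))
        have hno : ∀ a, Listed n A M (Sees n A ρ 93) (Sees n A ρ 9) a v → (f w).val ≠ a := by
          rintro a (h | h | h) he
          · exact h ((hM v).2 hr)
          · exact h.2 ((see a v).2 ⟨w, hw, he, hadj⟩)
          · exact h.1 ((any v).2 ⟨w, hw, hadj⟩)
        have k0 := hno 0 h0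
        have k1 := hno 1 h1
        have := (f w).2
        omega
    · have hun := hR.unseen fun w hw hadj => hany ⟨w, hw, hadj⟩
      refine ⟨Or.inr (Or.inr ⟨mt (any v).1 hany, fun u hu hE hc => ?_⟩), fun ⟨h2, h0, h1⟩ => ?_⟩
      · obtain ⟨w, h1, h2, h3⟩ := hun ⟨u, hu⟩ ((hA.1 _ _).1 hE) (by
          obtain ⟨w, h1, h2⟩ := (any₁ ⟨u, hu⟩).1 hc
          exact ⟨w, h1, h2⟩)
        exact (see₁ _ ⟨u, hu⟩).2 ⟨w, h1, congrArg Fin.val h3, h2⟩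
      · rcases hR.two (Fin.ext h2) with h | ⟨u, hvu, w, hw, hwu⟩
        · exact hany h
        -- the neighbour `u` of `v` would see all three colours
        have hall : ∀ a, Listed n A M (Sees n A ρ 93) (Sees n A ρ 9) a v →
            ∃ w, w ∈ W₁ ∧ (f w).val = a ∧ G.Adj w u := by
          rintro a (h | h | h)
          · exact (h ((hM v).2 hr)).elim
          · exact (hany ((any v).1 h.1)).elim
          · exact (see₁ a u).1 (h.2 u u.2 ((hA.1 _ _).2 hvu) ((any₁ u).2 ⟨w, hw, hwu⟩))
        obtain ⟨w₀, -, e0, a0⟩ := hall 0 h0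
        obtain ⟨w₁, -, e1, a1⟩ := hall 1 h1
        obtain ⟨w₂, -, a2, e2⟩ := hun u hvu ⟨w, hw, hwu⟩
        rw [← e2] at h2
        have n0 : (f w₀).val ≠ f u := fun h => hf _ _ a0 (Fin.ext h)
        have n1 : (f w₁).val ≠ f u := fun h => hf _ _ a1 (Fin.ext h)
        have n2 : (f w₂).val ≠ f u := fun h => hf _ _ a2 (Fin.ext h)
        have := (f u).2
        omega

theorem maskP_keepsReg {x : ℕ} (hx : x ≠ 5 ∧ x ≠ 6 ∧ x ≠ 7) : maskP.KeepsReg x := by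
  simp only [maskP, nest, KeepsReg]
  simp only [and_true, true_and]
  omega

theorem maskP_keepsArr {k : ℕ} (hk : k ≠ 3) : maskP.KeepsArr k := by
  simp [maskP, nest, KeepsArr, hk.symm]

theorem roundP_keepsReg {x : ℕ} (hx : x = 0 ∨ x = 4) : roundP.KeepsReg x := by
  refine ⟨(by omega : 2 ≠ x), maskP_keepsReg (by omega),
    (leafP_keepsReg (by omega)).nest fun y hy => ?_, trivial, (by omega : 1 ≠ x)⟩
  have := mem_guessLoops hy
  omega

theorem roundP_wf : roundP.WF :=
  ⟨trivial, by simp [maskP, nest, KeepsReg, WF],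
    leafP_wf.nest (leafP_keepsReg (by omega)) loops_guessLoops, trivial, trivial⟩

theorem mainP_wf : mainP.WF :=
  ⟨by simp [setupP, KeepsReg, WF], roundP_keepsReg (x := 4) (by decide),
    roundP_keepsReg (x := 0) (by decide), by decide, roundP_wf⟩

theorem mainP_keepsReg : mainP.KeepsReg 0 :=
  ⟨by simp [setupP, KeepsReg], by decide, roundP_keepsReg (.inl rfl)⟩

/-- What holds of a state `t'` reached from `t` while trying guesses: the component in array `3` is
the same, and if register `2` indicates success, then array `1` has a colouring of it. -/
structure Searching (n : ℕ) (A : ℕ → ℕ) (t t' : State) : Prop where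
  base : Base n A t'
  mask : t'.arr 3 = t.arr 3
  fail : t'.reg 1 = t.reg 1
  out : ∀ v, t.arr 3 v = 0 → t'.arr 1 v = t.arr 1 v
  good : t'.reg 2 ≠ 0 → Good n A (fun v => t.arr 3 v ≠ 0) (t'.arr 1)

theorem Searching.setReg {t t' : State} (h : Searching n A t t') {x : ℕ} (hx : 13 ≤ x) (i : ℕ) :
    Searching n A t (t'.setReg x i) := by
  refine ⟨h.base.of_eq (by rw [reg_setReg, if_neg (by omega)]) rfl rfl, h.mask,
    by rw [reg_setReg, if_neg (by omega), h.fail], h.out, ?_⟩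
  rw [reg_setReg, if_neg (by omega)]
  exact h.good

theorem Searching.leafP {t t' : State} (h : Searching n A t t')
    (hsymm : ∀ u < n, ∀ w < n, Edge n A u w → Edge n A w u)
    (hclosed : ∀ u < n, ∀ w < n, t.arr 3 u ≠ 0 → Edge n A u w → t.arr 3 w ≠ 0)
    (hg : Guess n t'.reg) :
    Searching n A t (leafP.den t') ∧ (t'.reg 2 ≠ 0 → (leafP.den t').reg 2 ≠ 0) ∧
      ((∃ F, Sol n (GuessCon n A (fun v => t.arr 3 v ≠ 0) t'.reg) F) →
        (leafP.den t').reg 2 ≠ 0) := by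
  obtain ⟨l1, l2, l3⟩ := den_leafP h.base hsymm hg (by rw [h.mask]; exact hclosed)
  rw [h.mask] at l1 l2 l3
  refine ⟨⟨h.base.den (leafP_keepsReg (by omega)) (leafP_keepsArr (by omega))
    (leafP_keepsArr (by omega)), by rw [den_arr (leafP_keepsArr (by omega)), h.mask],
    by rw [den_reg (leafP_keepsReg (by omega)), h.fail], fun v hv => by rw [l1 v hv, h.out v hv],
    fun hne => ?_⟩, fun hne => ?_, l2⟩
  · rcases l3 with l | l
    · exact l.2
    · rw [l.2]
      exact h.good (by rwa [l.1] at hne)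
  · rcases l3 with l | l
    · exact l.1
    · rwa [l.1]

/-- The search is successful if the constraints of some guess have a solution. -/
theorem den_search {t : State} (ht : Base n A t)
    (hsymm : ∀ u < n, ∀ w < n, Edge n A u w → Edge n A w u)
    (hclosed : ∀ u < n, ∀ w < n, t.arr 3 u ≠ 0 → Edge n A u w → t.arr 3 w ≠ 0) (h2 : t.reg 2 = 0) :
    Searching n A t ((nest guessLoops leafP).den t) ∧
      ((∃ ρ, Guess n ρ ∧ ∃ F, Sol n (GuessCon n A (fun v => t.arr 3 v ≠ 0) ρ) F) →
        ((nest guessLoops leafP).den t).reg 2 ≠ 0) := by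
  have inv0 : ∀ t', Searching n A t t' → t'.reg 0 = n := fun t' h => h.base.reg
  have hreg : ∀ t', ∀ y ∈ guessLoops, ∀ i, Searching n A t t' →
      Searching n A t (t'.setReg y.1 i) := fun t' y hy i h => h.setReg (mem_guessLoops hy) i
  have start : Searching n A t t := ⟨ht, rfl, rfl, fun _ _ => rfl, fun h => (h h2).elim⟩
  have leaf : ∀ t', Searching n A t t' → Valid n guessLoops t'.reg → _ := fun t' h hv =>
    h.leafP hsymm hclosed (valid_guessLoops.1 hv)
  refine ⟨nest_inv loops_guessLoops inv0 hreg (fun t' h hv => (leaf t' h hv).1) t start, ?_⟩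
  rintro ⟨ρ, hρ, F, hF⟩
  refine nest_done loops_guessLoops (valid_guessLoops.2 hρ) (D := fun t' => t'.reg 2 ≠ 0)
    inv0 hreg ?_ (fun t' h hv => (leaf t' h hv).1) ?_
    (fun t' h hd hv => (leaf t' h hv).2.1 hd) t start
  · intro t' y hy i h
    have := mem_guessLoops hy
    rwa [reg_setReg, if_neg (by omega)]
  · intro t' h he
    have he' : ∀ j < 93, t'.reg (20 + j) = ρ (20 + j) := fun j hj =>
      he (20 + j, 1, 1) (List.mem_append_left _
        (List.mem_map_of_mem (f := fun j => (20 + j, 1, 1)) (List.mem_range.2 hj)))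
    have he'' : ∀ j < 93, t'.reg (120 + j) = ρ (120 + j) := fun j hj =>
      he (120 + j, 0, 3) (List.mem_append_right _
        (List.mem_map_of_mem (f := fun j => (120 + j, 0, 3)) (List.mem_range.2 hj)))
    have hs : ∀ k ≤ 93, Sees n A t'.reg k = Sees n A ρ k := by
      intro k hk
      funext a v
      refine propext (exists_congr fun j => and_congr_right fun hj => ?_)
      rw [he' j (by omega), he'' j (by omega)]
    have hg : Guess n t'.reg := fun j hj => by rw [he' j hj, he'' j hj]; exact hρ j hj
    refine (h.leafP hsymm hclosed hg).2.2 ⟨F, ?_⟩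
    rw [GuessCon, hs 93 le_rfl, hs 9 (by omega)]
    exact hF

/-- What `roundP` achieves for the vertex `r`: if it does not report failure in register `1`, then
array `1` has a colouring of the component of `r`. -/
structure Round (G : SimpleGraph (Fin n)) (A : ℕ → ℕ) (r : Fin n) (s t : State) : Prop where
  base : Base n A t
  out : ∀ v : Fin n, ¬G.Reachable r v → t.arr 1 v = s.arr 1 v
  fail : t.reg 1 = 0 → s.reg 1 = 0
  sound : t.reg 1 = 0 → ∀ u : Fin n, G.Reachable r u →
    t.arr 1 u < 3 ∧ ∀ w : Fin n, G.Adj u w → t.arr 1 u ≠ t.arr 1 w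
  complete : G.Colorable 3 → s.reg 1 = 0 → t.reg 1 = 0

theorem den_roundP (H : ShortOdd.NoShort G) (hs : Base n A s) (hA : IsMatrix G A) {r : Fin n}
    (hr : s.reg 4 = r) : Round G A r s (roundP.den s) := by
  have hden : roundP.den s = (ite (.reg 2) skip (assign 1 (.const 1))).den
      ((nest guessLoops leafP).den (maskP.den ((assign 2 (.const 0)).den s))) := by
    rw [roundP, den_seq, den_seq, den_seq]
  rw [hden]
  have hs' : Base n A ((assign 2 (.const 0)).den s) := hs.of_eq rfl rfl rfl
  have hm := den_maskP hs' hA (r := r) (by simpa [den] using hr)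
  have hb := hs'.den (p := maskP) (maskP_keepsReg (by decide)) (maskP_keepsArr (by decide))
    (maskP_keepsArr (by decide))
  have m1 : (maskP.den ((assign 2 (.const 0)).den s)).arr 1 = s.arr 1 :=
    den_arr (maskP_keepsArr (by decide)) _
  have m2 : (maskP.den ((assign 2 (.const 0)).den s)).reg 2 = 0 := by
    rw [den_reg (maskP_keepsReg (by decide))]
    simp [den, Expr.eval]
  have m3 : (maskP.den ((assign 2 (.const 0)).den s)).reg 1 = s.reg 1 := by
    rw [den_reg (maskP_keepsReg (by decide))]
    simp [den]
  generalize maskP.den ((assign 2 (.const 0)).den s) = t at hm hb m1 m2 m3 ⊢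
  have hsymm : ∀ u < n, ∀ w < n, Edge n A u w → Edge n A w u := fun u hu w hw h =>
    (hA.1 ⟨w, hw⟩ ⟨u, hu⟩).2 ((hA.1 ⟨u, hu⟩ ⟨w, hw⟩).1 h).symm
  have hclosed : ∀ u < n, ∀ w < n, t.arr 3 u ≠ 0 → Edge n A u w → t.arr 3 w ≠ 0 :=
    fun u hu w hw h hE => (hm ⟨w, hw⟩).2 (((hm ⟨u, hu⟩).1 h).trans
      ((hA.1 ⟨u, hu⟩ ⟨w, hw⟩).1 hE).reachable)
  obtain ⟨hfin, hfound⟩ := den_search hb hsymm hclosed m2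
  replace hfound : G.Colorable 3 → ((nest guessLoops leafP).den t).reg 2 ≠ 0 := by
    rintro ⟨f⟩
    have hf : ∀ u v, G.Adj u v → f u ≠ f v := fun u v h => f.valid h
    obtain ⟨W₁, W₂, c1, c2, g, hg⟩ := ShortOdd.exists_respects H f hf r
    exact hfound (exists_guess hA hf c1 c2 hg (M := fun v => t.arr 3 v ≠ 0) hm)
  have finish : ∀ t', Searching n A t t' → (G.Colorable 3 → t'.reg 2 ≠ 0) →
      Round G A r s ((ite (.reg 2) skip (assign 1 (.const 1))).den t') := by
    intro t' ⟨h1, _, h3, h4, h5⟩ hfound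
    have hout : ∀ v : Fin n, ¬G.Reachable r v → t'.arr 1 v = s.arr 1 v := fun v hv => by
      rw [h4 v (by simpa using mt (hm v).1 hv), m1]
    by_cases h : t'.reg 2 = 0
    · have he : (ite (.reg 2) skip (assign 1 (.const 1))).den t' = t'.setReg 1 1 := by
        simp [den, Expr.eval, h]
      rw [he]
      exact ⟨h1.of_eq (by simp) rfl rfl, hout, fun h' => by simp at h', fun h' => by simp at h',
        fun hc => (hfound hc h).elim⟩
    · have he : (ite (.reg 2) skip (assign 1 (.const 1))).den t' = t' := by
        simp [den, Expr.eval, h]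
      rw [he]
      refine ⟨h1, hout, fun h' => m3.symm.trans (h3.symm.trans h'), fun _ u hu => ?_,
        fun _ h' => h3.trans (m3.trans h')⟩
      obtain ⟨g1, g2⟩ := h5 h u u.2 ((hm u).2 hu)
      exact ⟨g1, fun w hw => g2 w w.2 ((hA.1 u w).2 hw)⟩
  exact finish _ hfin hfound

theorem den_mainP (H : ShortOdd.NoShort G) :
    ((mainP.den (graphInput G)).reg 1 = 0 → ∀ u : Fin n, (mainP.den (graphInput G)).arr 1 u < 3 ∧
      ∀ w : Fin n, G.Adj u w →
        (mainP.den (graphInput G)).arr 1 u ≠ (mainP.den (graphInput G)).arr 1 w) ∧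
      (G.Colorable 3 → (mainP.den (graphInput G)).reg 1 = 0) := by
  have hA := isMatrix_graphInput G
  have hs := den_setupP G
  have h1 : (setupP.den (graphInput G)).reg 1 = 0 := by
    rw [den_reg (by simp [setupP, KeepsReg])]
    rfl
  rw [mainP, den]
  generalize (graphInput G).arr 0 = A at hA hs
  generalize setupP.den (graphInput G) = s at hs h1 ⊢
  obtain ⟨t, ⟨-, p1, p2⟩, he⟩ := rep_induct (x := 4) (m := 1) (c := 0) (p := roundP)
    (fun i t => Base n A t ∧ (t.reg 1 = 0 → ∀ r u : Fin n, r.val < i → G.Reachable r u →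
      t.arr 1 u < 3 ∧ ∀ w : Fin n, G.Adj u w → t.arr 1 u ≠ t.arr 1 w) ∧
      (G.Colorable 3 → t.reg 1 = 0)) (s := s) ⟨hs, fun _ r u h => by omega, fun _ => h1⟩ (by
    intro i hi t ⟨hb, q1, q2⟩
    rw [hs.reg, one_mul, add_zero] at hi
    obtain ⟨b1, b2, b3, b4, b5⟩ := den_roundP H (s := t.setReg 4 i) (hb.of_eq (by simp) rfl rfl) hA
      (r := ⟨i, hi⟩) (by simp)
    refine ⟨b1, fun h r u hr hru => ?_, fun hc => b5 hc (by simpa using q2 hc)⟩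
    by_cases hiu : G.Reachable ⟨i, hi⟩ u
    · exact b4 h u hiu
    · have hne : r.val ≠ i := fun h => hiu (by rwa [← (Fin.ext h : r = ⟨i, hi⟩)])
      have := q1 (by simpa using b3 h) r u (by omega) hru
      rw [b2 u hiu]
      refine ⟨this.1, fun w hw => ?_⟩
      rw [b2 w fun h => hiu (h.trans hw.symm.reachable)]
      exact this.2 w hw)
  rw [he]
  rw [hs.reg] at p1
  simp only [arr_setReg, reg_setReg, if_neg (by decide : (1 : ℕ) ≠ 4)]
  exact ⟨fun h u => p1 h u u (by omega) (SimpleGraph.Reachable.refl u), p2⟩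

end

end LoopProg

/-- The answer is read off from register `0` (`1` for yes, `0` for no), and a colouring with colours
`0, 1, 2` from the first `n` cells of array `1`. -/
theorem theorem1p2 :
    ∃ (alg : RAM.Program) (T : Polynomial ℕ),
      ∀ (n : ℕ) (G : SimpleGraph (Fin n)),
        IsInducedFree (SimpleGraph.pathGraph 9) G →
        IsInducedFree (SimpleGraph.cycleGraph 3) G →
        IsInducedFree (SimpleGraph.cycleGraph 5) G →
        ∃ (s : RAM.State) (t : ℕ),
          RAM.Exec alg (RAM.graphInput G) s t ∧
          t ≤ T.eval n ∧
          (G.Colorable 3 →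
            s.reg 0 = 1 ∧ ∃ c : G.Coloring (Fin 3), ∀ v : Fin n, s.arr 1 v.val = (c v).val) ∧
          (¬ G.Colorable 3 → s.reg 0 = 0) := by
  refine ⟨.seq LoopProg.mainP.compile (.assign 0 (.sub (.const 1) (.reg 1))),
    LoopProg.mainP.cost + 4, fun n G h9 h3 h5 => ?_⟩
  obtain ⟨t, ht, hexec⟩ := LoopProg.LProg.exec_compile LoopProg.mainP_wf LoopProg.mainP_keepsReg
    (RAM.graphInput G)
  obtain ⟨p1, p2⟩ := LoopProg.den_mainP (ShortOdd.noShort h9 h3 h5)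
  refine ⟨_, _, .seq hexec (.assign _ _ _), ?_, fun hc => ?_, fun hc => ?_⟩
  · have : (RAM.graphInput G).reg 0 = n := rfl
    rw [this] at ht
    simp only [RAM.Expr.cost, Polynomial.eval_add, Polynomial.eval_ofNat]
    omega
  · have h0 := p2 hc
    refine ⟨by simp [RAM.Expr.eval, h0], SimpleGraph.Coloring.mk
      (fun v => ⟨_, (p1 h0 v).1⟩) fun {u w} h he => (p1 h0 u).2 w h ?_, fun v => rfl⟩
    simpa using he
  · simp only [RAM.Expr.eval, LoopProg.reg_setReg, if_true]
    by_contra hne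
    refine hc ⟨SimpleGraph.Coloring.mk (fun v => ⟨_, (p1 (by omega) v).1⟩)
      fun {u w} h he => (p1 (by omega) u).2 w h ?_⟩
    simpa using he
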